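/- **Setting.** Let $(M,g)$ be a connected, paracompact, Hausdorff smooth manifold with a (pseudo-)Riemannian metric of any signature. Let $G$ be a compact Lie group, $\rho_H:G\to O(W)$ a faithful orthogonal representation on a finite-dimensional real Euclidean space $W$ (a unitary representation being regarded as a real one), with derived representation $\rho_H'$, and let $\beta$ be an $\mathrm{Ad}$-invariant inner product on $\mathrm{Lie}(G)$. Let $P\to M$ be a smooth principal $G$-bundle. Let $V_H:W\to\mathbb R$ be a general Higgs potential: smooth, bounded below, $G$-invariant, with Hessian positive definite transversally to each orbit of minima. Let $z_0$ be a (global) minimum of $V_H$ and $H=\{g:\rho_H(g)z_0=z_0\}$ its isotropy group. Put $\mathrm{Lie}(H)^\perp=$ the $\beta$-orthogonal complement of $\mathrm{Lie}(H)$ in $\mathrm{Lie}(G)$, $W_G=\rho_H'(\mathrm{Lie}(H)^\perp)z_0$, $W_{H,phys}=W_G^\perp$. The mass matrices $\mathbf M^2_H(z_0)\in\mathrm{End}(W)$, $\mathbf M^2_{YM}(z_0)\in\mathrm{End}(\mathrm{Lie}(G))$ are defined by $$\mathbf M^2_H(z_0)z\cdot z'=\mathrm{Hess}(V_H)(z_0)(z,z'),\qquad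 \beta(\mathbf M^2_{YM}(z_0)\eta,\eta')=2\,\rho_H'(\eta)z_0\cdot\rho_H'(\eta')z_0 .$$ Fix a sign $s\in\{1,-1\}$ and constants $c_{YM},c_H,c_V>0$. The Yang–Mills–Higgs action of a connection $A$ on $P$ with curvature $F_A$ and a section $\Phi$ of the Higgs bundle $P\times_{\rho_H}W$ is $$\mathcal I(A,\Phi)=s\,c_{YM}\langle F_A,F_A\rangle+c_H\langle\partial_A\Phi,\partial_A\Phi\rangle+s\,c_V\int_M V_H(\Phi)\,d\mathrm{vol}_g ,$$ where $\langle\cdot,\cdot\rangle$ is the $L^2$-pairing of forms given by $g$ and by $\beta$ resp. the inner product of $W$ (so $\langle F,F\rangle=\int\tfrac12\beta(F_{ij},F^{ij})$). A vacuum is a reduction $Q\subset P$ of $P$ to $H$; its vacuum section is $\mathcal V(x)=[(q,z_0)]$, $q\in Q_x$. A vacuum pair $(\Xi,\mathcal V)$ consists of a vacuum section and a flat connection $\Xi$ on $P$ that is compatible with it, i.e. whose connection form restricted to $Q$ has values in $\mathrm{Lie}(H)$. Then $\mathbf M^2_H(z_0)$, $\mathbf M^2_{YM}(z_0)$ define endomorphism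 fields of $Q\times_HW$ and $Q\times_H\mathrm{Lie}(G)$; write $M^2_{H,phys}$, $M^2_{YM,G}$ for their parts on $Q\times_HW_{H,phys}$ and on $Q\times_H\mathrm{Lie}(H)^\perp$ (which is isomorphic to the Goldstone bundle $Q\times_HW_G$). A fluctuation of the vacuum pair is a family, $0\le t\le1$, $$A_t=\Xi+t\,(A_H+A_G),\qquad \Phi_t=\mathcal V+t\,\Phi_{phys},$$ with smooth 1-forms $A_H$, $A_G$ on $M$ with values in $\mathrm{ad}(Q)=Q\times_H\mathrm{Lie}(H)$ and in $Q\times_H\mathrm{Lie}(H)^\perp$, and a smooth section $\Phi_{phys}$ of $Q\times_HW_{H,phys}$. **Proposition.** Let $(A_t,\Phi_t)$ be a fluctuation of a vacuum pair $(\Xi,\mathcal V)$. Then $(A_t,\Phi_t)$ satisfies the Euler–Lagrange equations of $\mathcal I$ up to order $O(t^2)$ (for every compactly supported smooth variation, supported in a coordinate patch over which $P$ is trivialized, the first variation of $\mathcal I$ at $(A_t,\Phi_t)$ is $O(t^2)$ as $t\to0$) if and only if $$\delta\partial A_H=0,$$ $$\delta\partial A_G+\tfrac{s\,c_H}{2c_{YM}}\,M^2_{YM,G}A_G=0,$$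 $$\delta\partial\Phi_{phys}+\tfrac{s\,c_V}{2c_H}\,M^2_{H,phys}\Phi_{phys}=0 .$$ Here $\partial$ is the (exterior) covariant derivative of the flat connection $\Xi$ on the respective bundle and $\delta$ its formal adjoint. In particular, for $s=1$ and $c_H=2c_{YM}$, $c_V=2c_H$ the massive equations read $\delta\partial A_G+M^2_{YM,G}A_G=0$ and $\delta\partial\Phi_{phys}+M^2_{H,phys}\Phi_{phys}=0$. -/

import Mathlib

open scoped Manifold ContDiff InnerProductSpace Topology
open Set

set_option linter.unusedSectionVars false

noncomputable section

namespace YMH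

universe u

/-- Coordinate space of an `n`-dimensional spacetime. -/
abbrev Coord (n : ℕ) := EuclideanSpace ℝ (Fin n)

/-- Linear endomorphisms of the typical fibre. -/
abbrev Endo (W : Type*) [NormedAddCommGroup W] [InnerProductSpace ℝ W] := W →L[ℝ] W

/-! ### The structure group, its Lie algebra, and the invariant inner product -/

/-- A faithful continuous orthogonal representation of `G` on a Euclidean space
`W` (for instance `ℝ^N`, or `ℂ^N` with its real inner product). For compact `G` it identifies `G`
with a closed subgroup of `O(W)`, so that `G` is a compact Lie group and a map into `G` is
smooth if and only if its composite with the representation is smooth. -/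
structure OrthogonalRep (G : Type*) [Group G] [TopologicalSpace G]
    (W : Type*) [NormedAddCommGroup W] [InnerProductSpace ℝ W] where
  toHom : G →* Endo W
  inner_map : ∀ g v w, ⟪toHom g v, toHom g w⟫_ℝ = ⟪v, w⟫_ℝ
  continuous_toHom : Continuous toHom
  faithful : Function.Injective toHom

variable {G : Type*} [Group G] [TopologicalSpace G]
  {W : Type*} [NormedAddCommGroup W] [InnerProductSpace ℝ W] [FiniteDimensional ℝ W]

namespace OrthogonalRep

instance : CoeFun (OrthogonalRep G W) (fun _ => G → Endo W) := ⟨fun ρ => ρ.toHom⟩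

variable (ρ : OrthogonalRep G W)

lemma map_mul (g h : G) : ρ (g * h) = ρ g * ρ h := ρ.toHom.map_mul g h

lemma map_one : ρ (1 : G) = 1 := ρ.toHom.map_one

/-- The Lie algebra of a subgroup `S` of `G`, as a subspace of `End(W)` by means of the (injective)
derived representation: the velocities at the identity of curves in `S`. -/
def lieAlg (S : Subgroup G) : Submodule ℝ (Endo W) where
  carrier := {X | ∃ γ : ℝ → G, (∀ t, γ t ∈ S) ∧ γ 0 = 1 ∧ HasDerivAt (fun t => ρ (γ t)) X 0}
  zero_mem' := ⟨fun _ => 1, fun _ => S.one_mem, rfl, hasDerivAt_const _ _⟩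
  add_mem' := by
    rintro X Y ⟨γ, hγ, hγ0, hX⟩ ⟨η, hη, hη0, hY⟩
    refine ⟨fun t => γ t * η t, fun t => S.mul_mem (hγ t) (hη t), by simp [hγ0, hη0], ?_⟩
    have h := hX.mul hY
    rw [hγ0, hη0, map_one, mul_one, one_mul] at h
    refine h.congr_of_eventuallyEq (Filter.Eventually.of_forall fun t => ?_)
    simp [map_mul]
  smul_mem' := by
    rintro c X ⟨γ, hγ, hγ0, hX⟩
    refine ⟨fun t => γ (c * t), fun t => hγ _, by simp [hγ0], ?_⟩
    have h1 : HasDerivAt (fun t : ℝ => c * t) c 0 := by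
      simpa using (hasDerivAt_id (0 : ℝ)).const_mul c
    have h2 : HasDerivAt (fun t => ρ (γ t)) X (c * 0) := by simpa using hX
    exact h2.scomp (0 : ℝ) h1

/-- `Lie(G)`. -/
abbrev lie : Submodule ℝ (Endo W) := ρ.lieAlg ⊤

/-- The adjoint representation `Ad_g X = ρ(g) X ρ(g)⁻¹` on `Lie(G)`. -/
def Ad (g : G) : ρ.lie →ₗ[ℝ] ρ.lie where
  toFun X := ⟨ρ g * X.1 * ρ g⁻¹, by
    obtain ⟨γ, -, hγ0, hX⟩ := X.2
    refine ⟨fun t => g * γ t * g⁻¹, fun _ => Subgroup.mem_top _, by simp [hγ0], ?_⟩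
    have h := (hX.const_mul (ρ g)).mul_const (ρ g⁻¹)
    refine h.congr_of_eventuallyEq (Filter.Eventually.of_forall fun t => ?_)
    simp [map_mul]⟩
  map_add' X Y := by ext1; simp [mul_add, add_mul]
  map_smul' c X := by ext1; simp

lemma map_mul_map_inv (g : G) : ρ g * ρ g⁻¹ = 1 := by
  rw [← map_mul, mul_inv_cancel, map_one]

lemma bracket_mem {X Y : Endo W} (hX : X ∈ ρ.lie) (hY : Y ∈ ρ.lie) :
    X * Y - Y * X ∈ ρ.lie := by
  obtain ⟨γ, -, hγ0, hγ⟩ := hX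
  have : CompleteSpace W := FiniteDimensional.complete ℝ W
  have hstar : ∀ t, ρ (γ t)⁻¹ = star (ρ (γ t)) := fun t => by
    have h : star (ρ (γ t)) * ρ (γ t) = 1 := by
      ext1 v
      refine ext_inner_right ℝ fun w => ?_
      rw [ContinuousLinearMap.star_eq_adjoint]
      change ⟪ContinuousLinearMap.adjoint (ρ (γ t)) (ρ (γ t) v), w⟫_ℝ = ⟪v, w⟫_ℝ
      rw [ContinuousLinearMap.adjoint_inner_left, ρ.inner_map]
    calc ρ (γ t)⁻¹ = star (ρ (γ t)) * ρ (γ t) * ρ (γ t)⁻¹ := by rw [h, one_mul]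
      _ = star (ρ (γ t)) := by rw [mul_assoc, map_mul_map_inv, mul_one]
  have hi : HasDerivAt (fun t => ρ (γ t)⁻¹) (star X) 0 :=
    hγ.star.congr_of_eventuallyEq (Filter.Eventually.of_forall hstar)
  have e0 : ρ (γ 0)⁻¹ = 1 := by rw [hγ0, inv_one, map_one]
  have e1 : ρ (γ 0) = 1 := by rw [hγ0, map_one]
  have hX : star X = -X := by
    have h := hγ.mul hi
    rw [e0, e1, mul_one, one_mul] at h
    have hc : HasDerivAt ((fun t => ρ (γ t)) * fun t => ρ (γ t)⁻¹) (0 : Endo W) 0 :=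
      (hasDerivAt_const (0 : ℝ) (1 : Endo W)).congr_of_eventuallyEq
        (Filter.Eventually.of_forall fun t => ρ.map_mul_map_inv (γ t))
    exact (neg_eq_of_add_eq_zero_right (h.unique hc)).symm
  have hd : HasDerivAt (fun t => ρ (γ t) * Y * ρ (γ t)⁻¹) (X * Y - Y * X) 0 := by
    have h := (hγ.mul_const Y).mul hi
    rw [e0, e1, hX] at h
    have h3 : X * Y * 1 + 1 * Y * -X = X * Y - Y * X := by noncomm_ring
    rw [h3] at h
    exact h
  have hcl : IsClosed (ρ.lie : Set (Endo W)) := Submodule.closed_of_finiteDimensional _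
  refine hcl.mem_of_tendsto hd.tendsto_slope_zero (Filter.Eventually.of_forall fun t => ?_)
  refine ρ.lie.smul_mem _ (ρ.lie.sub_mem ?_ ?_)
  · exact (ρ.Ad (γ (0 + t)) ⟨Y, hY⟩).2
  · exact (ρ.Ad (γ 0) ⟨Y, hY⟩).2

/-- The Lie bracket of `Lie(G)`. -/
def bracket (X Y : ρ.lie) : ρ.lie := ⟨X.1 * Y.1 - Y.1 * X.1, ρ.bracket_mem X.2 Y.2⟩

/-- The isotropy group `H = I(z₀)`. -/
def isotropy (z₀ : W) : Subgroup G where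
  carrier := {g | ρ g z₀ = z₀}
  one_mem' := by simp [map_one]
  mul_mem' := by
    intro a b ha hb
    simp only [mem_ofPred_eq] at ha hb ⊢
    rw [map_mul, mul_apply_eq_comp, hb, ha]
  inv_mem' := by
    intro a ha
    simp only [mem_ofPred_eq] at ha ⊢
    have h : (ρ a⁻¹ * ρ a) z₀ = z₀ := by rw [← map_mul, inv_mul_cancel, map_one]; rfl
    rwa [mul_apply_eq_comp, ha] at h

/-- `Lie(H)` as a subspace of `Lie(G)`, where `H = I(z₀)`. -/
def lieH (z₀ : W) : Submodule ℝ ρ.lie :=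
  (ρ.lieAlg (ρ.isotropy z₀)).comap ρ.lie.subtype

end OrthogonalRep

/-- An `Ad(G)`-invariant inner product on `Lie(G)`. For semi-simple `G` it is the general
(sign-reversed) Killing form, with one coupling constant for each simple ideal. -/
structure InvariantForm (ρ : OrthogonalRep G W) where
  toBilin : LinearMap.BilinForm ℝ ρ.lie
  symm : ∀ X Y, toBilin X Y = toBilin Y X
  pos : ∀ X, X ≠ 0 → 0 < toBilin X X
  invariant : ∀ g X Y, toBilin (ρ.Ad g X) (ρ.Ad g Y) = toBilin X Y

namespace InvariantForm

variable {ρ : OrthogonalRep G W} (β : InvariantForm ρ) (z₀ : W)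

lemma nondegenerate : β.toBilin.Nondegenerate := by
  refine ⟨fun X hX => ?_, fun X hX => ?_⟩ <;>
  · by_contra h
    exact absurd (hX X) (β.pos X h).ne'

/-- `Lie(H)^⊥`, the orthogonal complement of `Lie(H)` in `Lie(G)`. -/
def lieHPerp : Submodule ℝ ρ.lie where
  carrier := {X | ∀ Y ∈ ρ.lieH z₀, β.toBilin X Y = 0}
  zero_mem' := by simp
  add_mem' := by
    intro X Y hX hY Z hZ
    simp [hX Z hZ, hY Z hZ]
  smul_mem' := by
    intro c X hX Z hZ
    simp [hX Z hZ]

/-- The Goldstone space `W_G = {X z₀ | X ∈ Lie(H)^⊥}`. -/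
def goldstone : Submodule ℝ (W) :=
  (β.lieHPerp z₀).map
    ((ContinuousLinearMap.apply ℝ (W) z₀ : Endo W →ₗ[ℝ] W) ∘ₗ ρ.lie.subtype)

/-- The physical Higgs space `W_{H,phys} = W_G^⊥`. -/
def physHiggs : Submodule ℝ (W) := (β.goldstone z₀)ᗮ

/-- The form `(X, Y) ↦ 2 (X z₀) · (Y z₀)` on `Lie(G)`. -/
def massForm (ρ : OrthogonalRep G W) (z₀ : W) : ρ.lie →ₗ[ℝ] Module.Dual ℝ ρ.lie :=
  LinearMap.mk₂ ℝ (fun X Y => 2 * ⟪X.1 z₀, Y.1 z₀⟫_ℝ)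
    (by intro X X' Y; simp [inner_add_left, mul_add])
    (by intro c X Y; simp [inner_smul_left]; ring)
    (by intro X Y Y'; simp [inner_add_right, mul_add])
    (by intro c X Y; simp [inner_smul_right]; ring)

/-- The mass matrix `M²_YM(z₀)` of the gauge boson:
`β (M²_YM(z₀) X, Y) = 2 (X z₀) · (Y z₀)`. -/
def massYM : ρ.lie →ₗ[ℝ] ρ.lie :=
  (β.toBilin.toDual β.nondegenerate).symm.toLinearMap ∘ₗ massForm ρ z₀

lemma massYM_spec (X Y : ρ.lie) :
    β.toBilin (β.massYM z₀ X) Y = 2 * ⟪X.1 z₀, Y.1 z₀⟫_ℝ := by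
  simp only [massYM, LinearMap.comp_apply, LinearEquiv.coe_coe]
  rw [LinearMap.BilinForm.apply_toDual_symm_apply]
  rfl

end InvariantForm

/-- The Hessian of `V` at `z`. -/
def hess (V : W → ℝ) (z : W) : W →L[ℝ] W →L[ℝ] ℝ :=
  fderiv ℝ (fderiv ℝ V) z

/-- The mass matrix `M²_H(z₀)` of the Higgs boson: `M²_H(z₀) z · z' = Hess V (z₀) (z, z')`. -/
def massH (V : W → ℝ) (z₀ z : W) : W :=
  haveI : CompleteSpace W := FiniteDimensional.complete ℝ W
  (InnerProductSpace.toDual ℝ (W)).symm (hess V z₀ z)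

lemma massH_spec (V : W → ℝ) (z₀ z w : W) :
    ⟪massH V z₀ z, w⟫_ℝ = hess V z₀ z w := by
  simp [massH]

/-- A general Higgs potential: smooth, bounded from below, `G`-invariant, and with Hessian positive
definite transversally to each orbit of minima. -/
structure IsHiggsPotential (ρ : OrthogonalRep G W) (V : W → ℝ) : Prop where
  smooth : ContDiff ℝ ∞ V
  bddBelow : BddBelow (range V)
  invariant : ∀ g z, V (ρ g z) = V z
  transversal : ∀ z, (∀ w, V z ≤ V w) → ∀ w : W, w ≠ 0 →
    (∀ X : ρ.lie, ⟪w, X.1 z⟫_ℝ = 0) → 0 < hess V z w w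

/-! ### Spacetime -/

variable {n : ℕ} {M : Type*} [TopologicalSpace M] [ChartedSpace (Coord n) M]

/-- The coordinate vector `e_i`. -/
abbrev basisVec {n : ℕ} (i : Fin n) : Coord n := EuclideanSpace.single i (1 : ℝ)

/-- The components `θ_i` of a 1-form on `M` (with values in `F`), in the chart `c`. -/
def pullForm {F : Type*} [AddCommGroup F] [Module ℝ F]
    (c : OpenPartialHomeomorph M (Coord n))
    (θ : ∀ x : M, TangentSpace 𝓘(ℝ, Coord n) x →ₗ[ℝ] F) (i : Fin n) (y : Coord n) : F :=
  θ (c.symm y) (mfderiv 𝓘(ℝ, Coord n) 𝓘(ℝ, Coord n) c.symm y (basisVec i))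

/-- The partial derivative `∂_i f`. -/
def pd {F : Type*} [NormedAddCommGroup F] [NormedSpace ℝ F] (i : Fin n) (f : Coord n → F)
    (y : Coord n) : F :=
  fderiv ℝ f y (basisVec i)

/-- The components `g_ij` of a field of bilinear forms in the chart `c`. -/
def metricMatrix (c : OpenPartialHomeomorph M (Coord n))
    (g : ∀ x : M, TangentSpace 𝓘(ℝ, Coord n) x →L[ℝ] TangentSpace 𝓘(ℝ, Coord n) x →L[ℝ] ℝ)
    (y : Coord n) : Matrix (Fin n) (Fin n) ℝ :=
  Matrix.of fun i j =>
    g (c.symm y) (mfderiv 𝓘(ℝ, Coord n) 𝓘(ℝ, Coord n) c.symm y (basisVec i))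
      (mfderiv 𝓘(ℝ, Coord n) 𝓘(ℝ, Coord n) c.symm y (basisVec j))

/-- The smooth coordinate charts of `M`. -/
abbrev charts (n : ℕ) (M : Type*) [TopologicalSpace M] [ChartedSpace (Coord n) M] :
    Set (OpenPartialHomeomorph M (Coord n)) :=
  IsManifold.maximalAtlas 𝓘(ℝ, Coord n) ∞ M

/-- A smooth (pseudo-)Riemannian metric on `M`, of any signature. -/
structure PseudoMetric (n : ℕ) (M : Type*) [TopologicalSpace M] [ChartedSpace (Coord n) M] where
  toFun : ∀ x : M, TangentSpace 𝓘(ℝ, Coord n) x →L[ℝ] TangentSpace 𝓘(ℝ, Coord n) x →L[ℝ] ℝ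
  symm : ∀ x v w, toFun x v w = toFun x w v
  nondegenerate : ∀ x v, (∀ w, toFun x v w = 0) → v = 0
  smooth : ∀ c ∈ charts n M, ∀ i j, ContDiffOn ℝ ∞ (fun y => metricMatrix c toFun y i j) c.target

/-! ### The principal bundle, its sections, forms and connections -/

/-- A smooth principal `G`-bundle over `M`: a family of fibres with simply transitive right `G`-action,
together with local sections whose domains cover `M` and whose transition functions are smooth
(so that `(x, g) ↦ sec i x · g` are the local trivializations). -/
structure PrincipalBundle (ρ : OrthogonalRep G W) (n : ℕ) (M : Type*) [TopologicalSpace M]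
    [ChartedSpace (Coord n) M] where
  Fiber : M → Type u
  act : ∀ {x}, Fiber x → G → Fiber x
  act_one : ∀ {x} (p : Fiber x), act p 1 = p
  act_mul : ∀ {x} (p : Fiber x) (g h : G), act p (g * h) = act (act p g) h
  act_bijective : ∀ {x} (p : Fiber x), Function.Bijective (act p)
  Index : Type u
  dom : Index → Set M
  isOpen_dom : ∀ i, IsOpen (dom i)
  cover : ∀ x, ∃ i, x ∈ dom i
  sec : Index → ∀ x, Fiber x
  smooth_transition : ∀ i j,
    ContMDiffOn 𝓘(ℝ, Coord n) 𝓘(ℝ, Endo W) ∞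
      (fun x => ρ ((act_bijective (sec i x)).2 (sec j x)).choose) (dom i ∩ dom j)

namespace PrincipalBundle

variable {ρ : OrthogonalRep G W} (B : PrincipalBundle.{u} ρ n M)

/-- The unique `g` with `p · g = q`. -/
def diff {x : M} (p q : B.Fiber x) : G := ((B.act_bijective p).2 q).choose

lemma act_diff {x : M} (p q : B.Fiber x) : B.act p (B.diff p q) = q :=
  ((B.act_bijective p).2 q).choose_spec

/-- A local gauge: a smooth local section of the principal bundle over an open set. (The value of
`sec` outside `dom` is irrelevant.) -/
structure Gauge where
  dom : Set M
  isOpen_dom : IsOpen dom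
  sec : ∀ x, B.Fiber x
  smooth : ∀ i, ContMDiffOn 𝓘(ℝ, Coord n) 𝓘(ℝ, Endo W) ∞
    (fun x => ρ (B.diff (B.sec i x) (sec x))) (B.dom i ∩ dom)

/-- The transition function `γ` with `τ = σ γ`, as an endomorphism-valued map. -/
def transition (σ τ : B.Gauge) (x : M) : Endo W := ρ (B.diff (σ.sec x) (τ.sec x))

/-- The differential `dγ` of the transition function. -/
def dTransition (σ τ : B.Gauge) (x : M) (v : TangentSpace 𝓘(ℝ, Coord n) x) : Endo W :=
  mfderiv 𝓘(ℝ, Coord n) 𝓘(ℝ, Endo W) (B.transition σ τ) x v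

/-- The coordinate domain on which both the chart `c` and the gauge `σ` are defined. -/
def patch (c : OpenPartialHomeomorph M (Coord n)) (σ : B.Gauge) : Set (Coord n) :=
  c.target ∩ c.symm ⁻¹' σ.dom

/-- A smooth section of the Higgs bundle `P ×_ρ W`, as a `ρ`-equivariant map on `P`. -/
structure HiggsField where
  toFun : ∀ x, B.Fiber x → W
  equivariant : ∀ x (p : B.Fiber x) g, toFun x (B.act p g) = ρ g⁻¹ (toFun x p)
  smooth : ∀ σ : B.Gauge,
    ContMDiffOn 𝓘(ℝ, Coord n) 𝓘(ℝ, W) ∞ (fun x => toFun x (σ.sec x)) σ.dom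

/-- A smooth 1-form on `M` with values in the adjoint bundle `P ×_G Lie(G)`, as an `Ad`-equivariant
map on `P`. -/
structure AdForm where
  toFun : ∀ x, B.Fiber x → TangentSpace 𝓘(ℝ, Coord n) x →ₗ[ℝ] ρ.lie
  equivariant : ∀ x (p : B.Fiber x) g v, toFun x (B.act p g) v = ρ.Ad g⁻¹ (toFun x p v)
  smooth : ∀ σ : B.Gauge, ∀ c ∈ charts n M, ∀ i,
    ContDiffOn ℝ ∞ (pullForm c (fun x => toFun x (σ.sec x)) i) (B.patch c σ)

/-- A smooth connection on the principal bundle, given by the pull-backs `A_σ = σ^* ω` of its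
connection form `ω` along all local gauges, which obey
`A_{σ γ} = γ⁻¹ A_σ γ + γ⁻¹ dγ`. -/
structure Connection where
  form : B.Gauge → ∀ x : M, TangentSpace 𝓘(ℝ, Coord n) x →ₗ[ℝ] ρ.lie
  gauge_change : ∀ (σ τ : B.Gauge), ∀ x ∈ σ.dom ∩ τ.dom, ∀ v,
    (form τ x v : Endo W) =
      ρ (B.diff (σ.sec x) (τ.sec x))⁻¹ * (form σ x v : Endo W) * B.transition σ τ x
      + ρ (B.diff (σ.sec x) (τ.sec x))⁻¹ * B.dTransition σ τ x v
  smooth : ∀ σ : B.Gauge, ∀ c ∈ charts n M, ∀ i,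
    ContDiffOn ℝ ∞ (pullForm c (form σ) i) (B.patch c σ)

variable {B}

/-- Coordinate expression of a Higgs field. -/
def HiggsField.loc (Φ : B.HiggsField) (c : OpenPartialHomeomorph M (Coord n)) (σ : B.Gauge)
    (y : Coord n) : W := Φ.toFun (c.symm y) (σ.sec (c.symm y))

/-- Coordinate expression of an `ad(P)`-valued 1-form. -/
def AdForm.loc (a : B.AdForm) (c : OpenPartialHomeomorph M (Coord n)) (σ : B.Gauge) :
    Fin n → Coord n → ρ.lie := pullForm c fun x => a.toFun x (σ.sec x)

/-- Coordinate expression (local gauge potential) of a connection. -/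
def Connection.loc (A : B.Connection) (c : OpenPartialHomeomorph M (Coord n)) (σ : B.Gauge) :
    Fin n → Coord n → ρ.lie := pullForm c (A.form σ)

end PrincipalBundle

/-! ### Gauge calculus in coordinates

Here `A` is a local gauge potential and `h` is the matrix `(g_ij)` of the metric. -/

section LocalCalculus

variable {ρ : OrthogonalRep G W}

/-- The field strength `F_ij = ∂_i A_j - ∂_j A_i + [A_i, A_j]`. -/
def curvature (A : Fin n → Coord n → ρ.lie) (y : Coord n) (i j : Fin n) : ρ.lie :=
  pd i (A j) y - pd j (A i) y
    + ρ.bracket (A i y) (A j y)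

/-- The covariant derivative `D_i Φ = ∂_i Φ + A_i Φ` of a Higgs field. -/
def covDeriv (A : Fin n → Coord n → ρ.lie) (Φ : Coord n → W) (y : Coord n)
    (i : Fin n) : W :=
  pd i Φ y + (A i y).1 (Φ y)

/-- The exterior covariant derivative of an adjoint-valued 1-form:
`(∂a)_ij = ∂_i a_j - ∂_j a_i + [A_i, a_j] - [A_j, a_i]`. -/
def extCovDeriv (A a : Fin n → Coord n → ρ.lie) (y : Coord n) (i j : Fin n) : ρ.lie :=
  pd i (a j) y - pd j (a i) y
    + ρ.bracket (A i y) (a j y)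
    - ρ.bracket (A j y) (a i y)

/-- The volume density `√|det g|`. -/
def volDensity (h : Coord n → Matrix (Fin n) (Fin n) ℝ) (y : Coord n) : ℝ := √|(h y).det|

/-- `√|det g| θ^{ij} = √|det g| g^{ik} g^{jl} θ_kl`. -/
def raiseTwo (h : Coord n → Matrix (Fin n) (Fin n) ℝ) (θ : Coord n → Fin n → Fin n → ρ.lie)
    (i j : Fin n) (y : Coord n) : ρ.lie :=
  volDensity h y • ∑ k, ∑ l, ((h y)⁻¹ i k * (h y)⁻¹ j l) • θ y k l

/-- `√|det g| η^i = √|det g| g^{ij} η_j`. -/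
def raiseOne (h : Coord n → Matrix (Fin n) (Fin n) ℝ) (η : Coord n → Fin n → W)
    (i : Fin n) (y : Coord n) : W :=
  volDensity h y • ∑ j, (h y)⁻¹ i j • η y j

/-- The covariant co-derivative (formal adjoint of the exterior covariant derivative) of an
adjoint-valued 2-form: `(δθ)_j = - g_jk |g|^{-1/2} D_i (|g|^{1/2} θ^{ik})`. -/
def coDerivTwo (h : Coord n → Matrix (Fin n) (Fin n) ℝ) (A : Fin n → Coord n → ρ.lie)
    (θ : Coord n → Fin n → Fin n → ρ.lie) (y : Coord n) (j : Fin n) : ρ.lie :=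
  -((volDensity h y)⁻¹ • ∑ k, h y j k • ∑ i,
    (pd i (raiseTwo h θ i k) y + ρ.bracket (A i y) (raiseTwo h θ i k y)))

/-- The covariant co-derivative (formal adjoint of the covariant derivative) of a 1-form with values
in the Higgs bundle: `δη = - |g|^{-1/2} D_i (|g|^{1/2} η^i)`. -/
def coDerivOne (h : Coord n → Matrix (Fin n) (Fin n) ℝ) (A : Fin n → Coord n → ρ.lie)
    (η : Coord n → Fin n → W) (y : Coord n) : W :=
  -((volDensity h y)⁻¹ • ∑ i,
    (pd i (raiseOne h η i) y + (A i y).1 (raiseOne h η i y)))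

/-- Sign and normalization of the Yang-Mills-Higgs action
`s cYM ⟨F, F⟩ + cH ⟨DΦ, DΦ⟩ + s cV ∫ V(Φ)`. -/
structure Normalization where
  s : ℝ
  s_sign : s = 1 ∨ s = -1
  cYM : ℝ
  cYM_pos : 0 < cYM
  cH : ℝ
  cH_pos : 0 < cH
  cV : ℝ
  cV_pos : 0 < cV

/-- The Yang-Mills-Higgs Lagrangian; `½ F_ij F^ij` is the squared norm of the 2-form `F`. -/
def lagrangian (k : Normalization) (β : InvariantForm ρ) (V : W → ℝ)
    (h : Coord n → Matrix (Fin n) (Fin n) ℝ)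
    (A : Fin n → Coord n → ρ.lie) (Φ : Coord n → W) (y : Coord n) : ℝ :=
  k.s * k.cYM * ((1 / 2) * ∑ i, ∑ j, ∑ a, ∑ b,
      (h y)⁻¹ i a * (h y)⁻¹ j b * β.toBilin (curvature A y i j) (curvature A y a b))
    + k.cH * (∑ i, ∑ j, (h y)⁻¹ i j * ⟪covDeriv A Φ y i, covDeriv A Φ y j⟫_ℝ)
    + k.s * k.cV * V (Φ y)

/-- The Yang-Mills-Higgs action over a compact region `K` of a coordinate patch. -/
def action (k : Normalization) (β : InvariantForm ρ) (V : W → ℝ)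
    (h : Coord n → Matrix (Fin n) (Fin n) ℝ) (K : Set (Coord n))
    (A : Fin n → Coord n → ρ.lie) (Φ : Coord n → W) : ℝ :=
  ∫ y in K, lagrangian k β V h A Φ y * volDensity h y

end LocalCalculus

/-! ### Vacua, vacuum pairs and fluctuations -/

namespace PrincipalBundle

variable {ρ : OrthogonalRep G W} {B : PrincipalBundle.{u} ρ n M}

/-- A connection is flat if its field strength vanishes. -/
def Connection.IsFlat (A : B.Connection) : Prop :=
  ∀ c ∈ charts n M, ∀ σ : B.Gauge, ∀ y ∈ B.patch c σ, ∀ i j, curvature (A.loc c σ) y i j = 0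

variable (B) in
/-- A vacuum with respect to `z₀`: a reduction `Q ⊆ P` of the principal bundle to the isotropy
group `H = I(z₀)`. -/
structure Vacuum (z₀ : W) where
  Q : ∀ x, Set (B.Fiber x)
  act_mem_iff : ∀ x, ∀ q ∈ Q x, ∀ g, B.act q g ∈ Q x ↔ g ∈ ρ.isotropy z₀
  exists_gauge : ∀ x, ∃ τ : B.Gauge, x ∈ τ.dom ∧ ∀ y ∈ τ.dom, τ.sec y ∈ Q y

namespace Vacuum

variable {z₀ : W} (𝒬 : B.Vacuum z₀)

lemma nonempty (x : M) : (𝒬.Q x).Nonempty := by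
  obtain ⟨τ, hx, h⟩ := 𝒬.exists_gauge x
  exact ⟨_, h x hx⟩

/-- A reference point of `Q` over `x`; the objects defined by means of it do not depend on the
choice. -/
def point (x : M) : B.Fiber x := (𝒬.nonempty x).choose

/-- The vacuum section `x ↦ [(q, z₀)]`, `q ∈ Q_x`, as an equivariant map on `P`:
`ν (q · g) = ρ(g)⁻¹ z₀`. -/
def vacuumSection (x : M) (p : B.Fiber x) : W := ρ (B.diff (𝒬.point x) p)⁻¹ z₀

/-- The global mass matrix of the Higgs boson, `q · g ↦ ρ(g)⁻¹ M²_H(z₀) ρ(g)`. -/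
def globalMassH (V : W → ℝ) (x : M) (p : B.Fiber x) (w : W) : W :=
  ρ (B.diff (𝒬.point x) p)⁻¹ (massH V z₀ (ρ (B.diff (𝒬.point x) p) w))

/-- The global mass matrix of the gauge boson, `q · g ↦ Ad(g)⁻¹ M²_YM(z₀) Ad(g)`. -/
def globalMassYM (β : InvariantForm ρ) (x : M) (p : B.Fiber x) (X : ρ.lie) : ρ.lie :=
  ρ.Ad (B.diff (𝒬.point x) p)⁻¹ (β.massYM z₀ (ρ.Ad (B.diff (𝒬.point x) p) X))

/-- A connection on `P` is compatible with the vacuum if its connection form, pulled back to `Q`,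
has values in `Lie(H)`. -/
def Compatible (A : B.Connection) : Prop :=
  ∀ τ : B.Gauge, (∀ x ∈ τ.dom, τ.sec x ∈ 𝒬.Q x) →
    ∀ x ∈ τ.dom, ∀ v, A.form τ x v ∈ ρ.lieH z₀

/-- The connection `Ξ` and the vacuum section form a vacuum pair. -/
def IsVacuumPair (Ξ : B.Connection) : Prop := Ξ.IsFlat ∧ 𝒬.Compatible Ξ

/-- `a` is a 1-form with values in `ad(Q) = Q ×_H Lie(H)`. -/
def IsAdQValued (a : B.AdForm) : Prop :=
  ∀ x, ∀ q ∈ 𝒬.Q x, ∀ v, a.toFun x q v ∈ ρ.lieH z₀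

/-- `a` is a 1-form with values in `Q ×_H Lie(H)^⊥`, which is isomorphic to the Goldstone bundle. -/
def IsGoldstoneValued (β : InvariantForm ρ) (a : B.AdForm) : Prop :=
  ∀ x, ∀ q ∈ 𝒬.Q x, ∀ v, a.toFun x q v ∈ β.lieHPerp z₀

/-- `φ` is a section of the physical Higgs bundle `Q ×_H W_{H,phys}`. -/
def IsPhysical (β : InvariantForm ρ) (φ : B.HiggsField) : Prop :=
  ∀ x, ∀ q ∈ 𝒬.Q x, φ.toFun x q ∈ β.physHiggs z₀

/-- The family `(A_t, Φ_t)`, `0 ≤ t ≤ 1`, is the fluctuation `A_t = Ξ + t (a_H + a_G)`,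
`Φ_t = 𝒱 + t φ` of the vacuum pair, where `a_H`, `a_G`, `φ` take values in `ad(Q)`,
`Q ×_H Lie(H)^⊥` and the physical Higgs bundle, respectively. -/
structure IsFluctuation (β : InvariantForm ρ) (Ξ : B.Connection) (aH aG : B.AdForm)
    (φ : B.HiggsField) (A : ℝ → B.Connection) (Φ : ℝ → B.HiggsField) : Prop where
  adQ : 𝒬.IsAdQValued aH
  goldstone : 𝒬.IsGoldstoneValued β aG
  physical : 𝒬.IsPhysical β φ
  connection : ∀ t ∈ Icc (0 : ℝ) 1, ∀ σ : B.Gauge, ∀ x ∈ σ.dom,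
    (A t).form σ x = Ξ.form σ x + t • (aH.toFun x (σ.sec x) + aG.toFun x (σ.sec x))
  field : ∀ t ∈ Icc (0 : ℝ) 1, ∀ x (p : B.Fiber x),
    (Φ t).toFun x p = 𝒬.vacuumSection x p + t • φ.toFun x p

end Vacuum

/-- The family `(A_t, Φ_t)` satisfies the Euler-Lagrange equations of the Yang-Mills-Higgs action up
to order `O(t²)`: in every coordinate patch and for every compactly supported smooth variation
`(α, ψ)`, the first variation of the action at `(A_t, Φ_t)` exists and is `O(t²)` as `t → 0` in
`[0, 1]`. -/
def EulerLagrangeUpToOrderTwo (k : Normalization) (β : InvariantForm ρ) (V : W → ℝ)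
    (g : PseudoMetric n M) (A : ℝ → B.Connection) (Φ : ℝ → B.HiggsField) : Prop :=
  ∀ c ∈ charts n M, ∀ σ : B.Gauge, ∀ K : Set (Coord n), IsCompact K → K ⊆ B.patch c σ →
    ∀ (α : Fin n → Coord n → ρ.lie) (ψ : Coord n → W),
      (∀ i, ContDiff ℝ ∞ (α i) ∧ tsupport (α i) ⊆ K) → ContDiff ℝ ∞ ψ → tsupport ψ ⊆ K →
      ∃ D : ℝ → ℝ,
        (∀ t ∈ Icc (0 : ℝ) 1, HasDerivAt
          (fun ε : ℝ => action k β V (metricMatrix c g.toFun) K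
            (fun i y => (A t).loc c σ i y + ε • α i y) (fun y => (Φ t).loc c σ y + ε • ψ y)) (D t) 0)
        ∧ D =O[𝓝[Icc 0 1] 0] fun t => t ^ 2

/-- `δ ∂ a = 0` for an adjoint-valued 1-form `a`, with respect to the connection `Ξ`. -/
def MasslessEquation (g : PseudoMetric n M) (Ξ : B.Connection) (a : B.AdForm) : Prop :=
  ∀ c ∈ charts n M, ∀ σ : B.Gauge, ∀ y ∈ B.patch c σ, ∀ j,
    coDerivTwo (metricMatrix c g.toFun) (Ξ.loc c σ)
      (extCovDeriv (Ξ.loc c σ) (a.loc c σ)) y j = 0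

/-- `δ ∂ a + r M²_YM a = 0` for an adjoint-valued 1-form `a`. -/
def MassiveGaugeEquation (r : ℝ) {z₀ : W} (𝒬 : B.Vacuum z₀) (β : InvariantForm ρ)
    (g : PseudoMetric n M) (Ξ : B.Connection) (a : B.AdForm) : Prop :=
  ∀ c ∈ charts n M, ∀ σ : B.Gauge, ∀ y ∈ B.patch c σ, ∀ j,
    coDerivTwo (metricMatrix c g.toFun) (Ξ.loc c σ)
        (extCovDeriv (Ξ.loc c σ) (a.loc c σ)) y j
      + r • 𝒬.globalMassYM β (c.symm y) (σ.sec (c.symm y)) (a.loc c σ j y) = 0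

/-- `δ ∂ φ + r M²_H φ = 0` for a section `φ` of the Higgs bundle. -/
def MassiveHiggsEquation (r : ℝ) {z₀ : W} (𝒬 : B.Vacuum z₀) (V : W → ℝ)
    (g : PseudoMetric n M) (Ξ : B.Connection) (φ : B.HiggsField) : Prop :=
  ∀ c ∈ charts n M, ∀ σ : B.Gauge, ∀ y ∈ B.patch c σ,
    coDerivOne (metricMatrix c g.toFun) (Ξ.loc c σ)
        (covDeriv (Ξ.loc c σ) (φ.loc c σ)) y
      + r • 𝒬.globalMassH V (c.symm y) (σ.sec (c.symm y)) (φ.loc c σ y) = 0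

end PrincipalBundle

end YMH

end

/-! Everything is local, so fix a chart and a gauge, write `v` for the vacuum section and `a = aH +
aG`. The vacuum pair is itself critical: `Ξ` is flat, `v` is parallel because `Ξ` reduces to `Q`,
and `dV` vanishes at the minima `v y`. So the first variation `I(t)` at `(A_t, Φ_t)` in a fixed
direction `(α, ψ)` vanishes at `t = 0`. It extends smoothly in `t`, hence is `O(t²)` if and only if
`I'(0) = 0` (`isBigO_sq_iff_of_contDiff`). The number `I'(0)` is the second variation of the action
at the vacuum pair, the integral of `linearizedVariation`: the pairing of `∂a` with `∂α`, the
pairing of `∂φ + a v` with `∂ψ + α v`, and `Hess V (φ, ψ)`, with their constants.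

Since `v` is parallel, `∂φ` stays orthogonal to the orbit directions, so the cross term of `∂φ` with
`α v` drops out; also `aH v = 0`. Integration by parts (`integral_linearizedVariation`) and the
fundamental lemma (`integral_linearizedVariation_eq_zero_iff`) then give, with `r = s cH / (2 cYM)`
and `r' = s cV / (2 cH)`, the two equations `δ∂a + r M²_YM aG = 0` and `δ∂φ + δ(aG v) + r' M²_H φ =
0`.

The first splits because the subbundles modelled on `Lie(H)` and on its complement are parallel for
the compatible connection `Ξ`, and the mass matrix sees only the second
(`gaugeResidual_add_eq_zero_iff`). In the second, `δ∂φ` and, by Goldstone's theorem, `M²_H φ` are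
orthogonal to the orbit, while `δ(aG v)` is tangent to it; so it splits into the massive Higgs
equation and the extra condition `δ(aG v) = 0` (`higgsResidual_eq_zero_iff`).

The extra condition is no restriction, and this is the main point of the converse: it follows from
the gauge equation (`coDerivOne_action_eq_zero`). Pairing that equation with `∂Y`, for a compactly
supported section `Y` of the adjoint bundle, kills `δ∂a`, since `∂∂Y = 0` by flatness. What remains
is `r` times the pairing of `aG v` with `(∂Y) v = ∂(Y v)`. As `r ≠ 0`, the tangent vector `δ(aG v)`
is orthogonal to the orbit, hence zero. -/

namespace YMH

/-! ### Parameter integrals, first-order asymptotics and test functions -/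

section Analysis

open MeasureTheory

/-- Differentiation under the integral sign over a compact subset of an open set. -/
theorem hasDerivAt_setIntegral_of_contDiffOn {E : Type*} [NormedAddCommGroup E]
    [NormedSpace ℝ E] [MeasurableSpace E] [BorelSpace E] {μ : Measure E}
    [IsFiniteMeasureOnCompacts μ] {f : ℝ → E → ℝ} {U K : Set E} (hU : IsOpen U)
    (hf : ContDiffOn ℝ ∞ (fun p : ℝ × E => f p.1 p.2) (univ ×ˢ U)) (hK : IsCompact K)
    (hKU : K ⊆ U) (t₀ : ℝ) :
    HasDerivAt (fun t => ∫ y in K, f t y ∂μ) (∫ y in K, deriv (fun t => f t y) t₀ ∂μ) t₀ := by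
  have hop : IsOpen ((univ : Set ℝ) ×ˢ U) := isOpen_univ.prod hU
  have hdiff : ∀ y ∈ U, ∀ t, HasDerivAt (fun t => f t y)
      (fderiv ℝ (fun p : ℝ × E => f p.1 p.2) (t, y) (1, 0)) t := fun y hy t => by
    have h1 : HasFDerivAt (fun p : ℝ × E => f p.1 p.2)
        (fderiv ℝ (fun p : ℝ × E => f p.1 p.2) (t, y)) (t, y) :=
      ((hf.contDiffAt (hop.mem_nhds ⟨mem_univ _, hy⟩)).differentiableAt (by simp)).hasFDerivAt
    have h2 : HasDerivAt (fun t : ℝ => (t, y)) ((1 : ℝ), (0 : E)) t :=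
      (hasDerivAt_id t).prodMk (hasDerivAt_const t y)
    exact h1.comp_hasDerivAt t h2
  have hcont : ContinuousOn (fun p : ℝ × E =>
      fderiv ℝ (fun p : ℝ × E => f p.1 p.2) p ((1 : ℝ), (0 : E))) (univ ×ˢ U) :=
    (hf.continuousOn_fderiv_of_isOpen hop (by simp)).clm_apply continuousOn_const
  have hcomp : IsCompact (Metric.closedBall t₀ 1 ×ˢ K) :=
    (isCompact_closedBall t₀ 1).prod hK
  -- A constant dominating function: the parameter derivative is continuous, hence bounded over
  -- parameters within distance 1 of `t₀` and points of `K`.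
  obtain ⟨C, hC⟩ := hcomp.exists_bound_of_continuousOn
    (hcont.mono (prod_mono (subset_univ _) hKU))
  have hslice : ∀ t, ContinuousOn (fun y => f t y) K := fun t =>
    hf.continuousOn.comp (by fun_prop : Continuous fun y : E => (t, y)).continuousOn
      fun y hy => ⟨mem_univ _, hKU hy⟩
  have hslice' : ContinuousOn (fun y => deriv (fun t => f t y) t₀) K := by
    refine (hcont.comp (by fun_prop : Continuous fun y : E => (t₀, y)).continuousOn
      fun y hy => ⟨mem_univ _, hKU hy⟩).congr fun y hy => (hdiff y (hKU hy) t₀).deriv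
  have hm : MeasurableSet K := hK.measurableSet
  refine (hasDerivAt_integral_of_dominated_loc_of_deriv_le (F := f)
    (F' := fun t y => deriv (fun t => f t y) t) (bound := fun _ => C)
    (Metric.ball_mem_nhds t₀ one_pos) (Filter.Eventually.of_forall fun t =>
      (hslice t).aestronglyMeasurable_of_isCompact hK hm) ((hslice t₀).integrableOn_compact hK)
    (hslice'.aestronglyMeasurable_of_isCompact hK hm) ?_ ?_ ?_).2
  · refine (ae_restrict_iff' hm).2 (Filter.Eventually.of_forall fun y hy t ht => ?_)
    rw [(hdiff y (hKU hy) t).deriv]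
    exact hC (t, y) ⟨Metric.ball_subset_closedBall ht, hy⟩
  · exact integrableOn_const hK.measure_lt_top.ne
  · refine (ae_restrict_iff' hm).2 (Filter.Eventually.of_forall fun y hy t _ => ?_)
    exact (hdiff y (hKU hy) t).differentiableAt.hasDerivAt

/-- The parameter derivative of a jointly smooth function is jointly smooth. -/
theorem contDiffOn_deriv_param {E : Type*} [NormedAddCommGroup E] [NormedSpace ℝ E]
    {f : ℝ → E → ℝ} {U : Set E} (hU : IsOpen U)
    (hf : ContDiffOn ℝ ∞ (fun p : ℝ × E => f p.1 p.2) (univ ×ˢ U)) :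
    ContDiffOn ℝ ∞ (fun p : ℝ × E => deriv (fun t => f t p.2) p.1) (univ ×ˢ U) := by
  have hop : IsOpen ((univ : Set ℝ) ×ˢ U) := isOpen_univ.prod hU
  refine ((hf.fderiv_of_isOpen hop (m := ∞) (by simp)).clm_apply
    (contDiffOn_const (c := ((1 : ℝ), (0 : E))))).congr fun p hp => ?_
  have h1 : HasFDerivAt (fun p : ℝ × E => f p.1 p.2)
      (fderiv ℝ (fun p : ℝ × E => f p.1 p.2) (p.1, p.2)) (p.1, p.2) :=
    ((hf.contDiffAt (hop.mem_nhds hp)).differentiableAt (by simp)).hasFDerivAt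
  have h2 : HasDerivAt (fun t : ℝ => (t, p.2)) ((1 : ℝ), (0 : E)) p.1 :=
    (hasDerivAt_id _).prodMk (hasDerivAt_const _ _)
  exact (h1.comp_hasDerivAt p.1 h2).deriv

/-- A smooth function of one variable vanishing at `0` is `O(t²)` on `[0, 1]` if and only if its
derivative at `0` vanishes. -/
theorem isBigO_sq_iff_of_contDiff {I I' : ℝ → ℝ} (h0 : I 0 = 0)
    (hI : ∀ t, HasDerivAt I (I' t) t) (hI' : DifferentiableAt ℝ I' 0) :
    (I =O[𝓝[Icc 0 1] 0] fun t => t ^ 2) ↔ I' 0 = 0 := by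
  -- Mean value inequality: the derivative of `I t - t * I' 0` is `I' x - I' 0`, which is at most `C
  -- * |t|` for `|x| ≤ |t|` because `I'` is differentiable at `0`.
  have key : (fun t => I t - t * I' 0) =O[𝓝[Icc 0 1] 0] fun t : ℝ => t ^ 2 := by
    have h1 : (fun t => I' t - I' 0) =O[𝓝 0] fun t => t - 0 := hI'.isBigO_sub
    obtain ⟨C, hC⟩ := h1.bound
    obtain ⟨r, hr, hb⟩ := Metric.eventually_nhds_iff_ball.1 hC
    refine Asymptotics.IsBigO.of_bound C ?_
    filter_upwards [mem_nhdsWithin_of_mem_nhds (Metric.ball_mem_nhds (0 : ℝ) hr)] with t ht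
    have hC0 : ∀ x ∈ Icc (-|t|) |t|, ‖I' x - I' 0‖ ≤ C * |t| := fun x hx => by
      have hx' : |x| ≤ |t| := abs_le.2 hx
      have hx2 : x ∈ Metric.ball (0 : ℝ) r := by
        simp only [Metric.mem_ball, dist_zero_right, Real.norm_eq_abs] at ht ⊢
        exact hx'.trans_lt ht
      have h := hb x hx2
      simp only [sub_zero, Real.norm_eq_abs] at h
      rw [Real.norm_eq_abs]
      -- The bound supplies no sign for `C`. For `x ≠ 0` the estimate at `x` forces `0 ≤ C`; for `x
      -- = 0` the estimate at `t` gives what is needed.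
      rcases eq_or_ne x 0 with rfl | hx0
      · have ht2 := hb t ht
        simp only [sub_zero, Real.norm_eq_abs] at ht2
        simpa using (abs_nonneg _).trans ht2
      · have hCnn : 0 ≤ C := by
          by_contra hneg
          have := mul_neg_of_neg_of_pos (not_le.1 hneg) (abs_pos.2 hx0)
          linarith [abs_nonneg (I' x - I' 0)]
        exact h.trans (mul_le_mul_of_nonneg_left hx' hCnn)
    have hm := (convex_Icc (-|t|) |t|).norm_image_sub_le_of_norm_hasDerivWithin_le
      (f := fun t => I t - t * I' 0) (f' := fun x => I' x - I' 0) (C := C * |t|)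
      (fun x _ => by
        have h := (hI x).sub ((hasDerivAt_id x).mul_const (I' 0))
        rw [one_mul] at h
        exact h.hasDerivWithinAt) hC0
      (x := 0) (y := t) ⟨by simp, by simp⟩ ⟨neg_abs_le t, le_abs_self t⟩
    simp only [h0, zero_mul, sub_zero] at hm
    refine hm.trans (le_of_eq ?_)
    rw [norm_pow, Real.norm_eq_abs]
    ring
  constructor
  · intro h
    have h2 : (fun t : ℝ => t * I' 0) =O[𝓝[Icc 0 1] 0] fun t : ℝ => t ^ 2 := by
      simpa using h.sub key
    obtain ⟨C, hC⟩ := h2.bound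
    by_contra hne
    have hlim : Filter.Tendsto (fun t : ℝ => C * |t|) (𝓝[>] 0) (𝓝 0) := by
      have : Filter.Tendsto (fun t : ℝ => C * |t|) (𝓝 0) (𝓝 (C * |0|)) :=
        (by fun_prop : Continuous fun t : ℝ => C * |t|).tendsto 0
      simp only [abs_zero, mul_zero] at this
      exact this.mono_left nhdsWithin_le_nhds
    -- Only `t ≥ 0` is available, so the limit that forces `I' 0 = 0` is taken from the right, after
    -- dividing by `t > 0`.
    have hle : 𝓝[>] (0 : ℝ) ≤ 𝓝[Icc 0 1] 0 := by
      rw [← nhdsWithin_Ioc_eq_nhdsGT (zero_lt_one (α := ℝ))]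
      exact nhdsWithin_mono _ Ioc_subset_Icc_self
    have hev : ∀ᶠ t in 𝓝[>] (0 : ℝ), |I' 0| ≤ C * |t| := by
      filter_upwards [hle hC, self_mem_nhdsWithin] with t ht htpos
      have htpos : 0 < |t| := abs_pos.2 (ne_of_gt htpos)
      have ht : ‖t * I' 0‖ ≤ C * ‖t ^ 2‖ := ht
      rw [norm_mul, norm_pow, Real.norm_eq_abs, Real.norm_eq_abs] at ht
      nlinarith
    have := le_of_tendsto_of_tendsto tendsto_const_nhds hlim hev
    exact hne (abs_eq_zero.1 (le_antisymm this (abs_nonneg _)))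
  · intro h
    simpa [h] using key

/-- The integral of a directional derivative of a function with compact support vanishes. -/
theorem integral_fderiv_eq_zero {E : Type*} [NormedAddCommGroup E] [NormedSpace ℝ E]
    [FiniteDimensional ℝ E] [MeasurableSpace E] [BorelSpace E] {μ : Measure E}
    [μ.IsAddHaarMeasure] {f : E → ℝ} (hf : ContDiff ℝ 1 f) (hc : HasCompactSupport f) (e : E) :
    ∫ y, fderiv ℝ f y e ∂μ = 0 := by
  have hd : Differentiable ℝ f := hf.differentiable (by simp)
  have hi : Integrable (fun y => fderiv ℝ f y e) μ :=
    ((hf.continuous_fderiv (by simp)).clm_apply continuous_const).integrable_of_hasCompactSupport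
      (hc.fderiv_apply ℝ e)
  -- Integration by parts against the constant function 1.
  have h := integral_mul_fderiv_eq_neg_fderiv_mul_of_integrable (μ := μ) (f := fun _ : E => (1 : ℝ))
    (g := f) (v := e) (by simp) (by simpa using hi)
    (by simpa using hf.continuous.integrable_of_hasCompactSupport hc) (by simp) fun x _ => hd x
  simpa using h

/-- A function which is smooth on an open set and vanishes off a compact subset is smooth. -/
theorem contDiff_of_contDiffOn_of_eq_zero {E F : Type*} [NormedAddCommGroup E] [NormedSpace ℝ E]
    [NormedAddCommGroup F] [NormedSpace ℝ F] {f : E → F} {U K : Set E} (hU : IsOpen U)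
    (hK : IsCompact K) (hKU : K ⊆ U) (hf : ContDiffOn ℝ ∞ f U) (h0 : ∀ y ∉ K, f y = 0) :
    ContDiff ℝ ∞ f := by
  rw [contDiff_iff_contDiffAt]
  intro y
  by_cases hy : y ∈ K
  · exact hf.contDiffAt (hU.mem_nhds (hKU hy))
  · refine (contDiffAt_const (c := (0 : F))).congr_of_eventuallyEq ?_
    filter_upwards [hK.isClosed.isOpen_compl.mem_nhds hy] with z hz using h0 z hz

/-- The divergence theorem for functions vanishing off a compact subset of an open set. -/
theorem setIntegral_fderiv_eq_zero {E : Type*} [NormedAddCommGroup E] [NormedSpace ℝ E]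
    [FiniteDimensional ℝ E] [MeasurableSpace E] [BorelSpace E] {μ : Measure E}
    [μ.IsAddHaarMeasure] {f : E → ℝ} {U K : Set E} (hU : IsOpen U) (hK : IsCompact K)
    (hKU : K ⊆ U) (hf : ContDiffOn ℝ ∞ f U) (h0 : ∀ y ∉ K, f y = 0) (e : E) :
    ∫ y in K, fderiv ℝ f y e ∂μ = 0 := by
  have hsm := contDiff_of_contDiffOn_of_eq_zero hU hK hKU hf h0
  have hcs : HasCompactSupport f := HasCompactSupport.intro hK h0
  rw [setIntegral_eq_integral_of_forall_compl_eq_zero]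
  · exact integral_fderiv_eq_zero (hsm.of_le (by simp)) hcs e
  · intro y hy
    have : f =ᶠ[𝓝 y] fun _ => 0 := by
      filter_upwards [hK.isClosed.isOpen_compl.mem_nhds hy] with z hz using h0 z hz
    rw [this.fderiv_eq]
    simp

/-- The fundamental lemma of the calculus of variations. -/
theorem eqOn_zero_of_setIntegral_smul_eq_zero {E : Type*} [NormedAddCommGroup E] [NormedSpace ℝ E]
    [FiniteDimensional ℝ E] [MeasurableSpace E] [BorelSpace E] {μ : Measure E}
    [μ.IsAddHaarMeasure] {f : E → ℝ} {U : Set E} (hU : IsOpen U) (hf : ContinuousOn f U)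
    (h : ∀ η : E → ℝ, ContDiff ℝ ∞ η → HasCompactSupport η → tsupport η ⊆ U →
      ∫ y in tsupport η, η y * f y ∂μ = 0) : ∀ y ∈ U, f y = 0 := by
  have hae := hU.ae_eq_zero_of_integral_contDiff_smul_eq_zero (μ := μ) (f := f)
    (hf.locallyIntegrableOn hU.measurableSet) fun η hη hc hs => by
      have := h η hη hc hs
      rw [setIntegral_eq_integral_of_forall_compl_eq_zero] at this
      · simpa using this
      · intro y hy
        rw [image_eq_zero_of_notMem_tsupport hy, zero_mul]
  refine Measure.eqOn_open_of_ae_eq (μ := μ) (f := f) (g := fun _ => 0) ?_ hU hf continuousOn_const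
  exact (ae_restrict_iff' hU.measurableSet).2 hae

/-! ### Bilinear maps between finite-dimensional spaces -/

section Bilinear

variable {E F₁ F₂ F₃ : Type*} [NormedAddCommGroup E] [NormedSpace ℝ E]
  [NormedAddCommGroup F₁] [NormedSpace ℝ F₁] [FiniteDimensional ℝ F₁]
  [NormedAddCommGroup F₂] [NormedSpace ℝ F₂] [FiniteDimensional ℝ F₂]
  [NormedAddCommGroup F₃] [NormedSpace ℝ F₃] (b : F₁ →ₗ[ℝ] F₂ →ₗ[ℝ] F₃)

theorem hasFDerivAt_bilin {f : E → F₁} {g : E → F₂} {y : E} {f' : E →L[ℝ] F₁} {g' : E →L[ℝ] F₂}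
    (hf : HasFDerivAt f f' y) (hg : HasFDerivAt g g' y) :
    HasFDerivAt (fun z => b (f z) (g z))
      (b.toContinuousBilinearMap.precompR E (f y) g' +
        b.toContinuousBilinearMap.precompL E f' (g y)) y :=
  b.toContinuousBilinearMap.hasFDerivAt_of_bilinear hf hg

theorem fderiv_bilin {f : E → F₁} {g : E → F₂} {y : E} (hf : DifferentiableAt ℝ f y)
    (hg : DifferentiableAt ℝ g y) (e : E) : fderiv ℝ (fun z => b (f z) (g z)) y e =
      b (fderiv ℝ f y e) (g y) + b (f y) (fderiv ℝ g y e) := by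
  rw [(hasFDerivAt_bilin b hf.hasFDerivAt hg.hasFDerivAt).fderiv, add_comm]
  rfl

theorem hasDerivAt_bilin {f : ℝ → F₁} {g : ℝ → F₂} {t : ℝ} {f' : F₁} {g' : F₂}
    (hf : HasDerivAt f f' t) (hg : HasDerivAt g g' t) :
    HasDerivAt (fun s => b (f s) (g s)) (b f' (g t) + b (f t) g') t := by
  have h := (hasFDerivAt_bilin b hf.hasFDerivAt hg.hasFDerivAt).hasDerivAt
  refine h.congr_deriv ?_
  simp [ContinuousLinearMap.precompR, ContinuousLinearMap.precompL, add_comm]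

theorem contDiffOn_bilin {m : WithTop ℕ∞} {f : E → F₁} {g : E → F₂} {s : Set E}
    (hf : ContDiffOn ℝ m f s) (hg : ContDiffOn ℝ m g s) :
    ContDiffOn ℝ m (fun z => b (f z) (g z)) s :=
  b.toContinuousBilinearMap.isBoundedBilinearMap.contDiff.comp_contDiffOn (hf.prodMk hg)

end Bilinear

end Analysis

end YMH

namespace YMH

variable {G : Type*} [Group G] [TopologicalSpace G]
  {W : Type*} [NormedAddCommGroup W] [InnerProductSpace ℝ W] [FiniteDimensional ℝ W]

/-! ### Infinitesimal algebra of the orthogonal representation -/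

namespace OrthogonalRep

variable (ρ : OrthogonalRep G W)

theorem map_inv_mul_map (g : G) : ρ g⁻¹ * ρ g = 1 := by
  rw [← map_mul, inv_mul_cancel, map_one]

theorem map_inv_apply_map (g : G) (w : W) : ρ g⁻¹ (ρ g w) = w :=
  congrArg (fun T : Endo W => T w) (ρ.map_inv_mul_map g)

theorem map_apply_map_inv (g : G) (w : W) : ρ g (ρ g⁻¹ w) = w :=
  congrArg (fun T : Endo W => T w) (ρ.map_mul_map_inv g)

theorem inner_map_left (g : G) (v w : W) : ⟪ρ g v, w⟫_ℝ = ⟪v, ρ g⁻¹ w⟫_ℝ := by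
  rw [← ρ.inner_map g v (ρ g⁻¹ w), map_apply_map_inv]

/-- Orthogonality turns inversion in `G` into the linear map `star`. This is how inverses are
differentiated although `G` carries no smooth structure of its own. -/
theorem map_inv_eq_star [CompleteSpace W] (g : G) : ρ g⁻¹ = star (ρ g) := by
  ext v
  refine ext_inner_right ℝ fun w => ?_
  rw [ContinuousLinearMap.star_eq_adjoint, ContinuousLinearMap.adjoint_inner_left]
  simpa using ρ.inner_map_left g⁻¹ v w

theorem contDiff_star [CompleteSpace W] : ContDiff ℝ ∞ (fun T : Endo W => star T) :=
  ((starL' ℝ : Endo W ≃L[ℝ] Endo W) : Endo W →L[ℝ] Endo W).contDiff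

variable {ρ}

/-- Differentiate `⟪ρ(γ t) v, ρ(γ t) w⟫ = ⟪v, w⟫` at `t = 0`. -/
theorem inner_apply_left_of_mem_lie {X : Endo W} (hX : X ∈ ρ.lie) (v w : W) :
    ⟪X v, w⟫_ℝ = -⟪v, X w⟫_ℝ := by
  obtain ⟨γ, -, hγ0, hγ⟩ := hX
  have e1 : ρ (γ 0) = 1 := by rw [hγ0, map_one]
  have hv := hγ.clm_apply (hasDerivAt_const (0 : ℝ) v)
  have hw := hγ.clm_apply (hasDerivAt_const (0 : ℝ) w)
  have h := hv.inner ℝ hw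
  have hc : HasDerivAt (fun t => ⟪ρ (γ t) v, ρ (γ t) w⟫_ℝ) 0 0 :=
    (hasDerivAt_const (0 : ℝ) ⟪v, w⟫_ℝ).congr_of_eventuallyEq
      (Filter.Eventually.of_forall fun t => ρ.inner_map (γ t) v w)
  have := h.unique hc
  simp only [e1, map_zero, add_zero, one_apply_eq_self] at this
  linarith

theorem hasDerivAt_conj {γ : ℝ → G} {X : Endo W} (hγ0 : γ 0 = 1)
    (hγ : HasDerivAt (fun t => ρ (γ t)) X 0) (Y : Endo W) :
    HasDerivAt (fun t => ρ (γ t) * Y * ρ (γ t)⁻¹) (X * Y - Y * X) 0 := by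
  have : CompleteSpace W := FiniteDimensional.complete ℝ W
  have e1 : ρ (γ 0) = 1 := by rw [hγ0, map_one]
  have e0 : ρ (γ 0)⁻¹ = 1 := by rw [hγ0, inv_one, map_one]
  have hi : HasDerivAt (fun t => ρ (γ t)⁻¹) (star X) 0 :=
    hγ.star.congr_of_eventuallyEq (Filter.Eventually.of_forall fun t => ρ.map_inv_eq_star (γ t))
  have hX : star X = -X := by
    ext v
    refine ext_inner_right ℝ fun w => ?_
    rw [ContinuousLinearMap.star_eq_adjoint, ContinuousLinearMap.adjoint_inner_left,
      neg_apply, inner_neg_left,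
      inner_apply_left_of_mem_lie (ρ := ρ) ⟨γ, fun _ => Subgroup.mem_top _, hγ0, hγ⟩, neg_neg]
  have h := (hγ.mul_const Y).mul hi
  rw [e0, e1, hX] at h
  have h3 : X * Y * 1 + 1 * Y * -X = X * Y - Y * X := by noncomm_ring
  rw [h3] at h
  exact h

theorem conj_mem_lieAlg {S : Subgroup G} {g : G} (hg : g ∈ S) {X : Endo W}
    (hX : X ∈ ρ.lieAlg S) : ρ g * X * ρ g⁻¹ ∈ ρ.lieAlg S := by
  obtain ⟨γ, hγ, hγ0, hX⟩ := hX
  refine ⟨fun t => g * γ t * g⁻¹, fun t => S.mul_mem (S.mul_mem hg (hγ t)) (S.inv_mem hg),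
    by simp [hγ0], ?_⟩
  have h := (hX.const_mul (ρ g)).mul_const (ρ g⁻¹)
  refine h.congr_of_eventuallyEq (Filter.Eventually.of_forall fun t => ?_)
  simp [map_mul]

/-- The bracket is the velocity of the conjugates of `Y` by a curve in `S`. These stay in the Lie
algebra of `S`, a finite-dimensional and hence closed subspace, so the limit of difference quotients
does too. -/
theorem bracket_mem_lieAlg {S : Subgroup G} {X Y : Endo W} (hX : X ∈ ρ.lieAlg S)
    (hY : Y ∈ ρ.lieAlg S) : X * Y - Y * X ∈ ρ.lieAlg S := by
  obtain ⟨γ, hγS, hγ0, hγ⟩ := hX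
  have hd := hasDerivAt_conj hγ0 hγ Y
  have hcl : IsClosed (ρ.lieAlg S : Set (Endo W)) := Submodule.closed_of_finiteDimensional _
  refine hcl.mem_of_tendsto hd.tendsto_slope_zero (Filter.Eventually.of_forall fun t => ?_)
  exact (ρ.lieAlg S).smul_mem _ ((ρ.lieAlg S).sub_mem (conj_mem_lieAlg (hγS _) hY)
    (conj_mem_lieAlg (hγS _) hY))

theorem apply_eq_zero_of_mem_lieH {z₀ : W} {X : ρ.lie} (hX : X ∈ ρ.lieH z₀) : X.1 z₀ = 0 := by
  obtain ⟨γ, hγS, -, hγ⟩ := hX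
  have h := hγ.clm_apply (hasDerivAt_const (0 : ℝ) z₀)
  have hc : HasDerivAt (fun t => ρ (γ t) z₀) 0 0 :=
    (hasDerivAt_const (0 : ℝ) z₀).congr_of_eventuallyEq (Filter.Eventually.of_forall hγS)
  simpa using h.unique hc

theorem bracket_mem_lieH {z₀ : W} {X Y : ρ.lie} (hX : X ∈ ρ.lieH z₀) (hY : Y ∈ ρ.lieH z₀) :
    ρ.bracket X Y ∈ ρ.lieH z₀ :=
  bracket_mem_lieAlg hX hY

/-- The Lie bracket as a bilinear map. -/
def bracketₗ (ρ : OrthogonalRep G W) : ρ.lie →ₗ[ℝ] ρ.lie →ₗ[ℝ] ρ.lie :=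
  LinearMap.mk₂ ℝ ρ.bracket
    (by intro X X' Y; ext1; simp [bracket]; noncomm_ring)
    (by intro c X Y; ext1; simp [bracket, smul_sub])
    (by intro X Y Y'; ext1; simp [bracket]; noncomm_ring)
    (by intro c X Y; ext1; simp [bracket, smul_sub])

/-- The derived representation as a bilinear map. -/
def actionₗ (ρ : OrthogonalRep G W) : ρ.lie →ₗ[ℝ] W →ₗ[ℝ] W :=
  LinearMap.mk₂ ℝ (fun X w => X.1 w) (by simp) (by simp) (by simp) (by simp)

theorem bracket_swap (X Y : ρ.lie) : ρ.bracket X Y = -ρ.bracket Y X := by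
  ext1; simp [bracket]

theorem bracket_apply (X Y : ρ.lie) (w : W) :
    (ρ.bracket X Y).1 w = X.1 (Y.1 w) - Y.1 (X.1 w) := rfl

/-- The Jacobi identity, in the form in which it enters the commutator of covariant derivatives. -/
theorem bracket_bracket (X Y Z : ρ.lie) : ρ.bracket X (ρ.bracket Y Z) - ρ.bracket Y (ρ.bracket X Z)
    = ρ.bracket (ρ.bracket X Y) Z := by
  ext1; simp [bracket]; noncomm_ring

theorem inner_skew (X : ρ.lie) (v w : W) : ⟪X.1 v, w⟫_ℝ = -⟪v, X.1 w⟫_ℝ :=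
  inner_apply_left_of_mem_lie X.2 v w

@[simp] theorem coe_Ad (g : G) (X : ρ.lie) : (ρ.Ad g X : Endo W) = ρ g * X.1 * ρ g⁻¹ := rfl

theorem Ad_mul (g h : G) (X : ρ.lie) : ρ.Ad (g * h) X = ρ.Ad g (ρ.Ad h X) := by
  ext1; simp [map_mul, mul_assoc]

theorem Ad_one (X : ρ.lie) : ρ.Ad 1 X = X := by
  ext1; simp [map_one]

theorem Ad_apply_map (g : G) (X : ρ.lie) (w : W) : (ρ.Ad g X).1 (ρ g w) = ρ g (X.1 w) := by
  simp [mul_apply_eq_comp, map_inv_apply_map]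

theorem Ad_Ad_inv (g : G) (X : ρ.lie) : ρ.Ad g (ρ.Ad g⁻¹ X) = X := by
  rw [← Ad_mul, mul_inv_cancel, Ad_one]

end OrthogonalRep

open OrthogonalRep

/-! ### The orthogonal splitting of the Lie algebra -/

namespace InvariantForm

variable {ρ : OrthogonalRep G W} (β : InvariantForm ρ) {z₀ : W}

/-- The infinitesimal form of `Ad`-invariance. It makes every gauge potential a metric connection
for `β`. -/
theorem bracket_left (X Y Z : ρ.lie) :
    β.toBilin (ρ.bracket X Y) Z = -β.toBilin Y (ρ.bracket X Z) := by
  obtain ⟨γ, hγS, hγ0, hγ⟩ := X.2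
  -- The conjugated curves are differentiated in `End(W)`, so `β` is extended there along a linear
  -- projection `P` onto `Lie(G)`.
  obtain ⟨P, hP⟩ := LinearMap.exists_leftInverse_of_injective ρ.lie.subtype (by simp)
  have hP' : ∀ T : ρ.lie, P T.1 = T := fun T => congrArg (fun f : ρ.lie →ₗ[ℝ] ρ.lie => f T) hP
  have h := hasDerivAt_bilin (β.toBilin.compl₁₂ P P) (hasDerivAt_conj hγ0 hγ Y.1)
    (hasDerivAt_conj hγ0 hγ Z.1)
  have hc : HasDerivAt (fun s => β.toBilin.compl₁₂ P P (ρ (γ s) * Y.1 * ρ (γ s)⁻¹)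
      (ρ (γ s) * Z.1 * ρ (γ s)⁻¹)) 0 0 := by
    refine (hasDerivAt_const (0 : ℝ) (β.toBilin Y Z)).congr_of_eventuallyEq
      (Filter.Eventually.of_forall fun t => ?_)
    beta_reduce
    rw [← β.invariant (γ t) Y Z, LinearMap.compl₁₂_apply, ← coe_Ad, ← coe_Ad, hP', hP']
  have h' := h.unique hc
  have e : ∀ T : ρ.lie, P (ρ (γ 0) * T.1 * ρ (γ 0)⁻¹) = T := fun T => by
    rw [hγ0, inv_one, OrthogonalRep.map_one, one_mul, mul_one, hP']
  have e' : ∀ T : ρ.lie, P (X.1 * T.1 - T.1 * X.1) = ρ.bracket X T := fun T => hP' (ρ.bracket X T)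
  simp only [LinearMap.compl₁₂_apply, e, e'] at h'
  exact eq_neg_of_add_eq_zero_left h'

/-- The splitting is reductive: by skewness the bracket moves to the other factor, where `Lie(H)` is
a subalgebra. -/
theorem bracket_mem_lieHPerp {X Y : ρ.lie} (hX : X ∈ ρ.lieH z₀) (hY : Y ∈ β.lieHPerp z₀) :
    ρ.bracket X Y ∈ β.lieHPerp z₀ := fun Z hZ => by
  rw [β.bracket_left, hY _ (bracket_mem_lieH hX hZ), neg_zero]

theorem exists_add_mem (X : ρ.lie) : ∃ Y ∈ ρ.lieH z₀, ∃ Z ∈ β.lieHPerp z₀, Y + Z = X := by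
  have hrefl : β.toBilin.IsRefl := fun X Y h => by rw [β.symm, h]
  have hnd : (β.toBilin.restrict (ρ.lieH z₀)).Nondegenerate := by
    refine ⟨fun Y hY => ?_, fun Y hY => ?_⟩ <;>
    · by_contra h
      have h' : (Y : ρ.lie) ≠ 0 := fun h0 => h (Subtype.ext h0)
      exact absurd (hY Y) (β.pos Y h').ne'
  have hcompl := (LinearMap.BilinForm.restrict_nondegenerate_iff_isCompl_orthogonal hrefl).1 hnd
  obtain ⟨Y, hY, Z, hZ, h⟩ := Submodule.mem_sup.1
    (hcompl.sup_eq_top ▸ Submodule.mem_top : X ∈ ρ.lieH z₀ ⊔ _)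
  refine ⟨Y, hY, Z, fun T hT => ?_, h⟩
  rw [β.symm]
  exact hZ T hT

/-- Since `Lie(H)` annihilates `z₀`, the Goldstone space is the whole tangent space `Lie(G) z₀` of
the orbit, and the choice of complement no longer matters. -/
theorem mem_physHiggs_iff {w : W} : w ∈ β.physHiggs z₀ ↔ ∀ X : ρ.lie, ⟪w, X.1 z₀⟫_ℝ = 0 := by
  rw [physHiggs, Submodule.mem_orthogonal']
  constructor
  · intro h X
    obtain ⟨Y, hY, Z, hZ, rfl⟩ := β.exists_add_mem (z₀ := z₀) X
    have := h (Z.1 z₀) ⟨Z, hZ, rfl⟩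
    simp [apply_eq_zero_of_mem_lieH hY, this]
  · rintro h _ ⟨X, -, rfl⟩
    exact h X

theorem eq_zero_of_forall {X : ρ.lie} (h : ∀ Y, β.toBilin X Y = 0) : X = 0 := by
  by_contra h'
  exact (β.pos X h').ne' (h X)

end InvariantForm

/-! ### Derivatives of an invariant potential -/

namespace IsHiggsPotential

variable {ρ : OrthogonalRep G W} {V : W → ℝ}

/-- Differentiate `V ∘ ρ g = V` twice, using that `ρ g` is linear. -/
theorem hess_map (hV : IsHiggsPotential ρ V) (g : G) (z w w' : W) :
    hess V (ρ g z) (ρ g w) (ρ g w') = hess V z w w' := by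
  have hd1 : Differentiable ℝ V := hV.smooth.differentiable (by simp)
  have hd2 : Differentiable ℝ (fderiv ℝ V) :=
    (hV.smooth.fderiv_right (m := ∞) (by simp)).differentiable (by simp)
  have h1 : ∀ z w', fderiv ℝ V (ρ g z) (ρ g w') = fderiv ℝ V z w' := fun z w' => by
    have h : HasFDerivAt (fun z => V (ρ g z)) ((fderiv ℝ V (ρ g z)).comp (ρ g)) z :=
      (hd1 (ρ g z)).hasFDerivAt.comp z (ρ g).hasFDerivAt
    rw [show (fun z => V (ρ g z)) = V from funext (hV.invariant g)] at h
    rw [h.fderiv]; rfl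
  have h2 := ((hd2 (ρ g z)).hasFDerivAt.comp z (ρ g).hasFDerivAt).clm_apply
    (hasFDerivAt_const (ρ g w') z)
  have h3 := (hd2 z).hasFDerivAt.clm_apply (hasFDerivAt_const w' z)
  have h4 := h2.unique (h3.congr_of_eventuallyEq (Filter.Eventually.of_forall fun z => h1 z w'))
  simpa [hess] using congrArg (fun f : W →L[ℝ] ℝ => f w) h4

theorem fderiv_eq_zero (V : W → ℝ) {z : W} (hz : ∀ w, V z ≤ V w) : fderiv ℝ V z = 0 :=
  IsLocalMin.fderiv_eq_zero (Filter.Eventually.of_forall hz)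

/-- The potential is constant along the curve `ρ(γ t) z`, whose velocity is `X z`. -/
theorem fderiv_apply_lie (hV : IsHiggsPotential ρ V) (X : ρ.lie) (z : W) :
    fderiv ℝ V z (X.1 z) = 0 := by
  obtain ⟨γ, -, hγ0, hγ⟩ := X.2
  have e1 : ρ (γ 0) = 1 := by rw [hγ0, OrthogonalRep.map_one]
  have hv := hγ.clm_apply (hasDerivAt_const (0 : ℝ) z)
  have h := ((hV.smooth.differentiable (by simp)) (ρ (γ 0) z)).hasFDerivAt.comp_hasDerivAt
    (0 : ℝ) hv
  have hc : HasDerivAt (V ∘ fun t => ρ (γ t) z) 0 0 :=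
    (hasDerivAt_const (0 : ℝ) (V z)).congr_of_eventuallyEq
      (Filter.Eventually.of_forall fun t => hV.invariant (γ t) z)
  simpa [e1] using h.unique hc

/-- Goldstone's theorem: the Hessian vanishes along the orbit of a minimum. -/
theorem hess_apply_lie (hV : IsHiggsPotential ρ V) {z : W} (hz : ∀ w, V z ≤ V w) (X : ρ.lie)
    (w : W) : hess V z w (X.1 z) = 0 := by
  have hd2 : Differentiable ℝ (fderiv ℝ V) :=
    (hV.smooth.fderiv_right (m := ∞) (by simp)).differentiable (by simp)
  -- Differentiating `dV_z (X z) = 0` in direction `w` gives `Hess V (w, X z) + dV_z (X w) = 0`, and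
  -- `dV_z = 0` at a minimum.
  have h := (hd2 z).hasFDerivAt.clm_apply X.1.hasFDerivAt
  have h' := h.unique ((hasFDerivAt_const (0 : ℝ) z).congr_of_eventuallyEq
    (Filter.Eventually.of_forall fun z => hV.fderiv_apply_lie X z))
  simpa [hess, fderiv_eq_zero V hz] using congrArg (fun f : W →L[ℝ] ℝ => f w) h'

end IsHiggsPotential

end YMH

namespace YMH

/-! ### Calculus in coordinates -/

section PartialDerivatives

variable {n : ℕ} {F : Type*} [NormedAddCommGroup F] [NormedSpace ℝ F] {U : Set (Coord n)}

theorem differentiableAt_of_contDiffOn {E : Type*} [NormedAddCommGroup E] [NormedSpace ℝ E]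
    {U : Set E} {f : E → F} (hU : IsOpen U) (hf : ContDiffOn ℝ ∞ f U) {y : E} (hy : y ∈ U) :
    DifferentiableAt ℝ f y :=
  (hf.contDiffAt (hU.mem_nhds hy)).differentiableAt (by simp)

theorem contDiffOn_pd (hU : IsOpen U) {f : Coord n → F} (hf : ContDiffOn ℝ ∞ f U) (i : Fin n) :
    ContDiffOn ℝ ∞ (pd i f) U :=
  (hf.fderiv_of_isOpen hU (m := ∞) (by simp)).clm_apply contDiffOn_const

theorem pd_congr (hU : IsOpen U) {f g : Coord n → F} (h : ∀ z ∈ U, f z = g z) {y : Coord n}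
    (hy : y ∈ U) (i : Fin n) : pd i f y = pd i g y := by
  have : f =ᶠ[𝓝 y] g := Filter.eventuallyEq_of_mem (hU.mem_nhds hy) h
  rw [pd, pd, this.fderiv_eq]

theorem pd_add (hU : IsOpen U) {f g : Coord n → F} (hf : ContDiffOn ℝ ∞ f U)
    (hg : ContDiffOn ℝ ∞ g U) {y : Coord n} (hy : y ∈ U) (i : Fin n) :
    pd i (fun z => f z + g z) y = pd i f y + pd i g y := by
  rw [pd, fderiv_fun_add (differentiableAt_of_contDiffOn hU hf hy)
    (differentiableAt_of_contDiffOn hU hg hy)]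
  rfl

theorem pd_const_smul (hU : IsOpen U) {f : Coord n → F} (hf : ContDiffOn ℝ ∞ f U) {y : Coord n}
    (hy : y ∈ U) (i : Fin n) (r : ℝ) : pd i (fun z => r • f z) y = r • pd i f y := by
  rw [pd, fderiv_fun_const_smul (differentiableAt_of_contDiffOn hU hf hy)]
  rfl

theorem pd_comm (hU : IsOpen U) {f : Coord n → F} (hf : ContDiffOn ℝ ∞ f U) {y : Coord n}
    (hy : y ∈ U) (i j : Fin n) : pd i (pd j f) y = pd j (pd i f) y := by
  have hd : DifferentiableAt ℝ (fderiv ℝ f) y :=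
    differentiableAt_of_contDiffOn hU (hf.fderiv_of_isOpen hU (m := ∞) (by simp)) hy
  have hs : IsSymmSndFDerivAt ℝ f y :=
    (hf.contDiffAt (hU.mem_nhds hy)).isSymmSndFDerivAt (by
      rw [minSmoothness_of_isRCLikeNormedField]
      exact ENat.LEInfty.out)
  have h : ∀ i j : Fin n, pd i (pd j f) y = fderiv ℝ (fderiv ℝ f) y (basisVec i) (basisVec j) :=
    fun i j => by
      have h := (hd.hasFDerivAt.clm_apply (hasFDerivAt_const (basisVec j) y)).fderiv
      change fderiv ℝ (fun z => fderiv ℝ f z (basisVec j)) y (basisVec i) = _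
      rw [h]
      simp
  rw [h, h, hs]

theorem contDiffOn_fun_smul {E : Type*} [NormedAddCommGroup E] [NormedSpace ℝ E]
    {U : Set E} {r : E → ℝ} {f : E → F} (hr : ContDiffOn ℝ ∞ r U) (hf : ContDiffOn ℝ ∞ f U) :
    ContDiffOn ℝ ∞ (fun y => r y • f y) U :=
  hr.smul hf

theorem contDiffOn_fun_add {E : Type*} [NormedAddCommGroup E] [NormedSpace ℝ E]
    {U : Set E} {f g : E → F} (hf : ContDiffOn ℝ ∞ f U) (hg : ContDiffOn ℝ ∞ g U) :
    ContDiffOn ℝ ∞ (fun y => f y + g y) U :=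
  hf.add hg

theorem contDiffOn_fun_sum {E ι : Type*} [NormedAddCommGroup E] [NormedSpace ℝ E]
    {U : Set E} {s : Finset ι} {f : ι → E → F} (hf : ∀ i ∈ s, ContDiffOn ℝ ∞ (f i) U) :
    ContDiffOn ℝ ∞ (fun y => ∑ i ∈ s, f i y) U :=
  ContDiffOn.sum hf

theorem pd_bilin {F₁ F₂ F₃ : Type*} [NormedAddCommGroup F₁] [NormedSpace ℝ F₁]
    [FiniteDimensional ℝ F₁] [NormedAddCommGroup F₂] [NormedSpace ℝ F₂] [FiniteDimensional ℝ F₂]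
    [NormedAddCommGroup F₃] [NormedSpace ℝ F₃] (b : F₁ →ₗ[ℝ] F₂ →ₗ[ℝ] F₃) (i : Fin n)
    {f : Coord n → F₁} {g : Coord n → F₂} (hU : IsOpen U)
    (hf : ContDiffOn ℝ ∞ f U) (hg : ContDiffOn ℝ ∞ g U) {y : Coord n} (hy : y ∈ U) :
    pd i (fun z => b (f z) (g z)) y = b (pd i f y) (g y) + b (f y) (pd i g y) :=
  fderiv_bilin b (differentiableAt_of_contDiffOn hU hf hy)
    (differentiableAt_of_contDiffOn hU hg hy) _

end PartialDerivatives

/-! ### Smoothness of the inverse metric and of the volume density -/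

section Metric

variable {E : Type*} [NormedAddCommGroup E] [NormedSpace ℝ E] {ι : Type*} [Fintype ι]
  [DecidableEq ι] {h : E → Matrix ι ι ℝ} {U : Set E}

theorem contDiffOn_det (hh : ∀ i j, ContDiffOn ℝ ∞ (fun y => h y i j) U) :
    ContDiffOn ℝ ∞ (fun y => (h y).det) U := by
  simp only [Matrix.det_apply']
  exact ContDiffOn.sum fun τ _ => contDiffOn_const.mul (contDiffOn_prod fun i _ => hh _ _)

/-- Cramer's rule: an entry of the inverse is a determinant divided by a nowhere vanishing
determinant. -/
theorem contDiffOn_inv_apply (hh : ∀ i j, ContDiffOn ℝ ∞ (fun y => h y i j) U)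
    (h0 : ∀ y ∈ U, (h y).det ≠ 0) (i j : ι) : ContDiffOn ℝ ∞ (fun y => (h y)⁻¹ i j) U := by
  simp only [Matrix.inv_def, Ring.inverse_eq_inv', Matrix.smul_apply, smul_eq_mul,
    Matrix.adjugate_apply]
  refine ((contDiffOn_det hh).inv h0).mul (contDiffOn_det fun a b => ?_)
  -- In the adjugate, row `j` is replaced by a constant unit vector and the other rows are those of
  -- `h`.
  by_cases ha : a = j
  · subst ha
    simpa using contDiffOn_const
  · simpa [Matrix.updateRow_ne ha] using hh a b

end Metric

section Volume

variable {n : ℕ} {h : Coord n → Matrix (Fin n) (Fin n) ℝ} {U : Set (Coord n)}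

theorem volDensity_pos {y : Coord n} (h0 : (h y).det ≠ 0) : 0 < volDensity h y :=
  Real.sqrt_pos.2 (abs_pos.2 h0)

theorem contDiffOn_volDensity (hh : ∀ i j, ContDiffOn ℝ ∞ (fun y => h y i j) U)
    (h0 : ∀ y ∈ U, (h y).det ≠ 0) : ContDiffOn ℝ ∞ (volDensity h) U :=
  ContDiffOn.sqrt ((contDiffOn_det hh).abs h0) fun y hy => abs_ne_zero.2 (h0 y hy)

end Volume

variable {n : ℕ} {G : Type*} [Group G] [TopologicalSpace G]
  {W : Type*} [NormedAddCommGroup W] [InnerProductSpace ℝ W] [FiniteDimensional ℝ W]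
  {ρ : OrthogonalRep G W}

/-! ### Product rules for the bracket, the action and the pairings -/

section Products

variable {U : Set (Coord n)} {E : Type*} [NormedAddCommGroup E] [NormedSpace ℝ E] {S : Set E}

theorem contDiffOn_bracket {X Y : E → ρ.lie} (hX : ContDiffOn ℝ ∞ X S)
    (hY : ContDiffOn ℝ ∞ Y S) : ContDiffOn ℝ ∞ (fun y => ρ.bracket (X y) (Y y)) S :=
  contDiffOn_bilin (F₁ := ρ.lie) (F₂ := ρ.lie) (F₃ := ρ.lie) ρ.bracketₗ hX hY

theorem contDiffOn_action {X : E → ρ.lie} {f : E → W} (hX : ContDiffOn ℝ ∞ X S)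
    (hf : ContDiffOn ℝ ∞ f S) : ContDiffOn ℝ ∞ (fun y => (X y).1 (f y)) S :=
  contDiffOn_bilin (F₁ := ρ.lie) (F₂ := W) (F₃ := W) ρ.actionₗ hX hf

theorem contDiffOn_form (β : InvariantForm ρ) {X Y : E → ρ.lie} (hX : ContDiffOn ℝ ∞ X S)
    (hY : ContDiffOn ℝ ∞ Y S) : ContDiffOn ℝ ∞ (fun y => β.toBilin (X y) (Y y)) S :=
  contDiffOn_bilin (F₁ := ρ.lie) (F₂ := ρ.lie) (F₃ := ℝ) β.toBilin hX hY

theorem pd_bracket (hU : IsOpen U) {X Y : Coord n → ρ.lie} (hX : ContDiffOn ℝ ∞ X U)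
    (hY : ContDiffOn ℝ ∞ Y U) {y : Coord n} (hy : y ∈ U) (i : Fin n) :
    pd i (fun z => ρ.bracket (X z) (Y z)) y =
      ρ.bracket (pd i X y) (Y y) + ρ.bracket (X y) (pd i Y y) :=
  pd_bilin (F₁ := ρ.lie) (F₂ := ρ.lie) (F₃ := ρ.lie) ρ.bracketₗ i hU hX hY hy

theorem pd_action (hU : IsOpen U) {X : Coord n → ρ.lie} {f : Coord n → W}
    (hX : ContDiffOn ℝ ∞ X U) (hf : ContDiffOn ℝ ∞ f U) {y : Coord n} (hy : y ∈ U) (i : Fin n) :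
    pd i (fun z => (X z).1 (f z)) y = (pd i X y).1 (f y) + (X y).1 (pd i f y) :=
  pd_bilin (F₁ := ρ.lie) (F₂ := W) (F₃ := W) ρ.actionₗ i hU hX hf hy

theorem pd_form (β : InvariantForm ρ) (hU : IsOpen U) {X Y : Coord n → ρ.lie}
    (hX : ContDiffOn ℝ ∞ X U) (hY : ContDiffOn ℝ ∞ Y U) {y : Coord n} (hy : y ∈ U) (i : Fin n) :
    pd i (fun z => β.toBilin (X z) (Y z)) y =
      β.toBilin (pd i X y) (Y y) + β.toBilin (X y) (pd i Y y) :=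
  pd_bilin (F₁ := ρ.lie) (F₂ := ρ.lie) (F₃ := ℝ) β.toBilin i hU hX hY hy

theorem pd_inner (hU : IsOpen U) {f g : Coord n → W} (hf : ContDiffOn ℝ ∞ f U)
    (hg : ContDiffOn ℝ ∞ g U) {y : Coord n} (hy : y ∈ U) (i : Fin n) :
    pd i (fun z => ⟪f z, g z⟫_ℝ) y = ⟪pd i f y, g y⟫_ℝ + ⟪f y, pd i g y⟫_ℝ :=
  pd_bilin (innerₗ W) i hU hf hg hy

theorem bracket_add (X Y Z : ρ.lie) :
    ρ.bracket X (Y + Z) = ρ.bracket X Y + ρ.bracket X Z :=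
  map_add (ρ.bracketₗ X) Y Z

theorem bracket_smul (X Y : ρ.lie) (r : ℝ) : ρ.bracket X (r • Y) = r • ρ.bracket X Y :=
  map_smul (ρ.bracketₗ X) r Y

theorem add_bracket (X Y Z : ρ.lie) :
    ρ.bracket (X + Y) Z = ρ.bracket X Z + ρ.bracket Y Z :=
  LinearMap.map_add₂ ρ.bracketₗ X Y Z

theorem smul_bracket (X Y : ρ.lie) (r : ℝ) : ρ.bracket (r • X) Y = r • ρ.bracket X Y :=
  LinearMap.map_smul₂ ρ.bracketₗ r X Y

end Products

/-! ### Covariant derivatives -/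

/-- The covariant derivative `D_i X = ∂_i X + [A_i, X]` of an adjoint-valued function. -/
noncomputable def covAd (A : Fin n → Coord n → ρ.lie) (X : Coord n → ρ.lie) (y : Coord n)
    (i : Fin n) : ρ.lie :=
  pd i X y + ρ.bracket (A i y) (X y)

section Covariant

variable {U : Set (Coord n)} {A a : Fin n → Coord n → ρ.lie}

theorem extCovDeriv_eq (A a : Fin n → Coord n → ρ.lie) (y : Coord n) (i j : Fin n) :
    extCovDeriv A a y i j = covAd A (a j) y i - covAd A (a i) y j := by
  simp only [extCovDeriv, covAd]; abel

theorem extCovDeriv_swap (A a : Fin n → Coord n → ρ.lie) (y : Coord n) (i j : Fin n) :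
    extCovDeriv A a y i j = -extCovDeriv A a y j i := by
  simp only [extCovDeriv_eq]; abel

theorem contDiffOn_covAd (hU : IsOpen U) (hA : ∀ i, ContDiffOn ℝ ∞ (A i) U)
    {X : Coord n → ρ.lie} (hX : ContDiffOn ℝ ∞ X U) (i : Fin n) :
    ContDiffOn ℝ ∞ (fun y => covAd A X y i) U :=
  (contDiffOn_pd hU hX i).add (contDiffOn_bracket (hA i) hX)

theorem contDiffOn_covDeriv (hU : IsOpen U) (hA : ∀ i, ContDiffOn ℝ ∞ (A i) U)
    {f : Coord n → W} (hf : ContDiffOn ℝ ∞ f U) (i : Fin n) :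
    ContDiffOn ℝ ∞ (fun y => covDeriv A f y i) U :=
  (contDiffOn_pd hU hf i).add (contDiffOn_action (hA i) hf)

theorem contDiffOn_extCovDeriv (hU : IsOpen U) (hA : ∀ i, ContDiffOn ℝ ∞ (A i) U)
    (ha : ∀ i, ContDiffOn ℝ ∞ (a i) U) (i j : Fin n) :
    ContDiffOn ℝ ∞ (fun y => extCovDeriv A a y i j) U := by
  simp only [extCovDeriv_eq]
  exact (contDiffOn_covAd hU hA (ha j) i).sub (contDiffOn_covAd hU hA (ha i) j)

/-- The two terms containing the potential cancel by `bracket_left`, so ordinary derivatives of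
pairings may be replaced by covariant ones. -/
theorem pd_form_cov (β : InvariantForm ρ) (hU : IsOpen U) {X Y : Coord n → ρ.lie}
    (hX : ContDiffOn ℝ ∞ X U) (hY : ContDiffOn ℝ ∞ Y U) {y : Coord n} (hy : y ∈ U) (i : Fin n) :
    pd i (fun z => β.toBilin (X z) (Y z)) y =
      β.toBilin (covAd A X y i) (Y y) + β.toBilin (X y) (covAd A Y y i) := by
  rw [pd_form β hU hX hY hy, covAd, covAd, map_add, map_add, LinearMap.add_apply,
    β.bracket_left]
  ring

theorem pd_inner_cov (A : Fin n → Coord n → ρ.lie) (hU : IsOpen U) {f g : Coord n → W}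
    (hf : ContDiffOn ℝ ∞ f U) (hg : ContDiffOn ℝ ∞ g U) {y : Coord n} (hy : y ∈ U) (i : Fin n) :
    pd i (fun z => ⟪f z, g z⟫_ℝ) y = ⟪covDeriv A f y i, g y⟫_ℝ + ⟪f y, covDeriv A g y i⟫_ℝ := by
  rw [pd_inner hU hf hg hy, covDeriv, covDeriv, inner_add_left, inner_add_right,
    OrthogonalRep.inner_skew]
  ring

/-- The quadratic terms recombine because the bracket acts as a commutator. Applied to the parallel
`v`, this gives `∂(X v) = (∂X) v`, the identity behind all arguments about orbit directions. -/
theorem covDeriv_action (A : Fin n → Coord n → ρ.lie) (hU : IsOpen U) {X : Coord n → ρ.lie}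
    {f : Coord n → W} (hX : ContDiffOn ℝ ∞ X U) (hf : ContDiffOn ℝ ∞ f U) {y : Coord n}
    (hy : y ∈ U) (i : Fin n) : covDeriv A (fun z => (X z).1 (f z)) y i =
      (covAd A X y i).1 (f y) + (X y).1 (covDeriv A f y i) := by
  rw [covDeriv, pd_action hU hX hf hy, covDeriv, covAd, Submodule.coe_add, add_apply,
    OrthogonalRep.bracket_apply, map_add]
  abel

theorem covAd_add (hU : IsOpen U) {X Y : Coord n → ρ.lie} (hX : ContDiffOn ℝ ∞ X U)
    (hY : ContDiffOn ℝ ∞ Y U) {y : Coord n} (hy : y ∈ U) (i : Fin n) :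
    covAd A (fun z => X z + Y z) y i = covAd A X y i + covAd A Y y i := by
  rw [covAd, pd_add hU hX hY hy, bracket_add, covAd, covAd]
  abel

/-- The commutator of covariant derivatives is the bracket with the field strength. -/
theorem extCovDeriv_covAd (hU : IsOpen U) (hA : ∀ i, ContDiffOn ℝ ∞ (A i) U)
    {X : Coord n → ρ.lie} (hX : ContDiffOn ℝ ∞ X U) {y : Coord n} (hy : y ∈ U) (i j : Fin n) :
    extCovDeriv A (fun k z => covAd A X z k) y i j = ρ.bracket (curvature A y i j) (X y) := by
  have h : ∀ i j : Fin n, covAd A (fun z => covAd A X z j) y i =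
      pd i (pd j X) y + (ρ.bracket (pd i (A j) y) (X y) + ρ.bracket (A j y) (pd i X y))
        + (ρ.bracket (A i y) (pd j X y) + ρ.bracket (A i y) (ρ.bracket (A j y) (X y))) :=
    fun i j => by
      have : pd i (fun z => covAd A X z j) y = pd i (pd j X) y +
          (ρ.bracket (pd i (A j) y) (X y) + ρ.bracket (A j y) (pd i X y)) := by
        rw [← pd_bracket hU (hA j) hX hy]
        exact pd_add hU (contDiffOn_pd hU hX j) (contDiffOn_bracket (hA j) hX) hy i
      rw [covAd, this, covAd, bracket_add]
  -- Second derivatives cancel by symmetry, mixed terms cancel in pairs, and the Jacobi identity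
  -- collects the double brackets into `[[A_i, A_j], X]`.
  rw [extCovDeriv_eq, h, h, pd_comm hU hX hy i j, curvature, sub_eq_add_neg (pd i (A j) y),
    add_bracket, add_bracket, ← OrthogonalRep.bracket_bracket,
    show ρ.bracket (-pd j (A i) y) (X y) = -ρ.bracket (pd j (A i) y) (X y) from
      LinearMap.map_neg₂ ρ.bracketₗ _ _]
  abel

end Covariant

end YMH

namespace YMH

variable {n : ℕ} {G : Type*} [Group G] [TopologicalSpace G]
  {W : Type*} [NormedAddCommGroup W] [InnerProductSpace ℝ W] [FiniteDimensional ℝ W]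
  {ρ : OrthogonalRep G W}

/-! ### Codifferentials -/

section Codifferential

variable {U : Set (Coord n)} {A a : Fin n → Coord n → ρ.lie}
  {h : Coord n → Matrix (Fin n) (Fin n) ℝ} {θ θ' : Coord n → Fin n → Fin n → ρ.lie}
  {η η' : Coord n → Fin n → W}

theorem contDiffOn_raiseTwo (hh : ∀ i j, ContDiffOn ℝ ∞ (fun y => h y i j) U)
    (h0 : ∀ y ∈ U, (h y).det ≠ 0) (hθ : ∀ i j, ContDiffOn ℝ ∞ (fun y => θ y i j) U)
    (i j : Fin n) : ContDiffOn ℝ ∞ (raiseTwo h θ i j) U :=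
  contDiffOn_fun_smul (contDiffOn_volDensity hh h0) <| contDiffOn_fun_sum fun k _ =>
    contDiffOn_fun_sum fun l _ => contDiffOn_fun_smul
      ((contDiffOn_inv_apply hh h0 i k).mul (contDiffOn_inv_apply hh h0 j l)) (hθ k l)

theorem contDiffOn_raiseOne (hh : ∀ i j, ContDiffOn ℝ ∞ (fun y => h y i j) U)
    (h0 : ∀ y ∈ U, (h y).det ≠ 0) (hη : ∀ i, ContDiffOn ℝ ∞ (fun y => η y i) U)
    (i : Fin n) : ContDiffOn ℝ ∞ (raiseOne h η i) U :=
  (contDiffOn_volDensity hh h0).smul <| ContDiffOn.sum fun k _ =>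
    (contDiffOn_inv_apply hh h0 i k).smul (hη k)

theorem coDerivTwo_eq (h : Coord n → Matrix (Fin n) (Fin n) ℝ) (A : Fin n → Coord n → ρ.lie)
    (θ : Coord n → Fin n → Fin n → ρ.lie) (y : Coord n) (j : Fin n) :
    coDerivTwo h A θ y j =
      -((volDensity h y)⁻¹ • ∑ k, h y j k • ∑ i, covAd A (raiseTwo h θ i k) y i) := rfl

theorem coDerivOne_eq (h : Coord n → Matrix (Fin n) (Fin n) ℝ) (A : Fin n → Coord n → ρ.lie)
    (η : Coord n → Fin n → W) (y : Coord n) :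
    coDerivOne h A η y = -((volDensity h y)⁻¹ • ∑ i, covDeriv A (raiseOne h η i) y i) := rfl

theorem contDiffOn_coDerivTwo (hU : IsOpen U) (hA : ∀ i, ContDiffOn ℝ ∞ (A i) U)
    (hh : ∀ i j, ContDiffOn ℝ ∞ (fun y => h y i j) U)
    (h0 : ∀ y ∈ U, (h y).det ≠ 0) (hθ : ∀ i j, ContDiffOn ℝ ∞ (fun y => θ y i j) U)
    (j : Fin n) : ContDiffOn ℝ ∞ (fun y => coDerivTwo h A θ y j) U := by
  simp only [coDerivTwo_eq]
  exact (contDiffOn_fun_smul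
    ((contDiffOn_volDensity hh h0).inv fun y hy => (volDensity_pos (h0 y hy)).ne') <|
    contDiffOn_fun_sum fun k _ => contDiffOn_fun_smul (hh j k) <| contDiffOn_fun_sum fun i _ =>
      contDiffOn_covAd hU hA (contDiffOn_raiseTwo hh h0 hθ i k) i).neg

theorem contDiffOn_coDerivOne (hU : IsOpen U) (hA : ∀ i, ContDiffOn ℝ ∞ (A i) U)
    (hh : ∀ i j, ContDiffOn ℝ ∞ (fun y => h y i j) U)
    (h0 : ∀ y ∈ U, (h y).det ≠ 0) (hη : ∀ i, ContDiffOn ℝ ∞ (fun y => η y i) U) :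
    ContDiffOn ℝ ∞ (fun y => coDerivOne h A η y) U := by
  simp only [coDerivOne_eq]
  exact (((contDiffOn_volDensity hh h0).inv fun y hy => (volDensity_pos (h0 y hy)).ne').smul <|
    ContDiffOn.sum fun i _ =>
      contDiffOn_covDeriv hU hA (contDiffOn_raiseOne hh h0 hη i) i).neg

/-- A codifferential lowers the free index and divides by the volume density. This undoes both
operations, recovering the plain divergence. -/
theorem smul_sum_inv_smul {F : Type*} [AddCommGroup F] [Module ℝ F] {p q : Fin n → Fin n → ℝ}
    (e : ∀ j l, ∑ k, p j k * q k l = if j = l then 1 else 0) {v : ℝ} (hv : v ≠ 0) (S : Fin n → F)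
    (j : Fin n) : v • ∑ k, p j k • (v⁻¹ • ∑ l, q k l • S l) = S j := by
  simp only [smul_comm _ v⁻¹, ← Finset.smul_sum]
  rw [inv_smul_smul₀ hv]
  simp only [Finset.smul_sum, smul_smul]
  rw [Finset.sum_comm]
  simp only [← Finset.sum_smul, e]
  simp

theorem sum_inv_mul {m : Matrix (Fin n) (Fin n) ℝ} (hm : m.det ≠ 0) (j l : Fin n) :
    ∑ k, m⁻¹ j k * m k l = if j = l then 1 else 0 := by
  rw [← Matrix.mul_apply, Matrix.nonsing_inv_mul _ (isUnit_iff_ne_zero.2 hm), Matrix.one_apply]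

theorem smul_sum_swap {F : Type*} [AddCommGroup F] [Module ℝ F] (m : Matrix (Fin n) (Fin n) ℝ)
    (v : ℝ) {θ : Fin n → Fin n → F} (hθ : ∀ i j, θ i j = -θ j i) (i j : Fin n) :
    v • ∑ k, ∑ l, (m i k * m j l) • θ k l = -(v • ∑ k, ∑ l, (m j k * m i l) • θ k l) := by
  rw [Finset.sum_comm, ← smul_neg, ← Finset.sum_neg_distrib]
  simp only [← Finset.sum_neg_distrib, ← smul_neg]
  refine congrArg _ (Finset.sum_congr rfl fun k _ => Finset.sum_congr rfl fun l _ => ?_)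
  rw [mul_comm, hθ]

/-- The divergence of a 2-form is its codifferential with raised index. -/
theorem sum_covAd_raiseTwo {y : Coord n} (h0 : (h y).det ≠ 0) (j : Fin n) :
    ∑ i, covAd A (raiseTwo h θ i j) y i =
      -(volDensity h y • ∑ k, (h y)⁻¹ j k • coDerivTwo h A θ y k) := by
  have e := smul_sum_inv_smul (sum_inv_mul h0) (volDensity_pos h0).ne'
    (fun l => -∑ i, covAd A (raiseTwo h θ i l) y i) j
  simp only [coDerivTwo_eq]
  rw [← neg_eq_iff_eq_neg, ← e]
  simp only [smul_neg, Finset.sum_neg_distrib]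

theorem sum_covDeriv_raiseOne {y : Coord n} (h0 : (h y).det ≠ 0) :
    ∑ i, covDeriv A (raiseOne h η i) y i = -(volDensity h y • coDerivOne h A η y) := by
  rw [coDerivOne_eq, smul_neg, neg_neg, smul_inv_smul₀ (volDensity_pos h0).ne']

theorem raiseTwo_swap (hθ : ∀ y i j, θ y i j = -θ y j i) (i j : Fin n) (y : Coord n) :
    raiseTwo h θ i j y = -raiseTwo h θ j i y :=
  smul_sum_swap (F := ρ.lie) (h y)⁻¹ (volDensity h y) (hθ y) i j

/-- The pairing `g^{ik} g^{jl} β(θ_ij, θ'_kl)` of adjoint-valued 2-forms. -/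
noncomputable def pairTwo (β : InvariantForm ρ) (m : Matrix (Fin n) (Fin n) ℝ)
    (C C' : Fin n → Fin n → ρ.lie) : ℝ :=
  ∑ i, ∑ j, ∑ a, ∑ b, m i a * m j b * β.toBilin (C i j) (C' a b)

/-- The pairing `g^{ij} ⟪η_i, η'_j⟫` of 1-forms. -/
noncomputable def pairOne (m : Matrix (Fin n) (Fin n) ℝ) (C C' : Fin n → W) : ℝ :=
  ∑ i, ∑ j, m i j * ⟪C i, C' j⟫_ℝ

/-- Moves the inverse metric from one argument onto the pairing, so that integration by parts can
act on the raised form with its density already absorbed. Symmetry of the inverse metric matches the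
order of indices. -/
theorem sum_form_raiseTwo (β : InvariantForm ρ) {y : Coord n} (hs : ((h y)⁻¹).IsSymm)
    (C' : Fin n → Fin n → ρ.lie) :
    ∑ i, ∑ j, β.toBilin (raiseTwo h θ i j y) (C' i j) =
      volDensity h y * pairTwo β (h y)⁻¹ (θ y) C' := by
  have e : ∀ i j, β.toBilin (raiseTwo h θ i j y) (C' i j) = ∑ a, ∑ b, volDensity h y *
      ((h y)⁻¹ a i * (h y)⁻¹ b j * β.toBilin (θ y a b) (C' i j)) := fun i j => by
    simp only [raiseTwo, map_smul, map_sum, LinearMap.smul_apply, LinearMap.sum_apply,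
      smul_eq_mul, Finset.mul_sum]
    refine Finset.sum_congr rfl fun a _ => Finset.sum_congr rfl fun b _ => ?_
    rw [hs.apply i a, hs.apply j b]
  simp only [e, pairTwo, Finset.mul_sum]
  calc _ = ∑ i, ∑ a, ∑ j, ∑ b, volDensity h y *
        ((h y)⁻¹ a i * (h y)⁻¹ b j * β.toBilin (θ y a b) (C' i j)) :=
        Finset.sum_congr rfl fun i _ => Finset.sum_comm
    _ = ∑ a, ∑ i, ∑ b, ∑ j, volDensity h y *
        ((h y)⁻¹ a i * (h y)⁻¹ b j * β.toBilin (θ y a b) (C' i j)) := by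
        rw [Finset.sum_comm]
        exact Finset.sum_congr rfl fun a _ => Finset.sum_congr rfl fun i _ => Finset.sum_comm
    _ = _ := Finset.sum_congr rfl fun a _ => Finset.sum_comm

theorem sum_inner_raiseOne {y : Coord n} (hs : ((h y)⁻¹).IsSymm) (C' : Fin n → W) :
    ∑ i, ⟪raiseOne h η i y, C' i⟫_ℝ = volDensity h y * pairOne (h y)⁻¹ (η y) C' := by
  have e : ∀ i, ⟪raiseOne h η i y, C' i⟫_ℝ =
      ∑ a, volDensity h y * ((h y)⁻¹ a i * ⟪η y a, C' i⟫_ℝ) := fun i => by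
    simp only [raiseOne, real_inner_smul_left, sum_inner, Finset.mul_sum]
    refine Finset.sum_congr rfl fun a _ => ?_
    rw [hs.apply i a]
  simp only [e, pairOne, Finset.mul_sum]
  exact Finset.sum_comm

/-! ### Integration by parts -/

open MeasureTheory

section Parts

variable {K : Set (Coord n)}

theorem eq_zero_of_notMem_of_tsupport_subset {F : Type*} [Zero F] {f : Coord n → F}
    (hf : tsupport f ⊆ K) {y : Coord n} (hy : y ∉ K) : f y = 0 :=
  image_eq_zero_of_notMem_tsupport fun h => hy (hf h)

/-- The codifferential of 2-forms is the formal adjoint of the exterior covariant derivative. -/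
theorem integral_pairTwo_extCovDeriv (β : InvariantForm ρ) (hU : IsOpen U)
    (hA : ∀ i, ContDiffOn ℝ ∞ (A i) U) (hh : ∀ i j, ContDiffOn ℝ ∞ (fun y => h y i j) U)
    (h0 : ∀ y ∈ U, (h y).det ≠ 0) (hs : ∀ y ∈ U, ((h y)⁻¹).IsSymm)
    (hθ : ∀ i j, ContDiffOn ℝ ∞ (fun y => θ y i j) U) (hθ' : ∀ y i j, θ y i j = -θ y j i)
    (hK : IsCompact K) (hKU : K ⊆ U) {α : Fin n → Coord n → ρ.lie}
    (hα : ∀ i, ContDiffOn ℝ ∞ (α i) U) (hαK : ∀ i, ∀ y ∉ K, α i y = 0) :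
    ∫ y in K, volDensity h y * pairTwo β (h y)⁻¹ (θ y) (extCovDeriv A α y) =
      ∫ y in K, volDensity h y *
        (2 * ∑ j, ∑ k, (h y)⁻¹ j k * β.toBilin (coDerivTwo h A θ y k) (α j y)) := by
  have hR := contDiffOn_raiseTwo hh h0 hθ
  have hb : ∀ i j, ContDiffOn ℝ ∞ (fun z => β.toBilin (raiseTwo h θ i j z) (α j z)) U :=
    fun i j => contDiffOn_form β (hR i j) (hα j)
  have hint : ∀ i j, ∫ y in K, pd i (fun z => β.toBilin (raiseTwo h θ i j z) (α j z)) y = 0 :=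
    fun i j => setIntegral_fderiv_eq_zero hU hK hKU (hb i j) (fun y hy => by
      rw [hαK j y hy, map_zero]) _
  have hi : ∀ i j, IntegrableOn (fun y => 2 * pd i
      (fun z => β.toBilin (raiseTwo h θ i j z) (α j z)) y) K := fun i j =>
    (((contDiffOn_pd hU (hb i j) i).continuousOn.mono hKU).const_smul
      (2 : ℝ)).integrableOn_compact hK
  have hzero : ∫ y in K, ∑ i, ∑ j, 2 * pd i
      (fun z => β.toBilin (raiseTwo h θ i j z) (α j z)) y = 0 := by
    rw [integral_finsetSum _ fun i _ => integrable_finsetSum _ fun j _ => hi i j]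
    refine Finset.sum_eq_zero fun i _ => ?_
    rw [integral_finsetSum _ fun j _ => hi i j]
    refine Finset.sum_eq_zero fun j _ => ?_
    rw [integral_const_mul, hint, mul_zero]
  have hint2 : IntegrableOn (fun y => volDensity h y *
        (2 * ∑ j, ∑ k, (h y)⁻¹ j k * β.toBilin (coDerivTwo h A θ y k) (α j y))) K := by
    refine ContinuousOn.integrableOn_compact hK (ContinuousOn.mono ?_ hKU)
    exact ((contDiffOn_volDensity hh h0).mul <| contDiffOn_const.mul <|
      ContDiffOn.sum fun j _ => ContDiffOn.sum fun k _ => (contDiffOn_inv_apply hh h0 j k).mul <|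
        contDiffOn_form β (contDiffOn_coDerivTwo hU hA hh h0 hθ k) (hα j)).continuousOn
  -- Both sides differ by the integral of a divergence, which vanishes by compact support; adding it
  -- reduces the claim to a pointwise identity.
  rw [← add_zero (∫ y in K, volDensity h y * (2 * _)), ← hzero, ← integral_add hint2
    (integrable_finsetSum _ fun i _ => integrable_finsetSum _ fun j _ => hi i j)]
  refine setIntegral_congr_fun hK.measurableSet fun y hy => ?_
  have hyU := hKU hy
  rw [← sum_form_raiseTwo β (hs y hyU)]
  -- The raised form is antisymmetric, so the two halves of `∂α` contribute equally. This is the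
  -- factor 2 of the full sum over index pairs.
  have e1 : ∑ i, ∑ j, β.toBilin (raiseTwo h θ i j y) (extCovDeriv A α y i j) =
      2 * ∑ i, ∑ j, β.toBilin (raiseTwo h θ i j y) (covAd A (α j) y i) := by
    have e : ∀ i j, β.toBilin (raiseTwo h θ i j y) (covAd A (α i) y j) =
        -β.toBilin (raiseTwo h θ j i y) (covAd A (α i) y j) := fun i j => by
      rw [raiseTwo_swap hθ' i j, map_neg, LinearMap.neg_apply]
    simp only [extCovDeriv_eq, map_sub, Finset.sum_sub_distrib, e, Finset.sum_neg_distrib]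
    rw [Finset.sum_comm (f := fun i j => β.toBilin (raiseTwo h θ j i y) (covAd A (α i) y j))]
    ring
  have e2 : ∀ i j, pd i (fun z => β.toBilin (raiseTwo h θ i j z) (α j z)) y =
      β.toBilin (covAd A (raiseTwo h θ i j) y i) (α j y) +
        β.toBilin (raiseTwo h θ i j y) (covAd A (α j) y i) := fun i j =>
    pd_form_cov β hU (hR i j) (hα j) hyU i
  have e3 : ∑ i, ∑ j, β.toBilin (covAd A (raiseTwo h θ i j) y i) (α j y) =
      -(volDensity h y * ∑ j, ∑ k, (h y)⁻¹ j k * β.toBilin (coDerivTwo h A θ y k) (α j y)) := by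
    rw [Finset.sum_comm, Finset.mul_sum, ← Finset.sum_neg_distrib]
    refine Finset.sum_congr rfl fun j _ => ?_
    rw [← LinearMap.sum_apply, ← map_sum, sum_covAd_raiseTwo (h0 y hyU)]
    simp
  rw [e1]
  simp only [e2, ← Finset.mul_sum, Finset.sum_add_distrib]
  rw [e3]
  ring

/-- The codifferential of 1-forms is the formal adjoint of the covariant derivative. -/
theorem integral_pairOne_covDeriv (hU : IsOpen U)
    (hA : ∀ i, ContDiffOn ℝ ∞ (A i) U) (hh : ∀ i j, ContDiffOn ℝ ∞ (fun y => h y i j) U)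
    (h0 : ∀ y ∈ U, (h y).det ≠ 0) (hs : ∀ y ∈ U, ((h y)⁻¹).IsSymm)
    (hη : ∀ i, ContDiffOn ℝ ∞ (fun y => η y i) U) (hK : IsCompact K) (hKU : K ⊆ U)
    {ψ : Coord n → W} (hψ : ContDiffOn ℝ ∞ ψ U) (hψK : ∀ y ∉ K, ψ y = 0) :
    ∫ y in K, volDensity h y * pairOne (h y)⁻¹ (η y) (covDeriv A ψ y) =
      ∫ y in K, volDensity h y * ⟪coDerivOne h A η y, ψ y⟫_ℝ := by
  have hR := contDiffOn_raiseOne hh h0 hη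
  have hb : ∀ i, ContDiffOn ℝ ∞ (fun z => ⟪raiseOne h η i z, ψ z⟫_ℝ) U :=
    fun i => (hR i).inner ℝ hψ
  have hint : ∀ i, ∫ y in K, pd i (fun z => ⟪raiseOne h η i z, ψ z⟫_ℝ) y = 0 :=
    fun i => setIntegral_fderiv_eq_zero hU hK hKU (hb i) (fun y hy => by
      rw [hψK y hy, inner_zero_right]) _
  have hi : ∀ i, IntegrableOn (fun y => pd i (fun z => ⟪raiseOne h η i z, ψ z⟫_ℝ) y) K :=
    fun i => ((contDiffOn_pd hU (hb i) i).continuousOn.mono hKU).integrableOn_compact hK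
  have hzero : ∫ y in K, ∑ i, pd i (fun z => ⟪raiseOne h η i z, ψ z⟫_ℝ) y = 0 := by
    rw [integral_finsetSum _ fun i _ => hi i]
    exact Finset.sum_eq_zero fun i _ => hint i
  have hint2 : IntegrableOn (fun y => volDensity h y * ⟪coDerivOne h A η y, ψ y⟫_ℝ) K :=
    (((contDiffOn_volDensity hh h0).mul ((contDiffOn_coDerivOne hU hA hh h0 hη).inner ℝ
      hψ)).continuousOn.mono hKU).integrableOn_compact hK
  rw [← add_zero (∫ y in K, volDensity h y * ⟪_, _⟫_ℝ), ← hzero, ← integral_add hint2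
    (integrable_finsetSum _ fun i _ => hi i)]
  refine setIntegral_congr_fun hK.measurableSet fun y hy => ?_
  have hyU := hKU hy
  rw [← sum_inner_raiseOne (hs y hyU)]
  have e2 : ∀ i, pd i (fun z => ⟪raiseOne h η i z, ψ z⟫_ℝ) y =
      ⟪covDeriv A (raiseOne h η i) y i, ψ y⟫_ℝ + ⟪raiseOne h η i y, covDeriv A ψ y i⟫_ℝ :=
    fun i => pd_inner_cov A hU (hR i) hψ hyU i
  simp only [e2, Finset.sum_add_distrib]
  rw [← sum_inner, sum_covDeriv_raiseOne (h0 y hyU), inner_neg_left, real_inner_smul_left]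
  ring

end Parts

end Codifferential

end YMH

namespace YMH

/-! ### Mixed second derivatives of two-parameter families -/

/-- `F t ε` has an `ε`-derivative at `ε = 0` for every `t`, which vanishes at `t = 0` and has the
`t`-derivative `m` there. -/
def HasMixedDeriv (F : ℝ → ℝ → ℝ) (m : ℝ) : Prop :=
  ∃ d : ℝ → ℝ, (∀ t, HasDerivAt (F t) (d t) 0) ∧ d 0 = 0 ∧ HasDerivAt d m 0

namespace HasMixedDeriv

variable {F F' : ℝ → ℝ → ℝ} {m m' : ℝ}

theorem add (h : HasMixedDeriv F m) (h' : HasMixedDeriv F' m') :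
    HasMixedDeriv (fun t ε => F t ε + F' t ε) (m + m') := by
  obtain ⟨d, h1, h2, h3⟩ := h
  obtain ⟨d', h1', h2', h3'⟩ := h'
  exact ⟨fun t => d t + d' t, fun t => (h1 t).add (h1' t), by simp [h2, h2'], h3.add h3'⟩

theorem const_mul (c : ℝ) (h : HasMixedDeriv F m) :
    HasMixedDeriv (fun t ε => c * F t ε) (c * m) := by
  obtain ⟨d, h1, h2, h3⟩ := h
  exact ⟨fun t => c * d t, fun t => (h1 t).const_mul c, by simp [h2], h3.const_mul c⟩

theorem sum {ι : Type*} (s : Finset ι) {F : ι → ℝ → ℝ → ℝ} {m : ι → ℝ}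
    (h : ∀ i, HasMixedDeriv (F i) (m i)) :
    HasMixedDeriv (fun t ε => ∑ i ∈ s, F i t ε) (∑ i ∈ s, m i) := by
  choose d h1 h2 h3 using h
  exact ⟨fun t => ∑ i ∈ s, d i t, fun t => HasDerivAt.fun_sum fun i _ => h1 i t, by simp [h2],
    HasDerivAt.fun_sum fun i _ => h3 i⟩

theorem deriv_zero_zero (h : HasMixedDeriv F m) : deriv (F 0) 0 = 0 := by
  obtain ⟨d, h1, h2, -⟩ := h
  rw [(h1 0).deriv, h2]

theorem deriv_deriv (h : HasMixedDeriv F m) : deriv (fun t => deriv (F t) 0) 0 = m := by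
  obtain ⟨d, h1, -, h3⟩ := h
  rw [show (fun t => deriv (F t) 0) = d from funext fun t => (h1 t).deriv, h3.deriv]

end HasMixedDeriv

/-- A quadratic polynomial in two parameters without constant term. -/
def quadFamily {F : Type*} [NormedAddCommGroup F] [NormedSpace ℝ F] (c₁ c₂ c₃ c₄ c₅ : F) (t ε : ℝ) : F :=
  t • c₁ + ε • c₂ + t ^ 2 • c₃ + (t * ε) • c₄ + ε ^ 2 • c₅

section QuadFamily

theorem hasDerivAt_quadFamily {F : Type*} [NormedAddCommGroup F] [NormedSpace ℝ F]
    (c₁ c₂ c₃ c₄ c₅ : F) (t : ℝ) :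
    HasDerivAt (fun ε => quadFamily c₁ c₂ c₃ c₄ c₅ t ε) (c₂ + t • c₄) 0 := by
  have hid := hasDerivAt_id (0 : ℝ)
  have h := ((((hasDerivAt_const (0 : ℝ) (t • c₁)).fun_add (hid.smul_const c₂)).fun_add
    (hasDerivAt_const (0 : ℝ) (t ^ 2 • c₃))).fun_add ((hid.const_mul t).smul_const c₄)).fun_add
    ((hid.pow 2).smul_const c₅)
  refine (h.congr_deriv ?_)
  simp

theorem hasDerivAt_quadFamily_zero {F : Type*} [NormedAddCommGroup F] [NormedSpace ℝ F]
    (c₁ c₂ c₃ c₄ c₅ : F) :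
    HasDerivAt (fun t : ℝ => quadFamily c₁ c₂ c₃ c₄ c₅ t 0) c₁ 0 := by
  -- The two parameters exchange roles, and with them `c₁` and `c₂`, `c₃` and `c₅`.
  have h := hasDerivAt_quadFamily c₂ c₁ c₅ c₄ c₃ 0
  rw [zero_smul, add_zero] at h
  refine h.congr_of_eventuallyEq (Filter.Eventually.of_forall fun t => ?_)
  simp [quadFamily]

theorem hasDerivAt_const_add_smul {F : Type*} [NormedAddCommGroup F] [NormedSpace ℝ F]
    (c c' : F) : HasDerivAt (fun t : ℝ => c + t • c') c' 0 := by
  simpa using (((hasDerivAt_id (0 : ℝ)).smul_const c').const_add c)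

/-- Neither factor has a constant term, so only the coefficients linear in `t` and in `ε` reach
order `t ε`. This is why the quadratic brackets of the fluctuation with the variation never enter
the linearized equations. -/
theorem hasMixedDeriv_bilin {F₁ F₂ : Type*} [NormedAddCommGroup F₁] [NormedSpace ℝ F₁]
    [FiniteDimensional ℝ F₁] [NormedAddCommGroup F₂] [NormedSpace ℝ F₂] [FiniteDimensional ℝ F₂]
    (b : F₁ →ₗ[ℝ] F₂ →ₗ[ℝ] ℝ) (x₁ x₂ x₃ x₄ x₅ : F₁) (y₁ y₂ y₃ y₄ y₅ : F₂) :
    HasMixedDeriv (fun t ε => b (quadFamily x₁ x₂ x₃ x₄ x₅ t ε) (quadFamily y₁ y₂ y₃ y₄ y₅ t ε))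
      (b x₂ y₁ + b x₁ y₂) := by
  refine ⟨fun t => b (x₂ + t • x₄) (quadFamily y₁ y₂ y₃ y₄ y₅ t 0) +
    b (quadFamily x₁ x₂ x₃ x₄ x₅ t 0) (y₂ + t • y₄), fun t => ?_, ?_, ?_⟩
  · exact hasDerivAt_bilin b (hasDerivAt_quadFamily x₁ x₂ x₃ x₄ x₅ t)
      (hasDerivAt_quadFamily y₁ y₂ y₃ y₄ y₅ t)
  · simp [quadFamily]
  · have h := (hasDerivAt_bilin b (hasDerivAt_const_add_smul x₂ x₄)
      (hasDerivAt_quadFamily_zero y₁ y₂ y₃ y₄ y₅)).add (hasDerivAt_bilin b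
        (hasDerivAt_quadFamily_zero x₁ x₂ x₃ x₄ x₅) (hasDerivAt_const_add_smul y₂ y₄))
    refine h.congr_deriv ?_
    simp [quadFamily]

theorem contDiffOn_quadFamily {E F : Type*} [NormedAddCommGroup E] [NormedSpace ℝ E]
    [NormedAddCommGroup F] [NormedSpace ℝ F] {U : Set E} {c₁ c₂ c₃ c₄ c₅ : E → F}
    (h₁ : ContDiffOn ℝ ∞ c₁ U) (h₂ : ContDiffOn ℝ ∞ c₂ U) (h₃ : ContDiffOn ℝ ∞ c₃ U)
    (h₄ : ContDiffOn ℝ ∞ c₄ U) (h₅ : ContDiffOn ℝ ∞ c₅ U) :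
    ContDiffOn ℝ ∞ (fun p : ℝ × ℝ × E =>
      quadFamily (c₁ p.2.2) (c₂ p.2.2) (c₃ p.2.2) (c₄ p.2.2) (c₅ p.2.2) p.2.1 p.1)
      (univ ×ˢ univ ×ˢ U) := by
  have hp : ∀ {c : E → F}, ContDiffOn ℝ ∞ c U →
      ContDiffOn ℝ ∞ (fun p : ℝ × ℝ × E => c p.2.2) (univ ×ˢ univ ×ˢ U) := fun hc =>
    hc.comp (contDiff_snd.snd).contDiffOn fun p hp => hp.2.2
  have ht : ContDiffOn ℝ ∞ (fun p : ℝ × ℝ × E => p.2.1) (univ ×ˢ univ ×ˢ U) :=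
    contDiff_snd.fst.contDiffOn
  have hε : ContDiffOn ℝ ∞ (fun p : ℝ × ℝ × E => p.1) (univ ×ˢ univ ×ˢ U) :=
    contDiff_fst.contDiffOn
  exact ((((ht.smul (hp h₁)).add (hε.smul (hp h₂))).add ((ht.pow 2).smul (hp h₃))).add
    ((ht.mul hε).smul (hp h₄))).add ((hε.pow 2).smul (hp h₅))

end QuadFamily

/-- Criticality of `z` removes the `ε`-derivative at `t = 0`; differentiating it in `t` produces the
Hessian. -/
theorem hasMixedDeriv_comp_affine {F : Type*} [NormedAddCommGroup F] [NormedSpace ℝ F]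
    {V : F → ℝ} (hV : ContDiff ℝ ∞ V) {z : F} (hz : fderiv ℝ V z = 0) (x w : F) :
    HasMixedDeriv (fun t ε => V (z + t • x + ε • w)) (fderiv ℝ (fderiv ℝ V) z x w) := by
  have hd1 : Differentiable ℝ V := hV.differentiable (by simp)
  have hd2 : Differentiable ℝ (fderiv ℝ V) :=
    (hV.fderiv_right (m := ∞) (by simp)).differentiable (by simp)
  refine ⟨fun t => fderiv ℝ V (z + t • x) w, fun t => ?_, by simp [hz], ?_⟩
  · have h := (hd1 (z + t • x + (0 : ℝ) • w)).hasFDerivAt.comp_hasDerivAt (0 : ℝ)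
      (hasDerivAt_const_add_smul (z + t • x) w)
    rw [zero_smul, add_zero] at h
    exact h
  · have h := (hd2 (z + (0 : ℝ) • x)).hasFDerivAt.comp_hasDerivAt (0 : ℝ)
      (hasDerivAt_const_add_smul z x)
    simpa using h.clm_apply (hasDerivAt_const (0 : ℝ) w)

/-! ### The first variation as a function of the fluctuation parameter -/

section Integral

open MeasureTheory

/-- The first variation of an integral functional along a two-parameter family is `O(t²)` if and
only if the integral of the mixed second derivative vanishes. -/
theorem exists_hasDerivAt_isBigO_iff {E : Type*} [NormedAddCommGroup E]
    [NormedSpace ℝ E] [MeasurableSpace E] [BorelSpace E] {μ : Measure E}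
    [IsFiniteMeasureOnCompacts μ] {F : ℝ → ℝ → E → ℝ} {m : E → ℝ} {U K : Set E} (hU : IsOpen U)
    (hF : ContDiffOn ℝ ∞ (fun p : ℝ × ℝ × E => F p.2.1 p.1 p.2.2) (univ ×ˢ univ ×ˢ U))
    (hm : ∀ y ∈ U, HasMixedDeriv (fun t ε => F t ε y) (m y)) (hK : IsCompact K) (hKU : K ⊆ U)
    {J : ℝ → ℝ → ℝ} (hJ : ∀ t ∈ Icc (0 : ℝ) 1, ∀ ε, J t ε = ∫ y in K, F t ε y ∂μ) :
    (∃ D : ℝ → ℝ, (∀ t ∈ Icc (0 : ℝ) 1, HasDerivAt (J t) (D t) 0) ∧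
      D =O[𝓝[Icc 0 1] 0] fun t => t ^ 2) ↔ ∫ y in K, m y ∂μ = 0 := by
  set ℓ : ℝ → E → ℝ := fun t y => deriv (fun ε => F t ε y) 0 with hℓ
  set I : ℝ → ℝ := fun t => ∫ y in K, ℓ t y ∂μ with hI
  have hop : IsOpen ((univ : Set ℝ) ×ˢ U) := isOpen_univ.prod hU
  have hℓs : ContDiffOn ℝ ∞ (fun p : ℝ × E => ℓ p.1 p.2) (univ ×ˢ U) := by
    -- Here `ε` is the parameter and the pair `(t, y)` plays the role of the space variable, which
    -- explains the order of the factors in `hF`.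
    have h := contDiffOn_deriv_param (E := ℝ × E) (f := fun ε q => F q.1 ε q.2) hop hF
    exact h.comp (g := fun p : ℝ × ℝ × E => deriv (fun ε => F p.2.1 ε p.2.2) p.1)
      (f := fun q : ℝ × E => ((0 : ℝ), q)) (by fun_prop) fun q hq => ⟨mem_univ _, hq⟩
  -- The functional `J` is controlled only for `0 ≤ t ≤ 1`, whereas `I` is defined by the integrand
  -- for every real `t`, so that its two-sided derivative at `0` makes sense.
  have hJI : ∀ t ∈ Icc (0 : ℝ) 1, HasDerivAt (J t) (I t) 0 := fun t ht => by
    have hs : ContDiffOn ℝ ∞ (fun p : ℝ × E => F t p.1 p.2) (univ ×ˢ U) :=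
      hF.comp (f := fun p : ℝ × E => (p.1, t, p.2)) (by fun_prop)
        fun p hp => ⟨mem_univ _, mem_univ _, hp.2⟩
    exact (hasDerivAt_setIntegral_of_contDiffOn (μ := μ) hU hs hK hKU 0).congr_of_eventuallyEq
      (Filter.Eventually.of_forall fun ε => hJ t ht ε)
  have hI0 : I 0 = 0 :=
    (setIntegral_congr_fun hK.measurableSet fun y hy => (hm y (hKU hy)).deriv_zero_zero).trans
      (by simp)
  have hI' : ∀ t, HasDerivAt I (∫ y in K, deriv (fun t => ℓ t y) t ∂μ) t :=
    hasDerivAt_setIntegral_of_contDiffOn hU hℓs hK hKU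
  have hI'' := hasDerivAt_setIntegral_of_contDiffOn (μ := μ) hU
    (f := fun t y => deriv (fun t => ℓ t y) t) (contDiffOn_deriv_param hU hℓs) hK hKU 0
  have hmain := isBigO_sq_iff_of_contDiff hI0 hI' hI''.differentiableAt
  have hI0' : ∫ y in K, deriv (fun t => ℓ t y) 0 ∂μ = ∫ y in K, m y ∂μ :=
    setIntegral_congr_fun hK.measurableSet fun y hy => (hm y (hKU hy)).deriv_deriv
  rw [hI0'] at hmain
  rw [← hmain]
  constructor
  · rintro ⟨D, hD, hO⟩
    refine hO.congr' ?_ Filter.EventuallyEq.rfl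
    filter_upwards [self_mem_nhdsWithin] with t ht using (hD t ht).unique (hJI t ht)
  · exact fun h => ⟨I, hJI, h⟩

end Integral

variable {n : ℕ} {G : Type*} [Group G] [TopologicalSpace G]
  {W : Type*} [NormedAddCommGroup W] [InnerProductSpace ℝ W] [FiniteDimensional ℝ W]
  {ρ : OrthogonalRep G W}

/-! ### The first variation around a vacuum pair in coordinates -/

/-- The coordinate expression of a vacuum pair: a metric `h`, a flat gauge potential `Ξ` and a
parallel field `v` of minima of the potential on an open set `U`. -/
structure LocalVacuumPair (V : W → ℝ) (h : Coord n → Matrix (Fin n) (Fin n) ℝ)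
    (U : Set (Coord n)) (Ξ : Fin n → Coord n → ρ.lie) (v : Coord n → W) : Prop where
  isOpen : IsOpen U
  smooth_metric : ∀ i j, ContDiffOn ℝ ∞ (fun y => h y i j) U
  det_ne_zero : ∀ y ∈ U, (h y).det ≠ 0
  isSymm : ∀ y ∈ U, (h y).IsSymm
  smooth_potential : ∀ i, ContDiffOn ℝ ∞ (Ξ i) U
  smooth_vacuum : ContDiffOn ℝ ∞ v U
  flat : ∀ y ∈ U, ∀ i j, curvature Ξ y i j = 0
  parallel : ∀ y ∈ U, ∀ i, covDeriv Ξ v y i = 0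
  minimum : ∀ y ∈ U, ∀ w, V (v y) ≤ V w

/-- The integrand of the term of first order in `t` of the first variation of the action. -/
noncomputable def linearizedVariation (k : Normalization) (β : InvariantForm ρ) (V : W → ℝ)
    (h : Coord n → Matrix (Fin n) (Fin n) ℝ) (Ξ : Fin n → Coord n → ρ.lie) (v : Coord n → W)
    (a : Fin n → Coord n → ρ.lie) (φ : Coord n → W) (α : Fin n → Coord n → ρ.lie)
    (ψ : Coord n → W) (y : Coord n) : ℝ :=
  (k.s * k.cYM * pairTwo β (h y)⁻¹ (extCovDeriv Ξ a y) (extCovDeriv Ξ α y) +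
    k.cH * (2 * pairOne (h y)⁻¹ (fun i => covDeriv Ξ φ y i + (a i y).1 (v y))
      (fun i => covDeriv Ξ ψ y i + (α i y).1 (v y))) +
    k.s * k.cV * hess V (v y) (φ y) (ψ y)) * volDensity h y

theorem pairTwo_comm (β : InvariantForm ρ) {m : Matrix (Fin n) (Fin n) ℝ} (hm : m.IsSymm)
    (C C' : Fin n → Fin n → ρ.lie) : pairTwo β m C C' = pairTwo β m C' C := by
  have e : ∀ i j a b, m i a * m j b * β.toBilin (C i j) (C' a b) =
      m a i * m b j * β.toBilin (C' a b) (C i j) := fun i j a b => by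
    rw [hm.apply a i, hm.apply b j, β.symm]
  simp only [pairTwo, e]
  calc _ = ∑ i, ∑ a, ∑ j, ∑ b, m a i * m b j * β.toBilin (C' a b) (C i j) :=
        Finset.sum_congr rfl fun i _ => Finset.sum_comm
    _ = ∑ a, ∑ i, ∑ b, ∑ j, m a i * m b j * β.toBilin (C' a b) (C i j) := by
        rw [Finset.sum_comm]
        exact Finset.sum_congr rfl fun a _ => Finset.sum_congr rfl fun i _ => Finset.sum_comm
    _ = _ := Finset.sum_congr rfl fun a _ => Finset.sum_comm

theorem pairOne_comm {m : Matrix (Fin n) (Fin n) ℝ} (hm : m.IsSymm) (C C' : Fin n → W) :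
    pairOne m C C' = pairOne m C' C := by
  simp only [pairOne]
  rw [Finset.sum_comm]
  refine Finset.sum_congr rfl fun i _ => Finset.sum_congr rfl fun j _ => ?_
  rw [hm.apply i j, real_inner_comm]

/-- The hypothesis `hx` is flatness of the background: it removes the constant term. Stating the
identity over an abstract module reduces it to comparing coefficients of powers of `t` and `ε`. -/
theorem curvature_expansion {F : Type*} [AddCommGroup F] [Module ℝ F]
    {x₁ x₂ x₃ x₄ x₅ x₆ x₇ b₁ b₂ b₃ b₄ b₅ b₆ b₇ b₈ : F} (hx : x₁ - x₂ + x₇ = 0) (t ε : ℝ) :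
    x₁ + t • x₃ + ε • x₅ - (x₂ + t • x₄ + ε • x₆) +
      (x₇ + t • -b₁ + ε • -b₂ + t • (b₃ + t • b₄ + ε • b₅) + ε • (b₆ + t • b₇ + ε • b₈)) =
    t • (x₃ - x₄ + b₃ - b₁) + ε • (x₅ - x₆ + b₆ - b₂) + t ^ 2 • b₄ + (t * ε) • (b₇ + b₅) +
      ε ^ 2 • b₈ := by
  rw [← sub_eq_zero, ← hx]
  module

theorem covDeriv_expansion {F : Type*} [AddCommGroup F] [Module ℝ F]
    {x₁ x₂ x₃ x₇ b₁ b₂ b₃ b₄ b₅ b₆ b₇ b₈ : F} (hx : x₁ + x₇ = 0) (t ε : ℝ) :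
    x₁ + t • x₂ + ε • x₃ +
      (x₇ + t • b₁ + ε • b₂ + t • (b₃ + t • b₄ + ε • b₅) + ε • (b₆ + t • b₇ + ε • b₈)) =
    t • (x₂ + b₃ + b₁) + ε • (x₃ + b₆ + b₂) + t ^ 2 • b₄ + (t * ε) • (b₇ + b₅) +
      ε ^ 2 • b₈ := by
  rw [← sub_eq_zero, ← hx]
  module

/-! ### Expansion of the field strength and of the covariant derivative -/

namespace LocalVacuumPair

variable {V : W → ℝ} {h : Coord n → Matrix (Fin n) (Fin n) ℝ}
    {U : Set (Coord n)} {Ξ : Fin n → Coord n → ρ.lie} {v : Coord n → W}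

theorem isSymm_inv (H : LocalVacuumPair V h U Ξ v) : ∀ y ∈ U, ((h y)⁻¹).IsSymm := fun y hy => by
  rw [Matrix.IsSymm, Matrix.transpose_nonsing_inv, (H.isSymm y hy).eq]

theorem curvature_eq (H : LocalVacuumPair V h U Ξ v) {a α A : Fin n → Coord n → ρ.lie}
    (ha : ∀ i, ContDiffOn ℝ ∞ (a i) U) (hα : ∀ i, ContDiffOn ℝ ∞ (α i) U) {t ε : ℝ}
    (hA : ∀ i, ∀ y ∈ U, A i y = Ξ i y + t • a i y + ε • α i y) {y : Coord n} (hy : y ∈ U)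
    (i j : Fin n) : curvature A y i j = quadFamily (extCovDeriv Ξ a y i j) (extCovDeriv Ξ α y i j)
      (ρ.bracket (a i y) (a j y)) (ρ.bracket (a i y) (α j y) + ρ.bracket (α i y) (a j y))
      (ρ.bracket (α i y) (α j y)) t ε := by
  have hU := H.isOpen
  have hpd : ∀ i j, pd i (A j) y = pd i (Ξ j) y + t • pd i (a j) y + ε • pd i (α j) y :=
    fun i j => by
      have hta : ContDiffOn ℝ ∞ (fun z => t • a j z) U := contDiffOn_fun_smul contDiffOn_const (ha j)
      have hεα : ContDiffOn ℝ ∞ (fun z => ε • α j z) U := contDiffOn_fun_smul contDiffOn_const (hα j)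
      rw [pd_congr hU (hA j) hy, pd_add hU ((H.smooth_potential j).add hta) hεα hy,
        pd_add hU (H.smooth_potential j) hta hy, pd_const_smul hU (ha j) hy,
        pd_const_smul hU (hα j) hy]
  have hflat := H.flat y hy i j
  simp only [curvature] at hflat ⊢
  rw [hpd, hpd, hA i y hy, hA j y hy]
  simp only [bracket_add, add_bracket, bracket_smul, smul_bracket, extCovDeriv, quadFamily]
  -- Brings the background to the left slot, as in the definition of `extCovDeriv`.
  rw [OrthogonalRep.bracket_swap (a i y) (Ξ j y), OrthogonalRep.bracket_swap (α i y) (Ξ j y)]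
  exact curvature_expansion (F := ρ.lie) hflat t ε

theorem covDeriv_eq (H : LocalVacuumPair V h U Ξ v) {a α A : Fin n → Coord n → ρ.lie}
    {φ ψ Φ : Coord n → W} (hφ : ContDiffOn ℝ ∞ φ U) (hψ : ContDiffOn ℝ ∞ ψ U) {t ε : ℝ}
    (hA : ∀ i, ∀ y ∈ U, A i y = Ξ i y + t • a i y + ε • α i y)
    (hΦ : ∀ y ∈ U, Φ y = v y + t • φ y + ε • ψ y) {y : Coord n} (hy : y ∈ U)
    (i : Fin n) : covDeriv A Φ y i = quadFamily (covDeriv Ξ φ y i + (a i y).1 (v y))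
      (covDeriv Ξ ψ y i + (α i y).1 (v y)) ((a i y).1 (φ y))
      ((a i y).1 (ψ y) + (α i y).1 (φ y)) ((α i y).1 (ψ y)) t ε := by
  have hU := H.isOpen
  have hpd : pd i Φ y = pd i v y + t • pd i φ y + ε • pd i ψ y := by
    have htφ : ContDiffOn ℝ ∞ (fun z => t • φ z) U := contDiffOn_fun_smul contDiffOn_const hφ
    have hεψ : ContDiffOn ℝ ∞ (fun z => ε • ψ z) U := contDiffOn_fun_smul contDiffOn_const hψ
    rw [pd_congr hU hΦ hy, pd_add hU (H.smooth_vacuum.add htφ) hεψ hy,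
      pd_add hU H.smooth_vacuum htφ hy, pd_const_smul hU hφ hy, pd_const_smul hU hψ hy]
  have hpar := H.parallel y hy i
  simp only [covDeriv] at hpar ⊢
  rw [hpd, hA i y hy, hΦ y hy]
  simp only [Submodule.coe_add, Submodule.coe_smul, add_apply, smul_apply, map_add, map_smul,
    quadFamily]
  exact covDeriv_expansion hpar t ε

end LocalVacuumPair

end YMH

namespace YMH

variable {n : ℕ} {G : Type*} [Group G] [TopologicalSpace G]
  {W : Type*} [NormedAddCommGroup W] [InnerProductSpace ℝ W] [FiniteDimensional ℝ W]
  {ρ : OrthogonalRep G W}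

/-! ### The Lagrangian density along the two-parameter family -/

namespace LocalVacuumPair

variable {V : W → ℝ} {h : Coord n → Matrix (Fin n) (Fin n) ℝ}
    {U : Set (Coord n)} {Ξ : Fin n → Coord n → ρ.lie} {v : Coord n → W}

variable {K : Set (Coord n)} {a α : Fin n → Coord n → ρ.lie} {φ ψ : Coord n → W}

/-- The field strength of `Ξ + t a + ε α`. -/
noncomputable def curvatureFamily (Ξ a α : Fin n → Coord n → ρ.lie) (t ε : ℝ) (y : Coord n) (i j : Fin n) :
    ρ.lie :=
  quadFamily (extCovDeriv Ξ a y i j) (extCovDeriv Ξ α y i j)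
    (ρ.bracket (a i y) (a j y)) (ρ.bracket (a i y) (α j y) + ρ.bracket (α i y) (a j y))
    (ρ.bracket (α i y) (α j y)) t ε

/-- The covariant derivative of `v + t φ + ε ψ` with respect to `Ξ + t a + ε α`. -/
noncomputable def covDerivFamily (Ξ : Fin n → Coord n → ρ.lie) (v : Coord n → W) (a α : Fin n → Coord n → ρ.lie)
    (φ ψ : Coord n → W) (t ε : ℝ) (y : Coord n) (i : Fin n) : W :=
  quadFamily (covDeriv Ξ φ y i + (a i y).1 (v y)) (covDeriv Ξ ψ y i + (α i y).1 (v y))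
    ((a i y).1 (φ y)) ((a i y).1 (ψ y) + (α i y).1 (φ y)) ((α i y).1 (ψ y)) t ε

/-- The Lagrangian density along `(Ξ + t a + ε α, v + t φ + ε ψ)`. -/
noncomputable def densityFamily (k : Normalization) (β : InvariantForm ρ) (V : W → ℝ)
    (h : Coord n → Matrix (Fin n) (Fin n) ℝ) (Ξ : Fin n → Coord n → ρ.lie) (v : Coord n → W)
    (a α : Fin n → Coord n → ρ.lie) (φ ψ : Coord n → W) (t ε : ℝ) (y : Coord n) : ℝ :=
  (k.s * k.cYM * ((1 / 2) *
      pairTwo β (h y)⁻¹ (curvatureFamily Ξ a α t ε y) (curvatureFamily Ξ a α t ε y))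
    + k.cH * pairOne (h y)⁻¹ (covDerivFamily Ξ v a α φ ψ t ε y) (covDerivFamily Ξ v a α φ ψ t ε y)
    + k.s * k.cV * V (v y + t • φ y + ε • ψ y)) * volDensity h y

theorem contDiffOn_comp_snd_snd {E F : Type*} [NormedAddCommGroup E] [NormedSpace ℝ E]
    [NormedAddCommGroup F] [NormedSpace ℝ F] {U : Set E} {c : E → F} (hc : ContDiffOn ℝ ∞ c U) :
    ContDiffOn ℝ ∞ (fun p : ℝ × ℝ × E => c p.2.2) (univ ×ˢ univ ×ˢ U) :=
  hc.comp contDiff_snd.snd.contDiffOn fun _ hp => hp.2.2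

theorem contDiffOn_curvatureFamily (H : LocalVacuumPair V h U Ξ v)
    (ha : ∀ i, ContDiffOn ℝ ∞ (a i) U) (hα : ∀ i, ContDiffOn ℝ ∞ (α i) U) (i j : Fin n) :
    ContDiffOn ℝ ∞ (fun p : ℝ × ℝ × Coord n => curvatureFamily Ξ a α p.2.1 p.1 p.2.2 i j)
      (univ ×ˢ univ ×ˢ U) := by
  have h₁ := contDiffOn_extCovDeriv H.isOpen H.smooth_potential ha i j
  have h₂ := contDiffOn_extCovDeriv H.isOpen H.smooth_potential hα i j
  have h₄ : ContDiffOn ℝ ∞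
      (fun y => ρ.bracket (a i y) (α j y) + ρ.bracket (α i y) (a j y)) U :=
    contDiffOn_fun_add (contDiffOn_bracket (ha i) (hα j)) (contDiffOn_bracket (hα i) (ha j))
  have h := contDiffOn_quadFamily h₁ h₂ (contDiffOn_bracket (ha i) (ha j)) h₄
    (contDiffOn_bracket (hα i) (hα j))
  exact h.congr fun _ _ => rfl

theorem contDiffOn_covDerivFamily (H : LocalVacuumPair V h U Ξ v)
    (ha : ∀ i, ContDiffOn ℝ ∞ (a i) U) (hα : ∀ i, ContDiffOn ℝ ∞ (α i) U)
    (hφ : ContDiffOn ℝ ∞ φ U) (hψ : ContDiffOn ℝ ∞ ψ U) (i : Fin n) :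
    ContDiffOn ℝ ∞ (fun p : ℝ × ℝ × Coord n => covDerivFamily Ξ v a α φ ψ p.2.1 p.1 p.2.2 i)
      (univ ×ˢ univ ×ˢ U) := by
  have h₁ := contDiffOn_fun_add (contDiffOn_covDeriv H.isOpen H.smooth_potential hφ i)
    (contDiffOn_action (ha i) H.smooth_vacuum)
  have h₂ := contDiffOn_fun_add (contDiffOn_covDeriv H.isOpen H.smooth_potential hψ i)
    (contDiffOn_action (hα i) H.smooth_vacuum)
  have h₄ := contDiffOn_fun_add (contDiffOn_action (ha i) hψ) (contDiffOn_action (hα i) hφ)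
  exact contDiffOn_quadFamily h₁ h₂ (contDiffOn_action (ha i) hφ) h₄
    (contDiffOn_action (hα i) hψ)

theorem contDiffOn_pairTwo {E : Type*} [NormedAddCommGroup E] [NormedSpace ℝ E] {S : Set E}
    (β : InvariantForm ρ) {m : E → Matrix (Fin n) (Fin n) ℝ}
    {C C' : E → Fin n → Fin n → ρ.lie} (hm : ∀ i j, ContDiffOn ℝ ∞ (fun y => m y i j) S)
    (hC : ∀ i j, ContDiffOn ℝ ∞ (fun y => C y i j) S)
    (hC' : ∀ i j, ContDiffOn ℝ ∞ (fun y => C' y i j) S) :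
    ContDiffOn ℝ ∞ (fun y => pairTwo β (m y) (C y) (C' y)) S :=
  contDiffOn_fun_sum fun i _ => contDiffOn_fun_sum fun j _ => contDiffOn_fun_sum fun a _ =>
    contDiffOn_fun_sum fun b _ => ((hm i a).mul (hm j b)).mul (contDiffOn_form β (hC i j) (hC' a b))

theorem contDiffOn_pairOne {E : Type*} [NormedAddCommGroup E] [NormedSpace ℝ E] {S : Set E}
    {m : E → Matrix (Fin n) (Fin n) ℝ} {C C' : E → Fin n → W}
    (hm : ∀ i j, ContDiffOn ℝ ∞ (fun y => m y i j) S)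
    (hC : ∀ i, ContDiffOn ℝ ∞ (fun y => C y i) S) (hC' : ∀ i, ContDiffOn ℝ ∞ (fun y => C' y i) S) :
    ContDiffOn ℝ ∞ (fun y => pairOne (m y) (C y) (C' y)) S :=
  contDiffOn_fun_sum fun i _ => contDiffOn_fun_sum fun j _ =>
    (hm i j).mul ((hC i).inner ℝ (hC' j))

theorem contDiffOn_densityFamily (H : LocalVacuumPair V h U Ξ v) (hV : ContDiff ℝ ∞ V)
    (k : Normalization) (β : InvariantForm ρ)
    (ha : ∀ i, ContDiffOn ℝ ∞ (a i) U) (hα : ∀ i, ContDiffOn ℝ ∞ (α i) U)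
    (hφ : ContDiffOn ℝ ∞ φ U) (hψ : ContDiffOn ℝ ∞ ψ U) :
    ContDiffOn ℝ ∞ (fun p : ℝ × ℝ × Coord n => densityFamily k β V h Ξ v a α φ ψ p.2.1 p.1 p.2.2)
      (univ ×ˢ univ ×ˢ U) := by
  have hX := H.contDiffOn_curvatureFamily ha hα
  have hY := H.contDiffOn_covDerivFamily ha hα hφ hψ
  have hinv : ∀ i j, ContDiffOn ℝ ∞ (fun p : ℝ × ℝ × Coord n => (h p.2.2)⁻¹ i j)
      (univ ×ˢ univ ×ˢ U) := fun i j =>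
    contDiffOn_comp_snd_snd (contDiffOn_inv_apply H.smooth_metric H.det_ne_zero i j)
  have hVc : ContDiffOn ℝ ∞ (fun p : ℝ × ℝ × Coord n =>
      V (v p.2.2 + p.2.1 • φ p.2.2 + p.1 • ψ p.2.2)) (univ ×ˢ univ ×ˢ U) :=
    hV.comp_contDiffOn (((contDiffOn_comp_snd_snd H.smooth_vacuum).add
      (contDiff_snd.fst.contDiffOn.smul (contDiffOn_comp_snd_snd hφ))).add
      (contDiff_fst.contDiffOn.smul (contDiffOn_comp_snd_snd hψ)))
  exact (((contDiffOn_const.mul (contDiffOn_const.mul (contDiffOn_pairTwo β hinv hX hX))).add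
    (contDiffOn_const.mul (contDiffOn_pairOne hinv hY hY))).add (contDiffOn_const.mul hVc)).mul
    (contDiffOn_comp_snd_snd (contDiffOn_volDensity H.smooth_metric H.det_ne_zero))

theorem hasMixedDeriv_pairTwo (β : InvariantForm ρ) {m : Matrix (Fin n) (Fin n) ℝ} (hm : m.IsSymm)
    (Ξ a α : Fin n → Coord n → ρ.lie) (y : Coord n) :
    HasMixedDeriv (fun t ε => pairTwo β m (curvatureFamily Ξ a α t ε y)
      (curvatureFamily Ξ a α t ε y))
      (2 * pairTwo β m (extCovDeriv Ξ a y) (extCovDeriv Ξ α y)) := by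
  rw [two_mul]
  -- The product rule yields the variation once in the left slot and once in the right; symmetry of
  -- the pairing gives the factor 2 the same shape.
  nth_rewrite 1 [pairTwo_comm β hm]
  simp only [pairTwo, ← Finset.sum_add_distrib, ← mul_add]
  exact HasMixedDeriv.sum _ fun i => HasMixedDeriv.sum _ fun j => HasMixedDeriv.sum _ fun a =>
    HasMixedDeriv.sum _ fun b => HasMixedDeriv.const_mul _
      (hasMixedDeriv_bilin (F₁ := ρ.lie) (F₂ := ρ.lie) β.toBilin _ _ _ _ _ _ _ _ _ _)

theorem hasMixedDeriv_pairOne {m : Matrix (Fin n) (Fin n) ℝ} (hm : m.IsSymm)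
    (Ξ : Fin n → Coord n → ρ.lie) (v : Coord n → W) (a α : Fin n → Coord n → ρ.lie)
    (φ ψ : Coord n → W) (y : Coord n) :
    HasMixedDeriv (fun t ε => pairOne m (covDerivFamily Ξ v a α φ ψ t ε y)
      (covDerivFamily Ξ v a α φ ψ t ε y))
      (2 * pairOne m (fun i => covDeriv Ξ φ y i + (a i y).1 (v y))
        (fun i => covDeriv Ξ ψ y i + (α i y).1 (v y))) := by
  rw [two_mul]
  nth_rewrite 1 [pairOne_comm hm]
  simp only [pairOne, ← Finset.sum_add_distrib, ← mul_add]
  exact HasMixedDeriv.sum _ fun i => HasMixedDeriv.sum _ fun j => HasMixedDeriv.const_mul _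
    (hasMixedDeriv_bilin (innerₗ W) _ _ _ _ _ _ _ _ _ _)

theorem hasMixedDeriv_densityFamily (H : LocalVacuumPair V h U Ξ v) (hV : ContDiff ℝ ∞ V)
    (k : Normalization) (β : InvariantForm ρ) {y : Coord n} (hy : y ∈ U) :
    HasMixedDeriv (fun t ε => densityFamily k β V h Ξ v a α φ ψ t ε y)
      (linearizedVariation k β V h Ξ v a φ α ψ y) := by
  have hm := H.isSymm_inv y hy
  have h3 := hasMixedDeriv_comp_affine hV (IsHiggsPotential.fderiv_eq_zero V (H.minimum y hy))
    (φ y) (ψ y)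
  have h4 := (((((hasMixedDeriv_pairTwo β hm Ξ a α y).const_mul (1 / 2)).const_mul
    (k.s * k.cYM)).add ((hasMixedDeriv_pairOne hm Ξ v a α φ ψ y).const_mul k.cH)).add
    (h3.const_mul (k.s * k.cV))).const_mul (volDensity h y)
  have e : linearizedVariation k β V h Ξ v a φ α ψ y = volDensity h y *
      (k.s * k.cYM * (1 / 2 * (2 * pairTwo β (h y)⁻¹ (extCovDeriv Ξ a y) (extCovDeriv Ξ α y))) +
      k.cH * (2 * pairOne (h y)⁻¹ (fun i => covDeriv Ξ φ y i + (a i y).1 (v y))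
        (fun i => covDeriv Ξ ψ y i + (α i y).1 (v y))) +
      k.s * k.cV * fderiv ℝ (fderiv ℝ V) (v y) (φ y) (ψ y)) := by
    rw [linearizedVariation, hess]; ring
  rw [e]
  simp only [densityFamily, mul_comm _ (volDensity h y)]
  exact h4

theorem lagrangian_eq_densityFamily (H : LocalVacuumPair V h U Ξ v) (k : Normalization)
    (β : InvariantForm ρ) (ha : ∀ i, ContDiffOn ℝ ∞ (a i) U) (hα : ∀ i, ContDiffOn ℝ ∞ (α i) U)
    (hφ : ContDiffOn ℝ ∞ φ U) (hψ : ContDiffOn ℝ ∞ ψ U) {t ε : ℝ}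
    {A : Fin n → Coord n → ρ.lie} {Φ : Coord n → W}
    (hA : ∀ i, ∀ y ∈ U, A i y = Ξ i y + t • a i y + ε • α i y)
    (hΦ : ∀ y ∈ U, Φ y = v y + t • φ y + ε • ψ y) {y : Coord n} (hy : y ∈ U) :
    lagrangian k β V h A Φ y * volDensity h y = densityFamily k β V h Ξ v a α φ ψ t ε y := by
  have e1 : curvature A y = curvatureFamily Ξ a α t ε y := by
    funext i j
    exact H.curvature_eq ha hα hA hy i j
  have e2 : covDeriv A Φ y = covDerivFamily Ξ v a α φ ψ t ε y := by
    funext i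
    exact H.covDeriv_eq hφ hψ hA hΦ hy i
  rw [lagrangian, densityFamily, pairTwo, pairOne, e1, e2, hΦ y hy]

open MeasureTheory in
/-- The Euler-Lagrange equations up to order `O(t²)` for a fixed variation. -/
theorem exists_hasDerivAt_action_iff (H : LocalVacuumPair V h U Ξ v) (hV : ContDiff ℝ ∞ V)
    (k : Normalization) (β : InvariantForm ρ)
    (ha : ∀ i, ContDiffOn ℝ ∞ (a i) U) (hα : ∀ i, ContDiffOn ℝ ∞ (α i) U)
    (hφ : ContDiffOn ℝ ∞ φ U) (hψ : ContDiffOn ℝ ∞ ψ U) (hK : IsCompact K) (hKU : K ⊆ U)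
    {A : ℝ → Fin n → Coord n → ρ.lie} {Φ : ℝ → Coord n → W}
    (hA : ∀ t ∈ Icc (0 : ℝ) 1, ∀ i, ∀ y ∈ U, A t i y = Ξ i y + t • a i y)
    (hΦ : ∀ t ∈ Icc (0 : ℝ) 1, ∀ y ∈ U, Φ t y = v y + t • φ y) :
    (∃ D : ℝ → ℝ, (∀ t ∈ Icc (0 : ℝ) 1, HasDerivAt
        (fun ε : ℝ => action k β V h K (fun i y => A t i y + ε • α i y)
          (fun y => Φ t y + ε • ψ y)) (D t) 0) ∧ D =O[𝓝[Icc 0 1] 0] fun t => t ^ 2) ↔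
      ∫ y in K, linearizedVariation k β V h Ξ v a φ α ψ y = 0 := by
  refine exists_hasDerivAt_isBigO_iff H.isOpen (H.contDiffOn_densityFamily hV k β ha hα hφ hψ)
    (fun y hy => H.hasMixedDeriv_densityFamily hV k β hy) hK hKU
    (J := fun t ε => action k β V h K (fun i y => A t i y + ε • α i y)
          (fun y => Φ t y + ε • ψ y)) fun t ht ε => ?_
  refine setIntegral_congr_fun hK.measurableSet fun y hy => ?_
  exact H.lagrangian_eq_densityFamily k β ha hα hφ hψ
    (fun i y hy => by rw [hA t ht i y hy]) (fun y hy => by rw [hΦ t ht y hy]) (hKU hy)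

end LocalVacuumPair

end YMH

namespace YMH

variable {n : ℕ} {G : Type*} [Group G] [TopologicalSpace G]
  {W : Type*} [NormedAddCommGroup W] [InnerProductSpace ℝ W] [FiniteDimensional ℝ W]
  {ρ : OrthogonalRep G W}

/-! ### The second variation and its integration by parts -/

namespace LocalVacuumPair

variable {V : W → ℝ} {h : Coord n → Matrix (Fin n) (Fin n) ℝ}
    {U : Set (Coord n)} {Ξ : Fin n → Coord n → ρ.lie} {v : Coord n → W}

variable {K : Set (Coord n)} {a α : Fin n → Coord n → ρ.lie} {φ ψ : Coord n → W}

open MeasureTheory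

theorem integral_const_mul_add {X : Type*} [MeasurableSpace X] {μ : Measure X}
    {f₁ f₂ f₃ f₄ : X → ℝ} (h₁ : Integrable f₁ μ) (h₂ : Integrable f₂ μ) (h₃ : Integrable f₃ μ)
    (h₄ : Integrable f₄ μ) (c₁ c₂ c₃ : ℝ) :
    ∫ x, (c₁ * f₁ x + c₂ * f₂ x + c₃ * f₃ x + f₄ x) ∂μ =
      c₁ * ∫ x, f₁ x ∂μ + c₂ * ∫ x, f₂ x ∂μ + c₃ * ∫ x, f₃ x ∂μ + ∫ x, f₄ x ∂μ := by
  have i₁ := h₁.const_mul c₁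
  have i₂ := h₂.const_mul c₂
  have i₃ := h₃.const_mul c₃
  have i₁₂ : Integrable (fun x => c₁ * f₁ x + c₂ * f₂ x) μ := i₁.add i₂
  have i₁₂₃ : Integrable (fun x => c₁ * f₁ x + c₂ * f₂ x + c₃ * f₃ x) μ := i₁₂.add i₃
  rw [integral_add i₁₂₃ h₄, integral_add i₁₂ i₃, integral_add i₁ i₂, integral_const_mul,
    integral_const_mul, integral_const_mul]

theorem pairOne_add_left (m : Matrix (Fin n) (Fin n) ℝ) (C C' C'' : Fin n → W) :
    pairOne m (fun i => C i + C' i) C'' = pairOne m C C'' + pairOne m C' C'' := by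
  simp only [pairOne, inner_add_left, mul_add, Finset.sum_add_distrib]

theorem pairOne_add_right (m : Matrix (Fin n) (Fin n) ℝ) (C C' C'' : Fin n → W) :
    pairOne m C (fun i => C' i + C'' i) = pairOne m C C' + pairOne m C C'' := by
  simp only [pairOne, inner_add_right, mul_add, Finset.sum_add_distrib]

theorem pairOne_eq_zero (m : Matrix (Fin n) (Fin n) ℝ) {C C' : Fin n → W}
    (hC : ∀ i j, ⟪C i, C' j⟫_ℝ = 0) : pairOne m C C' = 0 := by
  simp [pairOne, hC]

/-- Covariant differentiation preserves the orthogonal complement of the tangent spaces of the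
orbits through the vacuum. -/
theorem inner_covDeriv_eq_zero (H : LocalVacuumPair V h U Ξ v) {f : Coord n → W}
    (hf : ContDiffOn ℝ ∞ f U) (hperp : ∀ y ∈ U, ∀ X : ρ.lie, ⟪f y, X.1 (v y)⟫_ℝ = 0)
    {y : Coord n} (hy : y ∈ U) (i : Fin n) (X : ρ.lie) :
    ⟪covDeriv Ξ f y i, X.1 (v y)⟫_ℝ = 0 := by
  have hX : ContDiffOn ℝ ∞ (fun _ : Coord n => X) U := contDiffOn_const
  -- Differentiate `⟪f, X v⟫ = 0` with `X` constant. Because `v` is parallel, `∂(X v) = (∂X) v` is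
  -- again an orbit direction, to which `f` is orthogonal.
  have h1 := pd_inner_cov Ξ H.isOpen hf (contDiffOn_action hX H.smooth_vacuum) hy i
  have h2 : pd i (fun z => ⟪f z, X.1 (v z)⟫_ℝ) y = 0 := by
    rw [pd_congr H.isOpen (fun z hz => hperp z hz X) hy]
    simp [pd]
  rw [h2, covDeriv_action Ξ H.isOpen hX H.smooth_vacuum hy, H.parallel y hy, map_zero, add_zero,
    hperp y hy, add_zero] at h1
  exact h1.symm

/-- Orthogonality to the orbit survives covariant differentiation and raising an index, hence also
the second differentiation inside `δ`. -/
theorem inner_coDerivOne_covDeriv_eq_zero (H : LocalVacuumPair V h U Ξ v) {f : Coord n → W}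
    (hf : ContDiffOn ℝ ∞ f U) (hperp : ∀ y ∈ U, ∀ X : ρ.lie, ⟪f y, X.1 (v y)⟫_ℝ = 0)
    {y : Coord n} (hy : y ∈ U) (X : ρ.lie) :
    ⟪coDerivOne h Ξ (covDeriv Ξ f) y, X.1 (v y)⟫_ℝ = 0 := by
  have hR : ∀ i, ∀ y ∈ U, ∀ X : ρ.lie, ⟪raiseOne h (covDeriv Ξ f) i y, X.1 (v y)⟫_ℝ = 0 :=
    fun i y hy X => by
      simp [raiseOne, real_inner_smul_left, sum_inner, H.inner_covDeriv_eq_zero hf hperp hy]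
  have hRs := contDiffOn_raiseOne H.smooth_metric H.det_ne_zero
    fun i => contDiffOn_covDeriv H.isOpen H.smooth_potential hf i
  rw [coDerivOne_eq, inner_neg_left, real_inner_smul_left, sum_inner,
    Finset.sum_eq_zero fun i _ => H.inner_covDeriv_eq_zero (hRs i) (hR i) hy i X, mul_zero, neg_zero]

/-- The codifferential of a Goldstone-valued 1-form is tangent to the orbit of the vacuum. -/
theorem exists_coDerivOne_action (H : LocalVacuumPair V h U Ξ v)
    (ha : ∀ i, ContDiffOn ℝ ∞ (a i) U) {y : Coord n} (hy : y ∈ U) :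
    ∃ Z : ρ.lie, coDerivOne h Ξ (fun z i => (a i z).1 (v z)) y = Z.1 (v y) := by
  -- The raised form is `Y_i v` with `Y_i` valued in the Lie algebra, so its divergence is `(D_i
  -- Y_i) v`.
  set Y : Fin n → Coord n → ρ.lie :=
    fun i z => volDensity h z • ∑ j, (h z)⁻¹ i j • a j z with hY
  have hYs : ∀ i, ContDiffOn ℝ ∞ (Y i) U := fun i =>
    contDiffOn_fun_smul (contDiffOn_volDensity H.smooth_metric H.det_ne_zero) <|
      contDiffOn_fun_sum fun j _ => contDiffOn_fun_smul
        (contDiffOn_inv_apply H.smooth_metric H.det_ne_zero i j) (ha j)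
  have hR : ∀ i, raiseOne h (fun z i => (a i z).1 (v z)) i = fun z => (Y i z).1 (v z) := fun i => by
    funext z
    simp [raiseOne, hY, sum_apply]
  refine ⟨-((volDensity h y)⁻¹ • ∑ i, covAd Ξ (Y i) y i), ?_⟩
  rw [coDerivOne_eq]
  simp only [hR, covDeriv_action Ξ H.isOpen (hYs _) H.smooth_vacuum hy, H.parallel y hy, map_zero,
    add_zero]
  simp [sum_apply]

/-- The left hand side of the gauge boson equation, paired with `X`; here `r` is the
coefficient of the mass term. -/
noncomputable def gaugeResidual (β : InvariantForm ρ) (h : Coord n → Matrix (Fin n) (Fin n) ℝ)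
    (Ξ : Fin n → Coord n → ρ.lie) (v : Coord n → W) (a aG : Fin n → Coord n → ρ.lie) (r : ℝ)
    (y : Coord n) (k : Fin n) (X : ρ.lie) : ℝ :=
  β.toBilin (coDerivTwo h Ξ (extCovDeriv Ξ a) y k) X + r * (2 * ⟪(aG k y).1 (v y), X.1 (v y)⟫_ℝ)

/-- The left hand side of the equation for the Higgs field, paired with `w`; here `r` is the
coefficient of the mass term. -/
noncomputable def higgsResidual (V : W → ℝ) (h : Coord n → Matrix (Fin n) (Fin n) ℝ)
    (Ξ : Fin n → Coord n → ρ.lie) (v : Coord n → W) (aG : Fin n → Coord n → ρ.lie)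
    (φ : Coord n → W) (r : ℝ) (y : Coord n) (w : W) : ℝ :=
  ⟪coDerivOne h Ξ (covDeriv Ξ φ) y, w⟫_ℝ +
    ⟪coDerivOne h Ξ (fun z i => (aG i z).1 (v z)) y, w⟫_ℝ + r * hess V (v y) (φ y) w

theorem contDiffOn_gaugeResidual (H : LocalVacuumPair V h U Ξ v) (β : InvariantForm ρ)
    {aG : Fin n → Coord n → ρ.lie} (ha : ∀ i, ContDiffOn ℝ ∞ (a i) U)
    (haG : ∀ i, ContDiffOn ℝ ∞ (aG i) U) (r : ℝ) (k : Fin n) {X : Coord n → ρ.lie}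
    (hX : ContDiffOn ℝ ∞ X U) :
    ContDiffOn ℝ ∞ (fun y => gaugeResidual β h Ξ v a aG r y k (X y)) U :=
  (contDiffOn_form β (contDiffOn_coDerivTwo H.isOpen H.smooth_potential H.smooth_metric
    H.det_ne_zero (contDiffOn_extCovDeriv H.isOpen H.smooth_potential ha) k) hX).add
    (contDiffOn_const.mul (contDiffOn_const.mul ((contDiffOn_action (haG k) H.smooth_vacuum).inner ℝ
      (contDiffOn_action hX H.smooth_vacuum))))

theorem contDiffOn_hess (H : LocalVacuumPair V h U Ξ v) (hV : ContDiff ℝ ∞ V)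
    (hφ : ContDiffOn ℝ ∞ φ U) (hψ : ContDiffOn ℝ ∞ ψ U) :
    ContDiffOn ℝ ∞ (fun y => hess V (v y) (φ y) (ψ y)) U := by
  have h1 : ContDiff ℝ ∞ (fderiv ℝ (fderiv ℝ V)) :=
    (hV.fderiv_right (m := ∞) (by simp)).fderiv_right (m := ∞) (by simp)
  exact ((h1.comp_contDiffOn H.smooth_vacuum).clm_apply hφ).clm_apply hψ

theorem contDiffOn_higgsResidual (H : LocalVacuumPair V h U Ξ v) (hV : ContDiff ℝ ∞ V)
    {aG : Fin n → Coord n → ρ.lie} (haG : ∀ i, ContDiffOn ℝ ∞ (aG i) U)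
    (hφ : ContDiffOn ℝ ∞ φ U) (hψ : ContDiffOn ℝ ∞ ψ U) (r : ℝ) :
    ContDiffOn ℝ ∞ (fun y => higgsResidual V h Ξ v aG φ r y (ψ y)) U :=
  (((contDiffOn_coDerivOne H.isOpen H.smooth_potential H.smooth_metric H.det_ne_zero
    (contDiffOn_covDeriv H.isOpen H.smooth_potential hφ)).inner ℝ hψ).add
    ((contDiffOn_coDerivOne H.isOpen H.smooth_potential H.smooth_metric H.det_ne_zero
      (fun i => contDiffOn_action (haG i) H.smooth_vacuum)).inner ℝ hψ)).add
    (contDiffOn_const.mul (H.contDiffOn_hess hV hφ hψ))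

/-- Integration by parts in the linearized variation. -/
theorem integral_linearizedVariation (H : LocalVacuumPair V h U Ξ v) (hV : ContDiff ℝ ∞ V)
    (k : Normalization) (β : InvariantForm ρ) {aG : Fin n → Coord n → ρ.lie}
    (ha : ∀ i, ContDiffOn ℝ ∞ (a i) U) (haG : ∀ i, ContDiffOn ℝ ∞ (aG i) U)
    (hav : ∀ i, ∀ y ∈ U, (a i y).1 (v y) = (aG i y).1 (v y))
    (hφ : ContDiffOn ℝ ∞ φ U) (hperp : ∀ y ∈ U, ∀ X : ρ.lie, ⟪φ y, X.1 (v y)⟫_ℝ = 0)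
    (hK : IsCompact K) (hKU : K ⊆ U)
    (hα : ∀ i, ContDiffOn ℝ ∞ (α i) U) (hαK : ∀ i, ∀ y ∉ K, α i y = 0)
    (hψ : ContDiffOn ℝ ∞ ψ U) (hψK : ∀ y ∉ K, ψ y = 0) :
    ∫ y in K, linearizedVariation k β V h Ξ v a φ α ψ y =
      ∫ y in K, volDensity h y * (2 * k.s * k.cYM * (∑ j, ∑ l, (h y)⁻¹ j l *
        gaugeResidual β h Ξ v a aG (k.s * k.cH / (2 * k.cYM)) y l (α j y)) +
        2 * k.cH * higgsResidual V h Ξ v aG φ (k.s * k.cV / (2 * k.cH)) y (ψ y)) := by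
  have hU := H.isOpen
  have hΞ := H.smooth_potential
  have hh := H.smooth_metric
  have h0 := H.det_ne_zero
  have hvol := contDiffOn_volDensity hh h0
  have hinv := contDiffOn_inv_apply hh h0
  have hDa := contDiffOn_extCovDeriv hU hΞ ha
  have hDα := contDiffOn_extCovDeriv hU hΞ hα
  have hDφ := contDiffOn_covDeriv hU hΞ hφ
  have hDψ := contDiffOn_covDeriv hU hΞ hψ
  have haGv : ∀ i, ContDiffOn ℝ ∞ (fun y => (aG i y).1 (v y)) U :=
    fun i => contDiffOn_action (haG i) H.smooth_vacuum
  have hαv : ∀ i, ContDiffOn ℝ ∞ (fun y => (α i y).1 (v y)) U :=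
    fun i => contDiffOn_action (hα i) H.smooth_vacuum
  have hint : ∀ {f : Coord n → ℝ}, ContDiffOn ℝ ∞ f U → IntegrableOn f K := fun hf =>
    (hf.continuousOn.mono hKU).integrableOn_compact hK
  have i1 := integral_pairTwo_extCovDeriv β hU hΞ hh h0 H.isSymm_inv hDa
    (extCovDeriv_swap Ξ a) hK hKU hα hαK
  have i2 := integral_pairOne_covDeriv hU hΞ hh h0 H.isSymm_inv hDφ hK hKU hψ hψK
  have i3 := integral_pairOne_covDeriv hU hΞ hh h0 H.isSymm_inv haGv hK hKU hψ hψK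
  set R : Coord n → ℝ := fun y => volDensity h y * (2 * k.cH * pairOne (h y)⁻¹
    (fun i => (aG i y).1 (v y)) (fun i => (α i y).1 (v y)) +
      k.s * k.cV * hess V (v y) (φ y) (ψ y)) with hR
  have hRs : ContDiffOn ℝ ∞ R U := hvol.mul ((contDiffOn_const.mul
    (contDiffOn_pairOne hinv haGv hαv)).add (contDiffOn_const.mul (H.contDiffOn_hess hV hφ hψ)))
  have hs1 : ContDiffOn ℝ ∞ (fun y => volDensity h y *
      pairTwo β (h y)⁻¹ (extCovDeriv Ξ a y) (extCovDeriv Ξ α y)) U :=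
    hvol.mul (contDiffOn_pairTwo β hinv hDa hDα)
  have hs2 : ContDiffOn ℝ ∞ (fun y => volDensity h y *
      pairOne (h y)⁻¹ (covDeriv Ξ φ y) (covDeriv Ξ ψ y)) U :=
    hvol.mul (contDiffOn_pairOne hinv hDφ hDψ)
  have hs3 : ContDiffOn ℝ ∞ (fun y => volDensity h y *
      pairOne (h y)⁻¹ (fun i => (aG i y).1 (v y)) (covDeriv Ξ ψ y)) U :=
    hvol.mul (contDiffOn_pairOne hinv haGv hDψ)
  have ht1 : ContDiffOn ℝ ∞ (fun y => volDensity h y * (2 * ∑ j, ∑ l, (h y)⁻¹ j l *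
      β.toBilin (coDerivTwo h Ξ (extCovDeriv Ξ a) y l) (α j y))) U :=
    hvol.mul (contDiffOn_const.mul (contDiffOn_fun_sum fun j _ => contDiffOn_fun_sum fun l _ =>
      (hinv j l).mul (contDiffOn_form β (contDiffOn_coDerivTwo hU hΞ hh h0 hDa l) (hα j))))
  have ht2 : ContDiffOn ℝ ∞ (fun y => volDensity h y *
      ⟪coDerivOne h Ξ (covDeriv Ξ φ) y, ψ y⟫_ℝ) U :=
    hvol.mul ((contDiffOn_coDerivOne hU hΞ hh h0 hDφ).inner ℝ hψ)
  have ht3 : ContDiffOn ℝ ∞ (fun y => volDensity h y *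
      ⟪coDerivOne h Ξ (fun z i => (aG i z).1 (v z)) y, ψ y⟫_ℝ) U :=
    hvol.mul ((contDiffOn_coDerivOne hU hΞ hh h0 haGv).inner ℝ hψ)
  have hcH := k.cH_pos.ne'
  have hcYM := k.cYM_pos.ne'
  have hss : k.s * k.s = 1 := by rcases k.s_sign with h | h <;> rw [h] <;> norm_num
  calc ∫ y in K, linearizedVariation k β V h Ξ v a φ α ψ y
      = ∫ y in K, (k.s * k.cYM * (volDensity h y *
          pairTwo β (h y)⁻¹ (extCovDeriv Ξ a y) (extCovDeriv Ξ α y)) +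
        2 * k.cH * (volDensity h y * pairOne (h y)⁻¹ (covDeriv Ξ φ y) (covDeriv Ξ ψ y)) +
        2 * k.cH * (volDensity h y *
          pairOne (h y)⁻¹ (fun i => (aG i y).1 (v y)) (covDeriv Ξ ψ y)) + R y) := by
        refine setIntegral_congr_fun hK.measurableSet fun y hy => ?_
        have hyU := hKU hy
        have e : (fun i => covDeriv Ξ φ y i + (a i y).1 (v y)) =
            fun i => covDeriv Ξ φ y i + (aG i y).1 (v y) := by
          funext i; rw [hav i y hyU]
        -- One cross term is zero pointwise, since `∂φ` is orthogonal to orbit directions. The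
        -- other, `aG v` against `∂ψ`, survives and is integrated by parts.
        have e0 : pairOne (h y)⁻¹ (covDeriv Ξ φ y) (fun i => (α i y).1 (v y)) = 0 :=
          pairOne_eq_zero _ fun i j => H.inner_covDeriv_eq_zero hφ hperp hyU i _
        simp only [linearizedVariation, e, pairOne_add_left, pairOne_add_right, hR]
        rw [e0]
        ring
    _ = k.s * k.cYM * (∫ y in K, volDensity h y *
          pairTwo β (h y)⁻¹ (extCovDeriv Ξ a y) (extCovDeriv Ξ α y)) +
        2 * k.cH * (∫ y in K, volDensity h y *
          pairOne (h y)⁻¹ (covDeriv Ξ φ y) (covDeriv Ξ ψ y)) +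
        2 * k.cH * (∫ y in K, volDensity h y *
          pairOne (h y)⁻¹ (fun i => (aG i y).1 (v y)) (covDeriv Ξ ψ y)) + ∫ y in K, R y := by
        exact integral_const_mul_add (hint hs1) (hint hs2) (hint hs3) (hint hRs) _ _ _
    _ = ∫ y in K, (k.s * k.cYM * (volDensity h y * (2 * ∑ j, ∑ l, (h y)⁻¹ j l *
          β.toBilin (coDerivTwo h Ξ (extCovDeriv Ξ a) y l) (α j y))) +
        2 * k.cH * (volDensity h y * ⟪coDerivOne h Ξ (covDeriv Ξ φ) y, ψ y⟫_ℝ) +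
        2 * k.cH * (volDensity h y *
          ⟪coDerivOne h Ξ (fun z i => (aG i z).1 (v z)) y, ψ y⟫_ℝ) + R y) := by
        rw [i1, i2, i3]
        exact (integral_const_mul_add (hint ht1) (hint ht2) (hint ht3) (hint hRs) _ _ _).symm
    _ = _ := by
        refine setIntegral_congr_fun hK.measurableSet fun y hy => ?_
        have e : ∑ j, ∑ l, (h y)⁻¹ j l *
            gaugeResidual β h Ξ v a aG (k.s * k.cH / (2 * k.cYM)) y l (α j y) =
            (∑ j, ∑ l, (h y)⁻¹ j l *
              β.toBilin (coDerivTwo h Ξ (extCovDeriv Ξ a) y l) (α j y)) +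
            k.s * k.cH / k.cYM * pairOne (h y)⁻¹ (fun i => (aG i y).1 (v y))
              (fun i => (α i y).1 (v y)) := by
          rw [pairOne, Finset.sum_comm (f := fun i j => (h y)⁻¹ i j *
            ⟪(aG i y).1 (v y), (α j y).1 (v y)⟫_ℝ)]
          simp only [gaugeResidual, mul_add, Finset.sum_add_distrib, Finset.mul_sum]
          congr 1
          refine Finset.sum_congr rfl fun j _ => Finset.sum_congr rfl fun l _ => ?_
          rw [(H.isSymm_inv y (hKU hy)).apply l j]
          field_simp
        simp only [e, higgsResidual, hR]
        field_simp
        -- The sign `s` appears both as the factor `2 s cYM` taken out in front and in the mass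
        -- coefficient; `s * s = 1` reconciles them.
        linear_combination (-2 * volDensity h y * k.cH * pairOne (h y)⁻¹ (fun i => (aG i y).1 (v y))
              (fun i => (α i y).1 (v y))) * hss

end LocalVacuumPair

end YMH

namespace YMH

variable {n : ℕ} {G : Type*} [Group G] [TopologicalSpace G]
  {W : Type*} [NormedAddCommGroup W] [InnerProductSpace ℝ W] [FiniteDimensional ℝ W]
  {ρ : OrthogonalRep G W}

/-! ### From vanishing integrals to pointwise equations -/

namespace LocalVacuumPair

variable {V : W → ℝ} {h : Coord n → Matrix (Fin n) (Fin n) ℝ}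
    {U : Set (Coord n)} {Ξ : Fin n → Coord n → ρ.lie} {v : Coord n → W}

variable {K : Set (Coord n)} {a α : Fin n → Coord n → ρ.lie} {φ ψ : Coord n → W}

open MeasureTheory

theorem tsupport_subset_tsupport {F F' : Type*} [Zero F] [Zero F'] {f : Coord n → F}
    {η : Coord n → F'} (hf : ∀ y, η y = 0 → f y = 0) : tsupport f ⊆ tsupport η :=
  closure_mono fun y hy h => hy (hf y h)

theorem eq_zero_of_sum_inv_mul_eq_zero {m : Matrix (Fin n) (Fin n) ℝ} (hm : m.det ≠ 0)
    {x : Fin n → ℝ} (hx : ∀ j, ∑ l, m⁻¹ j l * x l = 0) (l : Fin n) : x l = 0 := by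
  have h1 : m⁻¹.mulVec x = 0 := funext hx
  have h2 : m.mulVec (m⁻¹.mulVec x) = x := by
    rw [Matrix.mulVec_mulVec, Matrix.mul_nonsing_inv _ (isUnit_iff_ne_zero.2 hm), Matrix.one_mulVec]
  rw [h1, Matrix.mulVec_zero] at h2
  exact (congrFun h2 l).symm

/-- The first order term of the first variation vanishes for all variations if and only if the
linearized field equations hold. -/
theorem integral_linearizedVariation_eq_zero_iff (H : LocalVacuumPair V h U Ξ v)
    (hV : ContDiff ℝ ∞ V) (k : Normalization) (β : InvariantForm ρ)
    {aG : Fin n → Coord n → ρ.lie}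
    (ha : ∀ i, ContDiffOn ℝ ∞ (a i) U) (haG : ∀ i, ContDiffOn ℝ ∞ (aG i) U)
    (hav : ∀ i, ∀ y ∈ U, (a i y).1 (v y) = (aG i y).1 (v y))
    (hφ : ContDiffOn ℝ ∞ φ U) (hperp : ∀ y ∈ U, ∀ X : ρ.lie, ⟪φ y, X.1 (v y)⟫_ℝ = 0) :
    (∀ K : Set (Coord n), IsCompact K → K ⊆ U → ∀ (α : Fin n → Coord n → ρ.lie) (ψ : Coord n → W),
      (∀ i, ContDiff ℝ ∞ (α i) ∧ tsupport (α i) ⊆ K) → ContDiff ℝ ∞ ψ → tsupport ψ ⊆ K →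
      ∫ y in K, linearizedVariation k β V h Ξ v a φ α ψ y = 0) ↔
    (∀ y ∈ U, ∀ l X, gaugeResidual β h Ξ v a aG (k.s * k.cH / (2 * k.cYM)) y l X = 0) ∧
      ∀ y ∈ U, ∀ w, higgsResidual V h Ξ v aG φ (k.s * k.cV / (2 * k.cH)) y w = 0 := by
  have hcH := k.cH_pos.ne'
  have hcYM := k.cYM_pos.ne'
  have hs : k.s ≠ 0 := by rcases k.s_sign with h | h <;> rw [h] <;> norm_num
  have hvs := contDiffOn_volDensity H.smooth_metric H.det_ne_zero
  have hvol : ∀ y ∈ U, volDensity h y ≠ 0 := fun y hy => (volDensity_pos (H.det_ne_zero y hy)).ne'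
  have hinv := contDiffOn_inv_apply H.smooth_metric H.det_ne_zero
  constructor
  · intro hI
    have hI' : ∀ (η : Coord n → ℝ), ContDiff ℝ ∞ η → HasCompactSupport η → tsupport η ⊆ U →
        ∀ (X : Fin n → ρ.lie) (w : W), ∫ y in tsupport η, volDensity h y *
          (2 * k.s * k.cYM * (∑ j, ∑ l, (h y)⁻¹ j l *
            gaugeResidual β h Ξ v a aG (k.s * k.cH / (2 * k.cYM)) y l (η y • X j)) +
          2 * k.cH * higgsResidual V h Ξ v aG φ (k.s * k.cV / (2 * k.cH)) y (η y • w)) = 0 := by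
      intro η hη hc hηU X w
      have hαs : ∀ j, ContDiff ℝ ∞ (fun y => η y • X j) := fun j =>
        contDiffOn_univ.1 (contDiffOn_fun_smul hη.contDiffOn contDiffOn_const)
      have hψs : ContDiff ℝ ∞ (fun y => η y • w) := hη.smul contDiff_const
      have h0 : ∀ y ∉ tsupport η, η y = 0 := fun y hy => image_eq_zero_of_notMem_tsupport hy
      rw [← H.integral_linearizedVariation hV k β ha haG hav hφ hperp hc hηU
        (fun j => (hαs j).contDiffOn) (fun j y hy => by rw [h0 y hy, zero_smul]) hψs.contDiffOn
        (fun y hy => by rw [h0 y hy, zero_smul])]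
      refine hI _ hc hηU _ _ (fun j => ⟨hαs j, ?_⟩) hψs ?_
      · exact tsupport_subset_tsupport fun y hy => by rw [hy, zero_smul]
      · exact tsupport_subset_tsupport fun y hy => by rw [hy, zero_smul]
    constructor
    · intro y hy l X
      -- A variation in slot `j` detects the residual with raised index `j`; invertibility of the
      -- metric then gives each component.
      refine eq_zero_of_sum_inv_mul_eq_zero (H.det_ne_zero y hy)
        (x := fun l => gaugeResidual β h Ξ v a aG (k.s * k.cH / (2 * k.cYM)) y l X) (fun j => ?_) l
      set f : Coord n → ℝ := fun y => volDensity h y * (2 * k.s * k.cYM * ∑ l, (h y)⁻¹ j l *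
            gaugeResidual β h Ξ v a aG (k.s * k.cH / (2 * k.cYM)) y l X) with hf
      have hfs : ContDiffOn ℝ ∞ f U := hvs.mul (contDiffOn_const.mul
        (contDiffOn_fun_sum fun l _ => (hinv j l).mul
          (H.contDiffOn_gaugeResidual β ha haG _ l contDiffOn_const)))
      have hf0 := eqOn_zero_of_setIntegral_smul_eq_zero (μ := volume) H.isOpen hfs.continuousOn
        (fun η hη hc hηU => by
          -- Test with `α = η X` in slot `j` only and `ψ = 0`.
          rw [← hI' η hη hc hηU (Pi.single j X) 0]
          refine setIntegral_congr_fun hc.isCompact.measurableSet fun y hy => ?_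
          have e : ∀ j', ∑ l, (h y)⁻¹ j' l * gaugeResidual β h Ξ v a aG
              (k.s * k.cH / (2 * k.cYM)) y l (η y • (Pi.single j X : Fin n → ρ.lie) j') =
              if j' = j then η y * ∑ l, (h y)⁻¹ j l *
                gaugeResidual β h Ξ v a aG (k.s * k.cH / (2 * k.cYM)) y l X else 0 := by
            intro j'
            split_ifs with hj
            · subst hj
              rw [Pi.single_eq_same, Finset.mul_sum]
              refine Finset.sum_congr rfl fun l _ => ?_
              simp only [gaugeResidual, map_smul, smul_eq_mul, Submodule.coe_smul, smul_apply,
                real_inner_smul_right]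
              ring
            · rw [Pi.single_eq_of_ne hj]
              simp [gaugeResidual]
          simp only [e, hf]
          simp [higgsResidual]
          ring) y hy
      simpa [hf, hvol y hy, hs, hcYM] using hf0
    · intro y hy w
      set f : Coord n → ℝ := fun y => volDensity h y *
        (2 * k.cH * higgsResidual V h Ξ v aG φ (k.s * k.cV / (2 * k.cH)) y w) with hf
      have hfs : ContDiffOn ℝ ∞ f U := hvs.mul (contDiffOn_const.mul
        (H.contDiffOn_higgsResidual hV haG hφ contDiffOn_const _))
      have hf0 := eqOn_zero_of_setIntegral_smul_eq_zero (μ := volume) H.isOpen hfs.continuousOn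
        (fun η hη hc hηU => by
          -- Test with `α = 0` and `ψ = η w`.
          rw [← hI' η hη hc hηU 0 w]
          refine setIntegral_congr_fun hc.isCompact.measurableSet fun y hy => ?_
          simp [hf, gaugeResidual, higgsResidual, real_inner_smul_right]
          ring) y hy
      simpa [hf, hvol y hy, hcH] using hf0
  · rintro ⟨h1, h2⟩ K hK hKU α ψ hα hψ hψK
    rw [H.integral_linearizedVariation hV k β ha haG hav hφ hperp hK hKU
      (fun j => (hα j).1.contDiffOn)
      (fun j y hy => eq_zero_of_notMem_of_tsupport_subset (hα j).2 hy) hψ.contDiffOn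
      (fun y hy => eq_zero_of_notMem_of_tsupport_subset hψK hy)]
    rw [setIntegral_congr_fun (g := fun _ => (0 : ℝ)) hK.measurableSet fun y hy => ?_]
    · simp
    · simp [h1 y (hKU hy), h2 y (hKU hy)]

theorem pd_eq_zero_of_eq_zero {F : Type*} [NormedAddCommGroup F] [NormedSpace ℝ F]
    {f : Coord n → F} {K : Set (Coord n)} (hK : IsClosed K) (h0 : ∀ y ∉ K, f y = 0)
    {y : Coord n} (hy : y ∉ K) (i : Fin n) : pd i f y = 0 := by
  rw [pd_congr hK.isOpen_compl (g := fun _ => 0) (fun z hz => h0 z hz) hy]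
  simp [pd]

/-- A Goldstone-valued solution of the gauge boson equation is coclosed. -/
theorem coDerivOne_action_eq_zero (H : LocalVacuumPair V h U Ξ v) (β : InvariantForm ρ)
    {aG : Fin n → Coord n → ρ.lie} {r : ℝ} (hr : r ≠ 0)
    (ha : ∀ i, ContDiffOn ℝ ∞ (a i) U) (haG : ∀ i, ContDiffOn ℝ ∞ (aG i) U)
    (hres : ∀ y ∈ U, ∀ l X, gaugeResidual β h Ξ v a aG r y l X = 0) {y : Coord n} (hy : y ∈ U) :
    coDerivOne h Ξ (fun z i => (aG i z).1 (v z)) y = 0 := by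
  have hU := H.isOpen
  have hΞ := H.smooth_potential
  have haGv : ∀ i, ContDiffOn ℝ ∞ (fun y => (aG i y).1 (v y)) U :=
    fun i => contDiffOn_action (haG i) H.smooth_vacuum
  have hδ := contDiffOn_coDerivOne hU hΞ H.smooth_metric H.det_ne_zero haGv
  have key : ∀ X : ρ.lie, ⟪coDerivOne h Ξ (fun z i => (aG i z).1 (v z)) y, X.1 (v y)⟫_ℝ = 0 := by
    intro X
    set f : Coord n → ℝ := fun y => volDensity h y *
      ⟪coDerivOne h Ξ (fun z i => (aG i z).1 (v z)) y, X.1 (v y)⟫_ℝ with hf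
    have hfs : ContDiffOn ℝ ∞ f U :=
      (contDiffOn_volDensity H.smooth_metric H.det_ne_zero).mul
        (hδ.inner ℝ (contDiffOn_action contDiffOn_const H.smooth_vacuum))
    have hf0 := eqOn_zero_of_setIntegral_smul_eq_zero (μ := volume) hU hfs.continuousOn
      (fun η hη hc hηU => by
        -- An infinitesimal gauge transformation with compact support; the gauge equation is tested
        -- against its covariant derivative `∂Y`.
        set Y : Coord n → ρ.lie := fun y => η y • X with hY
        have hYs : ContDiffOn ℝ ∞ Y U := contDiffOn_fun_smul hη.contDiffOn contDiffOn_const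
        have hY0 : ∀ y ∉ tsupport η, Y y = 0 := fun y hy => by
          change η y • X = 0
          rw [image_eq_zero_of_notMem_tsupport hy, zero_smul]
        have hDs : ∀ j, ContDiffOn ℝ ∞ (fun y => covAd Ξ Y y j) U := fun j =>
          contDiffOn_covAd hU hΞ hYs j
        have hD0 : ∀ j, ∀ y ∉ tsupport η, covAd Ξ Y y j = 0 := fun j y hy => by
          have h1 : pd j Y y = 0 := pd_eq_zero_of_eq_zero (isClosed_tsupport η) hY0 hy j
          have h2 : ρ.bracket (Ξ j y) (Y y) = 0 := by
            rw [hY0 y hy]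
            exact map_zero (ρ.bracketₗ (Ξ j y))
          exact (congrArg₂ (· + ·) h1 h2).trans (add_zero _)
        have i1 := integral_pairTwo_extCovDeriv β hU hΞ H.smooth_metric H.det_ne_zero
          H.isSymm_inv (contDiffOn_extCovDeriv hU hΞ ha) (extCovDeriv_swap Ξ a) hc hηU hDs hD0
        have i2 := integral_pairOne_covDeriv hU hΞ H.smooth_metric H.det_ne_zero
          H.isSymm_inv haGv hc hηU (ψ := fun y => (Y y).1 (v y))
          (contDiffOn_action hYs H.smooth_vacuum) (fun y hy => by simp [hY0 y hy])
        have e1 : ∫ y in tsupport η, volDensity h y * pairTwo β (h y)⁻¹ (extCovDeriv Ξ a y)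
            (extCovDeriv Ξ (fun j y => covAd Ξ Y y j) y) = 0 := by
          rw [setIntegral_congr_fun (g := fun _ => (0 : ℝ)) hc.isCompact.measurableSet
            fun y hy => ?_]
          · simp
          -- Here flatness is decisive: `∂∂Y` is the bracket of `Y` with the field strength.
          · have e : extCovDeriv Ξ (fun j y => covAd Ξ Y y j) y = 0 := by
              funext i j
              rw [extCovDeriv_covAd hU hΞ hYs (hηU hy), H.flat y (hηU hy)]
              exact LinearMap.map_zero₂ ρ.bracketₗ _
            simp [e, pairTwo]
        -- The gauge equation trades `δ∂a` for the mass term. The constant `-4 * r` combines the 2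
        -- of the adjointness formula with the 2 of the mass form.
        have e2 : ∫ y in tsupport η, volDensity h y * (2 * ∑ j, ∑ l, (h y)⁻¹ j l *
            β.toBilin (coDerivTwo h Ξ (extCovDeriv Ξ a) y l) (covAd Ξ Y y j)) =
            -4 * r * ∫ y in tsupport η, volDensity h y * pairOne (h y)⁻¹
              (fun i => (aG i y).1 (v y)) (covDeriv Ξ (fun y => (Y y).1 (v y)) y) := by
          rw [← integral_const_mul]
          refine setIntegral_congr_fun hc.isCompact.measurableSet fun y hy => ?_
          have hyU := hηU hy
          have e : ∀ j l, (h y)⁻¹ j l *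
              β.toBilin (coDerivTwo h Ξ (extCovDeriv Ξ a) y l) (covAd Ξ Y y j) =
              -2 * r * ((h y)⁻¹ l j *
                ⟪(aG l y).1 (v y), covDeriv Ξ (fun y => (Y y).1 (v y)) y j⟫_ℝ) := fun j l => by
            have h1 := hres y hyU l (covAd Ξ Y y j)
            rw [gaugeResidual] at h1
            rw [covDeriv_action Ξ hU hYs H.smooth_vacuum hyU, H.parallel y hyU, map_zero, add_zero,
              (H.isSymm_inv y hyU).apply j l]
            linear_combination ((h y)⁻¹ j l) * h1
          simp only [e, pairOne, ← Finset.mul_sum]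
          rw [Finset.sum_comm]
          ring
        have e3 : ∫ y in tsupport η, η y * f y = ∫ y in tsupport η, volDensity h y *
            ⟪coDerivOne h Ξ (fun z i => (aG i z).1 (v z)) y, (Y y).1 (v y)⟫_ℝ := by
          refine setIntegral_congr_fun hc.isCompact.measurableSet fun y hy => ?_
          simp only [hf, hY, Submodule.coe_smul, smul_apply, real_inner_smul_right]
          ring
        rw [e3, ← i2]
        rw [e1, e2] at i1
        have hr4 : -4 * r ≠ 0 := mul_ne_zero (by norm_num) hr
        exact (mul_eq_zero.1 i1.symm).resolve_left hr4) y hy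
    simpa [hf, (volDensity_pos (H.det_ne_zero y hy)).ne'] using hf0
  -- The codifferential is `Z v` for some `Z`; choosing `X = Z` makes it orthogonal to itself.
  obtain ⟨Z, hZ⟩ := H.exists_coDerivOne_action haG hy
  have := key Z
  rw [hZ, inner_self_eq_zero] at this
  rw [hZ, this]

end LocalVacuumPair

end YMH

namespace YMH

/-! ### Parallel frames adapted to the vacuum -/

section Subspace

variable {n : ℕ} {F : Type*} [NormedAddCommGroup F] [NormedSpace ℝ F] [FiniteDimensional ℝ F]
  {S : Submodule ℝ F} {U : Set (Coord n)}

/-- Smoothness in the ambient space passes to the subspace by composing with a linear left inverse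
of the inclusion. -/
theorem contDiffOn_of_coe {f : Coord n → S} (hf : ContDiffOn ℝ ∞ (fun y => (f y : F)) U) :
    ContDiffOn ℝ ∞ f U := by
  obtain ⟨P, hP⟩ := LinearMap.exists_leftInverse_of_injective S.subtype (by simp)
  refine ((LinearMap.toContinuousLinearMap P).contDiff.comp_contDiffOn hf).congr fun y _ => ?_
  exact (congrArg (fun T : S →ₗ[ℝ] S => T (f y)) hP).symm

theorem coe_pd (hU : IsOpen U) {f : Coord n → S} (hf : ContDiffOn ℝ ∞ f U) {y : Coord n}
    (hy : y ∈ U) (i : Fin n) : ((pd i f y : S) : F) = pd i (fun z => (f z : F)) y := by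
  have h := S.subtypeL.hasFDerivAt.comp y (differentiableAt_of_contDiffOn hU hf hy).hasFDerivAt
  have h' : HasFDerivAt (fun z => (f z : F)) (S.subtypeL ∘L fderiv ℝ f y) y := h
  rw [pd, pd, h'.fderiv]
  rfl

end Subspace

variable {n : ℕ} {G : Type*} [Group G] [TopologicalSpace G]
  {W : Type*} [NormedAddCommGroup W] [InnerProductSpace ℝ W] [FiniteDimensional ℝ W]
  {ρ : OrthogonalRep G W}

theorem contDiffOn_map_inv {E : Type*} [NormedAddCommGroup E] [NormedSpace ℝ E] {N : Set E}
    {u : E → G} (hu : ContDiffOn ℝ ∞ (fun y => ρ (u y)) N) :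
    ContDiffOn ℝ ∞ (fun y => ρ (u y)⁻¹) N := by
  have : CompleteSpace W := FiniteDimensional.complete ℝ W
  simp only [ρ.map_inv_eq_star]
  exact OrthogonalRep.contDiff_star.comp_contDiffOn hu

/-- A frame `u` over `N` with respect to which the vacuum section is `z₀` and the gauge potential
has values in `Lie(H)`. -/
structure AdaptedFrame (ρ : OrthogonalRep G W) (z₀ : W) (Ξ : Fin n → Coord n → ρ.lie)
    (v : Coord n → W) (N : Set (Coord n)) (u : Coord n → G) : Prop where
  isOpen : IsOpen N
  smooth : ContDiffOn ℝ ∞ (fun y => ρ (u y)) N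
  exists_pd : ∀ y ∈ N, ∀ i, ∃ ξ ∈ ρ.lieH z₀,
    pd i (fun z => ρ (u z)) y + (Ξ i y).1 * ρ (u y) = ρ (u y) * ξ.1
  vacuum : ∀ y ∈ N, v y = ρ (u y) z₀

namespace AdaptedFrame

variable {z₀ : W} {Ξ : Fin n → Coord n → ρ.lie} {v : Coord n → W} {N : Set (Coord n)}
  {u : Coord n → G}

theorem smooth_vacuum (H : AdaptedFrame ρ z₀ Ξ v N u) : ContDiffOn ℝ ∞ v N :=
  (H.smooth.clm_apply (contDiffOn_const (c := z₀))).congr H.vacuum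

/-- Evaluating the frame equation at `z₀` gives `ρ(u) ξ z₀`, and `ξ` in `Lie(H)` annihilates `z₀`.
-/
theorem covDeriv_vacuum (H : AdaptedFrame ρ z₀ Ξ v N u) {y : Coord n} (hy : y ∈ N) (i : Fin n) :
    covDeriv Ξ v y i = 0 := by
  obtain ⟨ξ, hξ, h⟩ := H.exists_pd y hy i
  have h1 : pd i v y = pd i (fun z => ρ (u z)) y z₀ := by
    rw [pd_congr H.isOpen H.vacuum hy, pd, pd, fderiv_clm_apply
      (differentiableAt_of_contDiffOn H.isOpen H.smooth hy) (differentiableAt_const z₀)]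
    simp
  rw [covDeriv, h1, H.vacuum y hy]
  have h2 := congrArg (fun T : Endo W => T z₀) h
  simp only [add_apply, mul_apply_eq_comp] at h2
  rw [h2, OrthogonalRep.apply_eq_zero_of_mem_lieH hξ, map_zero]

theorem pd_map_inv (H : AdaptedFrame ρ z₀ Ξ v N u) {y : Coord n} (hy : y ∈ N) (i : Fin n) :
    pd i (fun z => ρ (u z)⁻¹) y = -(ρ (u y)⁻¹ * pd i (fun z => ρ (u z)) y * ρ (u y)⁻¹) := by
  have h := pd_bilin (LinearMap.mul ℝ (Endo W)) i H.isOpen (contDiffOn_map_inv H.smooth) H.smooth hy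
  have h0 : pd i (fun z => LinearMap.mul ℝ (Endo W) (ρ (u z)⁻¹) (ρ (u z))) y = 0 := by
    simp [ρ.map_inv_mul_map, pd]
  rw [h0] at h
  simp only [LinearMap.mul_apply'] at h
  have h' := congrArg (fun T => T * ρ (u y)⁻¹) h
  simp only [zero_mul, add_mul, mul_assoc, ρ.map_mul_map_inv, mul_one] at h'
  rw [mul_assoc]
  exact eq_neg_of_add_eq_zero_left h'.symm

theorem contDiffOn_Ad (H : AdaptedFrame ρ z₀ Ξ v N u) (Z : ρ.lie) :
    ContDiffOn ℝ ∞ (fun y => ρ.Ad (u y) Z) N :=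
  contDiffOn_of_coe (F := Endo W) (S := ρ.lie)
    ((H.smooth.clm_comp contDiffOn_const).clm_comp (contDiffOn_map_inv H.smooth))

/-- In the frame `u` the connection acts by bracketing with `ξ` in `Lie(H)`. Consequently every
subspace stable under `Lie(H)` spans a parallel subbundle. -/
theorem exists_covAd_Ad (H : AdaptedFrame ρ z₀ Ξ v N u) {y : Coord n} (hy : y ∈ N) (i : Fin n) :
    ∃ ξ ∈ ρ.lieH z₀, ∀ Z, covAd Ξ (fun z => ρ.Ad (u z) Z) y i = ρ.Ad (u y) (ρ.bracket ξ Z) := by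
  obtain ⟨ξ, hξ, h⟩ := H.exists_pd y hy i
  refine ⟨ξ, hξ, fun Z => ?_⟩
  have e : pd i (fun z => ρ (u z)) y = ρ (u y) * ξ.1 - (Ξ i y).1 * ρ (u y) :=
    eq_sub_of_add_eq h
  have hc : ContDiffOn ℝ ∞ (fun z => ρ (u z) * Z.1) N := H.smooth.clm_comp contDiffOn_const
  have h1 := pd_bilin (LinearMap.mul ℝ (Endo W)) i H.isOpen hc (contDiffOn_map_inv H.smooth) hy
  have h2 := pd_bilin (LinearMap.mul ℝ (Endo W)) i H.isOpen H.smooth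
    (contDiffOn_const (c := Z.1)) hy
  have h3 : pd i (fun _ : Coord n => Z.1) y = 0 := by simp [pd]
  simp only [LinearMap.mul_apply'] at h1 h2
  rw [h3, mul_zero, add_zero] at h2
  rw [h2, H.pd_map_inv hy, e] at h1
  have h4 : ((pd i (fun z => ρ.Ad (u z) Z) y : ρ.lie) : Endo W) =
      pd i (fun z => ρ (u z) * Z.1 * ρ (u z)⁻¹) y :=
    coe_pd (F := Endo W) (S := ρ.lie) H.isOpen (H.contDiffOn_Ad Z) hy i
  refine Subtype.ext ?_
  change ((pd i (fun z => ρ.Ad (u z) Z) y : ρ.lie) : Endo W) + ((Ξ i y).1 * (ρ (u y) * Z.1 * ρ (u y)⁻¹) -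
    (ρ (u y) * Z.1 * ρ (u y)⁻¹) * (Ξ i y).1) = ρ (u y) * (ξ.1 * Z.1 - Z.1 * ξ.1) * ρ (u y)⁻¹
  rw [h4, h1]
  have k1 := ρ.map_inv_mul_map (u y)
  have k2 := ρ.map_mul_map_inv (u y)
  generalize ρ (u y) = R at *
  generalize ρ (u y)⁻¹ = R' at *
  -- Isolates the only place where `R R' = 1` and `R' R = 1` are needed; the remaining identity
  -- holds in any noncommutative ring.
  have k3 : R' * (R * ξ.1 - (Ξ i y).1 * R) * R' = ξ.1 * R' - R' * (Ξ i y).1 := by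
    rw [mul_sub, sub_mul, ← mul_assoc R' R, k1, one_mul, ← mul_assoc R', mul_assoc _ R R', k2,
      mul_one]
  rw [k3]
  noncomm_ring

/-- Differentiate `β(X, Ad_u Z) = 0`: the connection is metric, and `∂(Ad_u Z)` lies again in the
subbundle spanned by `S`. -/
theorem form_covAd_eq_zero (H : AdaptedFrame ρ z₀ Ξ v N u) (β : InvariantForm ρ)
    {S : Submodule ℝ ρ.lie} (hS : ∀ ξ ∈ ρ.lieH z₀, ∀ Z ∈ S, ρ.bracket ξ Z ∈ S)
    {X : Coord n → ρ.lie} (hX : ContDiffOn ℝ ∞ X N)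
    (hXS : ∀ y ∈ N, ∀ Z ∈ S, β.toBilin (X y) (ρ.Ad (u y) Z) = 0) {y : Coord n} (hy : y ∈ N)
    (i : Fin n) {Z : ρ.lie} (hZ : Z ∈ S) : β.toBilin (covAd Ξ X y i) (ρ.Ad (u y) Z) = 0 := by
  obtain ⟨ξ, hξ, h⟩ := H.exists_covAd_Ad hy i
  have h1 := pd_form_cov (A := Ξ) β H.isOpen hX (H.contDiffOn_Ad Z) hy i
  have h2 : pd i (fun z => β.toBilin (X z) (ρ.Ad (u z) Z)) y = 0 := by
    rw [pd_congr H.isOpen (fun z hz => hXS z hz Z hZ) hy]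
    simp [pd]
  rw [h2, h, hXS y hy _ (hS ξ hξ Z hZ), add_zero] at h1
  exact h1.symm

variable {h : Coord n → Matrix (Fin n) (Fin n) ℝ} {a : Fin n → Coord n → ρ.lie}

/-- The operator `δ∂` preserves the orthogonal complement of a parallel subbundle. -/
theorem form_coDerivTwo_eq_zero (H : AdaptedFrame ρ z₀ Ξ v N u) (β : InvariantForm ρ)
    (hΞ : ∀ i, ContDiffOn ℝ ∞ (Ξ i) N) (hh : ∀ i j, ContDiffOn ℝ ∞ (fun y => h y i j) N)
    (h0 : ∀ y ∈ N, (h y).det ≠ 0)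
    {S : Submodule ℝ ρ.lie} (hS : ∀ ξ ∈ ρ.lieH z₀, ∀ Z ∈ S, ρ.bracket ξ Z ∈ S)
    (ha : ∀ i, ContDiffOn ℝ ∞ (a i) N)
    (haS : ∀ i, ∀ y ∈ N, ∀ Z ∈ S, β.toBilin (a i y) (ρ.Ad (u y) Z) = 0) {y : Coord n} (hy : y ∈ N)
    (l : Fin n) {Z : ρ.lie} (hZ : Z ∈ S) :
    β.toBilin (coDerivTwo h Ξ (extCovDeriv Ξ a) y l) (ρ.Ad (u y) Z) = 0 := by
  have h1 : ∀ i j, ∀ y ∈ N, ∀ Z ∈ S,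
      β.toBilin (extCovDeriv Ξ a y i j) (ρ.Ad (u y) Z) = 0 := fun i j y hy Z hZ => by
    rw [extCovDeriv_eq, map_sub, LinearMap.sub_apply,
      H.form_covAd_eq_zero β hS (ha j) (haS j) hy i hZ,
      H.form_covAd_eq_zero β hS (ha i) (haS i) hy j hZ, sub_zero]
  have h2 : ∀ i j, ∀ y ∈ N, ∀ Z ∈ S,
      β.toBilin (raiseTwo h (extCovDeriv Ξ a) i j y) (ρ.Ad (u y) Z) = 0 := fun i j y hy Z hZ => by
    simp [raiseTwo, LinearMap.sum_apply, h1 _ _ y hy Z hZ]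
  have h3 := contDiffOn_raiseTwo hh h0 (contDiffOn_extCovDeriv H.isOpen hΞ ha)
  rw [coDerivTwo_eq]
  simp [LinearMap.sum_apply, H.form_covAd_eq_zero β hS (h3 _ _) (h2 _ _) hy _ hZ]

theorem coDerivTwo_extCovDeriv_add (hN : IsOpen N) (hΞ : ∀ i, ContDiffOn ℝ ∞ (Ξ i) N)
    (hh : ∀ i j, ContDiffOn ℝ ∞ (fun y => h y i j) N) (h0 : ∀ y ∈ N, (h y).det ≠ 0)
    {a a' : Fin n → Coord n → ρ.lie} (ha : ∀ i, ContDiffOn ℝ ∞ (a i) N)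
    (ha' : ∀ i, ContDiffOn ℝ ∞ (a' i) N) {y : Coord n} (hy : y ∈ N) (l : Fin n) :
    coDerivTwo h Ξ (extCovDeriv Ξ fun i z => a i z + a' i z) y l =
      coDerivTwo h Ξ (extCovDeriv Ξ a) y l + coDerivTwo h Ξ (extCovDeriv Ξ a') y l := by
  have h1 : ∀ z ∈ N, ∀ i j, extCovDeriv Ξ (fun i z => a i z + a' i z) z i j =
      extCovDeriv Ξ a z i j + extCovDeriv Ξ a' z i j := fun z hz i j => by
    simp only [extCovDeriv_eq, covAd_add hN (ha _) (ha' _) hz]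
    abel
  have h2 : ∀ i j, ∀ z ∈ N, raiseTwo h (extCovDeriv Ξ fun i z => a i z + a' i z) i j z =
      raiseTwo h (extCovDeriv Ξ a) i j z + raiseTwo h (extCovDeriv Ξ a') i j z := fun i j z hz => by
    simp only [raiseTwo, h1 z hz, smul_add, Finset.sum_add_distrib]
  have h3 := contDiffOn_raiseTwo hh h0 (contDiffOn_extCovDeriv hN hΞ ha)
  have h4 := contDiffOn_raiseTwo hh h0 (contDiffOn_extCovDeriv hN hΞ ha')
  have h5 : ∀ i j, covAd Ξ (raiseTwo h (extCovDeriv Ξ fun i z => a i z + a' i z) i j) y i =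
      covAd Ξ (raiseTwo h (extCovDeriv Ξ a) i j) y i +
        covAd Ξ (raiseTwo h (extCovDeriv Ξ a') i j) y i := fun i j => by
    rw [← covAd_add hN (h3 i j) (h4 i j) hy, covAd, covAd, pd_congr hN (h2 i j) hy, h2 i j y hy]
  simp only [coDerivTwo_eq, h5, smul_add, Finset.sum_add_distrib, neg_add]

theorem exists_Ad_add (u : Coord n → G) (β : InvariantForm ρ) (y : Coord n)
    (X : ρ.lie) : ∃ Y ∈ ρ.lieH z₀, ∃ Z ∈ β.lieHPerp z₀, ρ.Ad (u y) Y + ρ.Ad (u y) Z = X := by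
  obtain ⟨Y, hY, Z, hZ, h⟩ := β.exists_add_mem (z₀ := z₀) (ρ.Ad (u y)⁻¹ X)
  exact ⟨Y, hY, Z, hZ, by rw [← map_add, h, ρ.Ad_Ad_inv]⟩

theorem Ad_apply_vacuum (H : AdaptedFrame ρ z₀ Ξ v N u) {y : Coord n} (hy : y ∈ N) {Y : ρ.lie}
    (hY : Y ∈ ρ.lieH z₀) : (ρ.Ad (u y) Y).1 (v y) = 0 := by
  rw [H.vacuum y hy, ρ.Ad_apply_map, OrthogonalRep.apply_eq_zero_of_mem_lieH hY, map_zero]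

/-- The equation for the gauge field splits into its components along `Lie(H)` and along its
orthogonal complement. -/
theorem gaugeResidual_add_eq_zero_iff (H : AdaptedFrame ρ z₀ Ξ v N u) (β : InvariantForm ρ)
    (hΞ : ∀ i, ContDiffOn ℝ ∞ (Ξ i) N) (hh : ∀ i j, ContDiffOn ℝ ∞ (fun y => h y i j) N)
    (h0 : ∀ y ∈ N, (h y).det ≠ 0) {aH aG : Fin n → Coord n → ρ.lie}
    (haH : ∀ i, ContDiffOn ℝ ∞ (aH i) N) (haG : ∀ i, ContDiffOn ℝ ∞ (aG i) N)
    (haH' : ∀ i, ∀ y ∈ N, ∀ Z ∈ β.lieHPerp z₀, β.toBilin (aH i y) (ρ.Ad (u y) Z) = 0)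
    (haG' : ∀ i, ∀ y ∈ N, ∀ Z ∈ ρ.lieH z₀, β.toBilin (aG i y) (ρ.Ad (u y) Z) = 0)
    (r : ℝ) {y : Coord n} (hy : y ∈ N) (l : Fin n) :
    (∀ X, LocalVacuumPair.gaugeResidual β h Ξ v (fun i z => aH i z + aG i z) aG r y l X = 0) ↔
      coDerivTwo h Ξ (extCovDeriv Ξ aH) y l = 0 ∧
        ∀ X, LocalVacuumPair.gaugeResidual β h Ξ v aG aG r y l X = 0 := by
  have e : ∀ X, LocalVacuumPair.gaugeResidual β h Ξ v (fun i z => aH i z + aG i z) aG r y l X =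
      β.toBilin (coDerivTwo h Ξ (extCovDeriv Ξ aH) y l) X +
        LocalVacuumPair.gaugeResidual β h Ξ v aG aG r y l X := fun X => by
    rw [LocalVacuumPair.gaugeResidual, LocalVacuumPair.gaugeResidual,
      coDerivTwo_extCovDeriv_add H.isOpen hΞ hh h0 haH haG hy, map_add, LinearMap.add_apply]
    ring
  constructor
  · intro hX
    have h1 : ∀ X, β.toBilin (coDerivTwo h Ξ (extCovDeriv Ξ aH) y l) X = 0 := fun X => by
      obtain ⟨Y, hY, Z, hZ, rfl⟩ := exists_Ad_add u β y X
      -- Tested along `Lie(H)`, both `δ∂aG` and the mass term vanish, leaving `δ∂aH`; along the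
      -- complement `δ∂aH` vanishes by itself.
      have hG := H.form_coDerivTwo_eq_zero β hΞ hh h0
        (fun ξ hξ Z hZ => OrthogonalRep.bracket_mem_lieH hξ hZ) haG haG' hy l hY
      have hH := H.form_coDerivTwo_eq_zero β hΞ hh h0
        (fun ξ hξ Z hZ => β.bracket_mem_lieHPerp hξ hZ) haH haH' hy l hZ
      have h2 := (e (ρ.Ad (u y) Y)).symm.trans (hX _)
      rw [LocalVacuumPair.gaugeResidual, hG, H.Ad_apply_vacuum hy hY, inner_zero_right, mul_zero,
        mul_zero, add_zero, add_zero] at h2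
      rw [map_add, h2, hH, add_zero]
    refine ⟨β.eq_zero_of_forall h1, fun X => ?_⟩
    have := (e X).symm.trans (hX X)
    rwa [h1, zero_add] at this
  · rintro ⟨h1, h2⟩ X
    rw [e, h1, h2, add_zero, map_zero, LinearMap.zero_apply]

end AdaptedFrame

/-! ### Pointwise form of the gauge and Higgs equations -/

namespace LocalVacuumPair

variable {V : W → ℝ} {h : Coord n → Matrix (Fin n) (Fin n) ℝ}
    {U : Set (Coord n)} {Ξ : Fin n → Coord n → ρ.lie} {v : Coord n → W}

theorem gaugeResidual_eq_zero_iff (β : InvariantForm ρ) {a : Fin n → Coord n → ρ.lie} {r : ℝ}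
    {y : Coord n} {l : Fin n} {m : ρ.lie}
    (hm : ∀ X, β.toBilin m X = 2 * ⟪(a l y).1 (v y), X.1 (v y)⟫_ℝ) :
    (∀ X, gaugeResidual β h Ξ v a a r y l X = 0) ↔
      coDerivTwo h Ξ (extCovDeriv Ξ a) y l + r • m = 0 := by
  have e : ∀ X, gaugeResidual β h Ξ v a a r y l X =
      β.toBilin (coDerivTwo h Ξ (extCovDeriv Ξ a) y l + r • m) X := fun X => by
    rw [gaugeResidual, map_add, map_smul, LinearMap.add_apply, LinearMap.smul_apply, hm,
      smul_eq_mul]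
  simp only [e]
  exact ⟨fun h => β.eq_zero_of_forall h, fun h X => by rw [h, map_zero, LinearMap.zero_apply]⟩

theorem higgsResidual_eq_zero_iff (H : LocalVacuumPair V h U Ξ v) (hV : IsHiggsPotential ρ V)
    {aG : Fin n → Coord n → ρ.lie} (haG : ∀ i, ContDiffOn ℝ ∞ (aG i) U) {φ : Coord n → W}
    (hφ : ContDiffOn ℝ ∞ φ U) (hperp : ∀ y ∈ U, ∀ X : ρ.lie, ⟪φ y, X.1 (v y)⟫_ℝ = 0) {r : ℝ}
    {y : Coord n} (hy : y ∈ U) {m : W} (hm : ∀ w, ⟪m, w⟫_ℝ = hess V (v y) (φ y) w) :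
    (∀ w, higgsResidual V h Ξ v aG φ r y w = 0) ↔
      coDerivOne h Ξ (fun z i => (aG i z).1 (v z)) y = 0 ∧
        coDerivOne h Ξ (covDeriv Ξ φ) y + r • m = 0 := by
  have e : ∀ w, higgsResidual V h Ξ v aG φ r y w =
      ⟪coDerivOne h Ξ (fun z i => (aG i z).1 (v z)) y, w⟫_ℝ +
        ⟪coDerivOne h Ξ (covDeriv Ξ φ) y + r • m, w⟫_ℝ := fun w => by
    rw [higgsResidual, inner_add_left, real_inner_smul_left, hm]
    ring
  constructor
  · intro hw
    -- Testing with the tangent vector `Z v = δ(aG v)` itself removes `δ∂φ` by orthogonality and the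
    -- Hessian by Goldstone's theorem; only its squared norm remains.
    have h1 : coDerivOne h Ξ (fun z i => (aG i z).1 (v z)) y = 0 := by
      obtain ⟨Z, hZ⟩ := H.exists_coDerivOne_action haG hy
      have h2 := (e (Z.1 (v y))).symm.trans (hw _)
      rwa [hZ, inner_add_left, H.inner_coDerivOne_covDeriv_eq_zero hφ hperp hy,
        real_inner_smul_left, hm, hV.hess_apply_lie (H.minimum y hy), mul_zero, add_zero, add_zero,
        inner_self_eq_zero, ← hZ] at h2
    refine ⟨h1, ext_inner_right ℝ fun w => ?_⟩
    have h2 := (e w).symm.trans (hw w)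
    rwa [h1, inner_zero_left, zero_add, ← inner_zero_left (𝕜 := ℝ) w] at h2
  · rintro ⟨h1, h2⟩ w
    rw [e, h1, h2, inner_zero_left, add_zero]

end LocalVacuumPair

end YMH

namespace YMH

universe u

/-! ### Coordinate expressions of global objects -/

section Spacetime

variable {n : ℕ} {M : Type*} [TopologicalSpace M] [ChartedSpace (Coord n) M]
  {c : OpenPartialHomeomorph M (Coord n)}

theorem contMDiffOn_symm_of_mem_charts (hc : c ∈ charts n M) :
    ContMDiffOn 𝓘(ℝ, Coord n) 𝓘(ℝ, Coord n) ∞ c.symm c.target :=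
  contMDiffOn_symm_of_mem_maximalAtlas hc

theorem mdifferentiableAt_symm (hc : c ∈ charts n M) {y : Coord n} (hy : y ∈ c.target) :
    MDifferentiableAt 𝓘(ℝ, Coord n) 𝓘(ℝ, Coord n) c.symm y :=
  ((contMDiffOn_symm_of_mem_charts hc).contMDiffAt (c.open_target.mem_nhds hy)).mdifferentiableAt
    (by simp)

theorem contDiffOn_comp_symm {F : Type*} [NormedAddCommGroup F] [NormedSpace ℝ F]
    (hc : c ∈ charts n M) {f : M → F} {s : Set M}
    (hf : ContMDiffOn 𝓘(ℝ, Coord n) 𝓘(ℝ, F) ∞ f s) :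
    ContDiffOn ℝ ∞ (fun y => f (c.symm y)) (c.target ∩ c.symm ⁻¹' s) :=
  contMDiffOn_iff_contDiffOn.1 (hf.comp
    ((contMDiffOn_symm_of_mem_charts hc).mono inter_subset_left) inter_subset_right)

theorem mfderiv_symm_bijective [IsManifold 𝓘(ℝ, Coord n) ∞ M] (hc : c ∈ charts n M)
    {y : Coord n} (hy : y ∈ c.target) :
    Function.Bijective (mfderiv 𝓘(ℝ, Coord n) 𝓘(ℝ, Coord n) c.symm y) := by
  have h : c.MDifferentiable 𝓘(ℝ, Coord n) 𝓘(ℝ, Coord n) :=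
    ⟨(contMDiffOn_of_mem_maximalAtlas hc).mdifferentiableOn (by simp),
      (contMDiffOn_symm_of_mem_maximalAtlas hc).mdifferentiableOn (by simp)⟩
  exact h.symm.mfderiv_bijective hy

theorem isSymm_metricMatrix (g : PseudoMetric n M) (c : OpenPartialHomeomorph M (Coord n))
    (y : Coord n) : (metricMatrix c g.toFun y).IsSymm :=
  Matrix.IsSymm.ext fun _ _ => g.symm _ _ _

/-- A null vector `x` of the Gram matrix makes `T x` orthogonal to the images of a basis, hence to
everything by surjectivity of `T`. Then `T x = 0`, and `x = 0` by injectivity. -/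
theorem det_of_nondegenerate {F : Type*} [NormedAddCommGroup F] [NormedSpace ℝ F]
    (b : F →L[ℝ] F →L[ℝ] ℝ) (hb : ∀ v, (∀ w, b v w = 0) → v = 0) {T : Coord n →L[ℝ] F}
    (hT : Function.Bijective T) :
    (Matrix.of fun i j : Fin n => b (T (basisVec i)) (T (basisVec j))).det ≠ 0 := by
  intro h0
  obtain ⟨x, hx, h⟩ := Matrix.exists_vecMul_eq_zero_iff.2 h0
  have hsum : ∀ w : Coord n, w = ∑ j, w j • basisVec j := fun w => by
    ext j
    simp [Finset.sum_apply, Pi.single_apply]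
  have h1 : ∀ j, b (T (∑ i, x i • basisVec i)) (T (basisVec j)) = 0 := fun j => by
    have := congrFun h j
    simp only [Matrix.vecMul, dotProduct, Matrix.of_apply, Pi.zero_apply] at this
    simp only [map_sum, map_smul, sum_apply, smul_apply, smul_eq_mul, this]
  have h2 : T (∑ i, x i • basisVec i) = 0 := by
    refine hb _ fun w => ?_
    obtain ⟨w', rfl⟩ := hT.2 w
    generalize T (∑ i, x i • basisVec i) = v at h1
    rw [hsum w', map_sum T, map_sum (b v)]
    exact Finset.sum_eq_zero fun j _ => by rw [map_smul, map_smul, h1, smul_zero]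
  have h3 : (∑ i, x i • basisVec i : Coord n) = 0 := hT.1 (h2.trans (map_zero T).symm)
  refine hx (funext fun j => ?_)
  have := congrArg (fun w : Coord n => w j) h3
  simpa [Finset.sum_apply, Pi.single_apply] using this

theorem det_metricMatrix_ne_zero [IsManifold 𝓘(ℝ, Coord n) ∞ M] (g : PseudoMetric n M)
    (hc : c ∈ charts n M) {y : Coord n} (hy : y ∈ c.target) :
    (metricMatrix c g.toFun y).det ≠ 0 :=
  det_of_nondegenerate (F := Coord n) (g.toFun (c.symm y)) (g.nondegenerate (c.symm y))
    (mfderiv_symm_bijective hc hy)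

end Spacetime

variable {n : ℕ} {M : Type*} [TopologicalSpace M] [ChartedSpace (Coord n) M]
  {G : Type*} [Group G] [TopologicalSpace G]
  {W : Type*} [NormedAddCommGroup W] [InnerProductSpace ℝ W] [FiniteDimensional ℝ W]
  {ρ : OrthogonalRep G W}

namespace PrincipalBundle

/-! ### Transition functions and changes of gauge -/

section Diff

variable (B : PrincipalBundle.{u} ρ n M) {x : M}

theorem diff_mul_diff (p q r : B.Fiber x) : B.diff p q * B.diff q r = B.diff p r :=
  (B.act_bijective p).1 (by rw [B.act_mul, B.act_diff, B.act_diff, B.act_diff])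

theorem diff_self (p : B.Fiber x) : B.diff p p = 1 :=
  (B.act_bijective p).1 (by rw [B.act_diff, B.act_one])

theorem inv_diff (p q : B.Fiber x) : (B.diff p q)⁻¹ = B.diff q p :=
  inv_eq_of_mul_eq_one_right (by rw [diff_mul_diff, diff_self])

variable {B}

/-- Gauges are smooth relative to the reference sections. The transition from `σ` to `τ` factors
through a reference section covering the point, with the inverse factor realized by `star`. -/
theorem contMDiffOn_transition (σ τ : B.Gauge) :
    ContMDiffOn 𝓘(ℝ, Coord n) 𝓘(ℝ, Endo W) ∞ (B.transition σ τ) (σ.dom ∩ τ.dom) := by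
  have : CompleteSpace W := FiniteDimensional.complete ℝ W
  intro x hx
  obtain ⟨i, hi⟩ := B.cover x
  have hopen : IsOpen (B.dom i ∩ (σ.dom ∩ τ.dom)) :=
    (B.isOpen_dom i).inter (σ.isOpen_dom.inter τ.isOpen_dom)
  have h1 := OrthogonalRep.contDiff_star.contMDiff.comp_contMDiffOn
    ((σ.smooth i).mono (inter_subset_inter_right (B.dom i) inter_subset_left :
      B.dom i ∩ (σ.dom ∩ τ.dom) ⊆ _))
  have h2 := h1.clm_comp ((τ.smooth i).mono (inter_subset_inter_right (B.dom i) inter_subset_right))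
  refine ((h2.congr fun z _ => ?_).contMDiffAt
    (hopen.mem_nhds ⟨hi, hx⟩)).contMDiffWithinAt
  change ρ (B.diff (σ.sec z) (τ.sec z)) =
    star (ρ (B.diff (B.sec i z) (σ.sec z))) * ρ (B.diff (B.sec i z) (τ.sec z))
  rw [← ρ.map_inv_eq_star, B.inv_diff, ← ρ.map_mul, B.diff_mul_diff]

theorem isOpen_patch (c : OpenPartialHomeomorph M (Coord n)) (σ : B.Gauge) :
    IsOpen (B.patch c σ) :=
  c.isOpen_inter_preimage_symm σ.isOpen_dom

/-- The behaviour of a local gauge potential under a change of gauge. -/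
theorem Connection.pd_transition_add (A : B.Connection)
    {c : OpenPartialHomeomorph M (Coord n)} (hc : c ∈ charts n M) (σ τ : B.Gauge) {y : Coord n}
    (hσ : y ∈ B.patch c σ) (hτ : y ∈ B.patch c τ) (i : Fin n) :
    pd i (fun z => ρ (B.diff (σ.sec (c.symm z)) (τ.sec (c.symm z)))) y +
      (A.loc c σ i y).1 * ρ (B.diff (σ.sec (c.symm y)) (τ.sec (c.symm y))) =
      ρ (B.diff (σ.sec (c.symm y)) (τ.sec (c.symm y))) * (A.loc c τ i y).1 := by
  have hx : c.symm y ∈ σ.dom ∩ τ.dom := ⟨hσ.2, hτ.2⟩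
  have h1 := A.gauge_change σ τ (c.symm y) hx
    (mfderiv 𝓘(ℝ, Coord n) 𝓘(ℝ, Coord n) c.symm y (basisVec i))
  have hd : MDifferentiableAt 𝓘(ℝ, Coord n) 𝓘(ℝ, Endo W) (B.transition σ τ) (c.symm y) :=
    ((contMDiffOn_transition σ τ).contMDiffAt
      ((σ.isOpen_dom.inter τ.isOpen_dom).mem_nhds hx)).mdifferentiableAt (by simp)
  have h2 : pd i (fun z => ρ (B.diff (σ.sec (c.symm z)) (τ.sec (c.symm z)))) y =
      B.dTransition σ τ (c.symm y)
        (mfderiv 𝓘(ℝ, Coord n) 𝓘(ℝ, Coord n) c.symm y (basisVec i)) := by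
    have h3 := mfderiv_comp y hd (mdifferentiableAt_symm hc hσ.1)
    rw [mfderiv_eq_fderiv] at h3
    exact congrArg (fun T : Coord n →L[ℝ] Endo W => T (basisVec i)) h3
  change _ = ρ (B.diff (σ.sec (c.symm y)) (τ.sec (c.symm y))) * (A.form τ (c.symm y) _ : Endo W)
  rw [h1, h2, mul_add, ← mul_assoc, ← mul_assoc, ← mul_assoc, ρ.map_mul_map_inv, one_mul, one_mul,
    add_comm]
  rfl

theorem AdForm.loc_eq_Ad (a : B.AdForm) (c : OpenPartialHomeomorph M (Coord n)) (σ τ : B.Gauge)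
    (i : Fin n) (y : Coord n) :
    a.loc c σ i y = ρ.Ad (B.diff (σ.sec (c.symm y)) (τ.sec (c.symm y))) (a.loc c τ i y) := by
  have h := a.equivariant (c.symm y) (τ.sec (c.symm y)) (B.diff (τ.sec (c.symm y))
    (σ.sec (c.symm y))) (mfderiv 𝓘(ℝ, Coord n) 𝓘(ℝ, Coord n) c.symm y (basisVec i))
  rw [B.act_diff, B.inv_diff] at h
  exact h

theorem HiggsField.loc_eq_map (φ : B.HiggsField) (c : OpenPartialHomeomorph M (Coord n))
    (σ τ : B.Gauge) (y : Coord n) :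
    φ.loc c σ y = ρ (B.diff (σ.sec (c.symm y)) (τ.sec (c.symm y))) (φ.loc c τ y) := by
  have h := φ.equivariant (c.symm y) (τ.sec (c.symm y)) (B.diff (τ.sec (c.symm y))
    (σ.sec (c.symm y)))
  rw [B.act_diff, B.inv_diff] at h
  exact h

end Diff

/-! ### Coordinate form of the vacuum and of its mass matrices -/

namespace Vacuum

variable {B : PrincipalBundle.{u} ρ n M} {z₀ : W} (𝒬 : B.Vacuum z₀)
  {c : OpenPartialHomeomorph M (Coord n)} {σ τ : B.Gauge}

/-- Coordinate expression of the vacuum section. -/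
noncomputable def loc (c : OpenPartialHomeomorph M (Coord n)) (σ : B.Gauge) (y : Coord n) : W :=
  𝒬.vacuumSection (c.symm y) (σ.sec (c.symm y))

theorem diff_point_mem {x : M} {q : B.Fiber x} (hq : q ∈ 𝒬.Q x) :
    B.diff (𝒬.point x) q ∈ ρ.isotropy z₀ := by
  rw [← 𝒬.act_mem_iff x _ (𝒬.nonempty x).choose_spec]
  exact (congrArg (· ∈ 𝒬.Q x) (B.act_diff _ _)).mpr hq

/-- Two points of `Q` over `x` differ by an element of `H`, which fixes `z₀`; so the reference point
may be replaced by any `q` in `Q`. -/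
theorem vacuumSection_eq {x : M} {q : B.Fiber x} (hq : q ∈ 𝒬.Q x) (p : B.Fiber x) :
    𝒬.vacuumSection x p = ρ (B.diff p q) z₀ := by
  have h : ρ (B.diff (𝒬.point x) q)⁻¹ z₀ = z₀ :=
    (ρ.isotropy z₀).inv_mem (𝒬.diff_point_mem hq)
  rw [vacuumSection, ← B.diff_mul_diff _ q p, mul_inv_rev, ρ.map_mul, mul_apply_eq_comp, h,
    B.inv_diff]

/-- The frame is the transition to a gauge `τ` with values in `Q`. The element `ξ` of its frame
equation is the potential of `Ξ` in that gauge, which lies in `Lie(H)` by compatibility. -/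
theorem adaptedFrame {Ξ : B.Connection} (hΞ : 𝒬.Compatible Ξ) (hc : c ∈ charts n M)
    (hτ : ∀ x ∈ τ.dom, τ.sec x ∈ 𝒬.Q x) :
    AdaptedFrame ρ z₀ (Ξ.loc c σ) (𝒬.loc c σ) (B.patch c σ ∩ B.patch c τ)
      fun y => B.diff (σ.sec (c.symm y)) (τ.sec (c.symm y)) where
  isOpen := (isOpen_patch c σ).inter (isOpen_patch c τ)
  smooth := (contDiffOn_comp_symm hc (contMDiffOn_transition σ τ)).mono
    fun _ hy => ⟨hy.1.1, hy.1.2, hy.2.2⟩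
  exists_pd y hy i := ⟨Ξ.loc c τ i y, hΞ τ hτ _ hy.2.2 _, Ξ.pd_transition_add hc σ τ hy.1 hy.2 i⟩
  vacuum _ hy := 𝒬.vacuumSection_eq (hτ _ hy.2.2) _

theorem localVacuumPair [IsManifold 𝓘(ℝ, Coord n) ∞ M] (g : PseudoMetric n M) {V : W → ℝ}
    (hV : IsHiggsPotential ρ V) (hz₀ : ∀ z, V z₀ ≤ V z) {Ξ : B.Connection}
    (hΞ : 𝒬.IsVacuumPair Ξ) (hc : c ∈ charts n M) (σ : B.Gauge) :
    LocalVacuumPair V (metricMatrix c g.toFun) (B.patch c σ) (Ξ.loc c σ) (𝒬.loc c σ) := by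
  have hframe : ∀ y ∈ B.patch c σ, ∃ N u, y ∈ N ∧
      AdaptedFrame ρ z₀ (Ξ.loc c σ) (𝒬.loc c σ) N u := fun y hy => by
    obtain ⟨τ, hx, hτ⟩ := 𝒬.exists_gauge (c.symm y)
    exact ⟨B.patch c σ ∩ B.patch c τ, _, ⟨hy, hy.1, hx⟩, 𝒬.adaptedFrame hΞ.2 hc hτ⟩
  refine ⟨isOpen_patch c σ, fun i j => (g.smooth c hc i j).mono inter_subset_left,
    fun _ hy => det_metricMatrix_ne_zero g hc hy.1, fun y _ => isSymm_metricMatrix g c y,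
    Ξ.smooth σ c hc, fun y hy => ?_, hΞ.1 c hc σ, fun y hy i => ?_, fun y hy w => ?_⟩
  · obtain ⟨N, u, hyN, H⟩ := hframe y hy
    exact (H.smooth_vacuum.contDiffAt (H.isOpen.mem_nhds hyN)).contDiffWithinAt
  · obtain ⟨N, u, hyN, H⟩ := hframe y hy
    exact H.covDeriv_vacuum hyN i
  · rw [loc, vacuumSection, hV.invariant]
    exact hz₀ w

theorem form_globalMassYM (β : InvariantForm ρ) (σ : B.Gauge) (y : Coord n) (X Y : ρ.lie) :
    β.toBilin (𝒬.globalMassYM β (c.symm y) (σ.sec (c.symm y)) X) Y =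
      2 * ⟪X.1 (𝒬.loc c σ y), Y.1 (𝒬.loc c σ y)⟫_ℝ := by
  rw [globalMassYM, loc, vacuumSection]
  generalize B.diff (𝒬.point (c.symm y)) (σ.sec (c.symm y)) = p
  rw [← β.invariant p, ρ.Ad_Ad_inv, β.massYM_spec, OrthogonalRep.coe_Ad, OrthogonalRep.coe_Ad]
  simp only [mul_apply_eq_comp, ρ.inner_map]

/-- Invariance of the Hessian transports the definition at `z₀` to the point `v y` of the orbit. -/
theorem inner_globalMassH {V : W → ℝ} (hV : IsHiggsPotential ρ V) (σ : B.Gauge) (y : Coord n)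
    (w w' : W) : ⟪𝒬.globalMassH V (c.symm y) (σ.sec (c.symm y)) w, w'⟫_ℝ =
      hess V (𝒬.loc c σ y) w w' := by
  rw [globalMassH, loc, vacuumSection]
  generalize B.diff (𝒬.point (c.symm y)) (σ.sec (c.symm y)) = p
  rw [ρ.inner_map_left, inv_inv, massH_spec, ← hV.hess_map p (ρ p⁻¹ z₀),
    ρ.map_apply_map_inv]

theorem form_loc_adQ (β : InvariantForm ρ) {a : B.AdForm} (ha : 𝒬.IsAdQValued a)
    (hτ : ∀ x ∈ τ.dom, τ.sec x ∈ 𝒬.Q x) (i : Fin n) {y : Coord n} (hy : y ∈ B.patch c τ)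
    {Z : ρ.lie} (hZ : Z ∈ β.lieHPerp z₀) :
    β.toBilin (a.loc c σ i y)
      (ρ.Ad (B.diff (σ.sec (c.symm y)) (τ.sec (c.symm y))) Z) = 0 := by
  rw [a.loc_eq_Ad c σ τ, β.invariant, β.symm]
  exact hZ _ (ha _ _ (hτ _ hy.2) _)

theorem form_loc_goldstone (β : InvariantForm ρ) {a : B.AdForm} (ha : 𝒬.IsGoldstoneValued β a)
    (hτ : ∀ x ∈ τ.dom, τ.sec x ∈ 𝒬.Q x) (i : Fin n) {y : Coord n} (hy : y ∈ B.patch c τ)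
    {Z : ρ.lie} (hZ : Z ∈ ρ.lieH z₀) :
    β.toBilin (a.loc c σ i y)
      (ρ.Ad (B.diff (σ.sec (c.symm y)) (τ.sec (c.symm y))) Z) = 0 := by
  rw [a.loc_eq_Ad c σ τ, β.invariant]
  exact ha _ _ (hτ _ hy.2) _ _ hZ

theorem loc_apply_eq_zero {a : B.AdForm} (ha : 𝒬.IsAdQValued a)
    (c : OpenPartialHomeomorph M (Coord n)) (σ : B.Gauge) (i : Fin n) (y : Coord n) : (a.loc c σ i y).1 (𝒬.loc c σ y) = 0 := by
  obtain ⟨τ, hx, hτ⟩ := 𝒬.exists_gauge (c.symm y)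
  rw [a.loc_eq_Ad c σ τ, loc, 𝒬.vacuumSection_eq (hτ _ hx), ρ.Ad_apply_map]
  have h : (a.loc c τ i y).1 z₀ = 0 :=
    OrthogonalRep.apply_eq_zero_of_mem_lieH (ha _ _ (hτ _ hx) _)
  rw [h, map_zero]

theorem inner_loc_eq_zero {β : InvariantForm ρ} {φ : B.HiggsField} (hφ : 𝒬.IsPhysical β φ)
    (c : OpenPartialHomeomorph M (Coord n)) (σ : B.Gauge) (y : Coord n) (X : ρ.lie) :
    ⟪φ.loc c σ y, X.1 (𝒬.loc c σ y)⟫_ℝ = 0 := by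
  obtain ⟨τ, hx, hτ⟩ := 𝒬.exists_gauge (c.symm y)
  rw [φ.loc_eq_map c σ τ, loc, 𝒬.vacuumSection_eq (hτ _ hx)]
  generalize B.diff (σ.sec (c.symm y)) (τ.sec (c.symm y)) = p
  -- Transporting to `Q` replaces `X` by `Ad(p⁻¹) X`, which is harmless because orthogonality there
  -- holds against all of `Lie(G)`.
  have h := (β.mem_physHiggs_iff.1 (hφ _ _ (hτ _ hx))) (ρ.Ad p⁻¹ X)
  rw [ρ.inner_map_left]
  rw [OrthogonalRep.coe_Ad, inv_inv] at h
  exact h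

end Vacuum

end PrincipalBundle

end YMH

namespace YMH

universe u

/-! ### The equivalence on one coordinate patch -/

namespace PrincipalBundle

variable {n : ℕ} {M : Type*} [TopologicalSpace M] [ChartedSpace (Coord n) M]
  {G : Type*} [Group G] [TopologicalSpace G]
  {W : Type*} [NormedAddCommGroup W] [InnerProductSpace ℝ W] [FiniteDimensional ℝ W]
  {ρ : OrthogonalRep G W} {B : PrincipalBundle.{u} ρ n M} {z₀ : W} {𝒬 : B.Vacuum z₀}
  {c : OpenPartialHomeomorph M (Coord n)} {σ : B.Gauge}

/-- The equations of motion on a coordinate patch. -/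
theorem residuals_eq_zero_iff [IsManifold 𝓘(ℝ, Coord n) ∞ M] (g : PseudoMetric n M)
    (β : InvariantForm ρ) {V : W → ℝ} (hV : IsHiggsPotential ρ V) (hz₀ : ∀ z, V z₀ ≤ V z)
    {Ξ : B.Connection} (hΞ : 𝒬.IsVacuumPair Ξ) {aH aG : B.AdForm} {φ : B.HiggsField}
    (hH : 𝒬.IsAdQValued aH) (hG : 𝒬.IsGoldstoneValued β aG) (hφ : 𝒬.IsPhysical β φ)
    (hc : c ∈ charts n M) {r : ℝ} (hr : r ≠ 0) (r' : ℝ) :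
    ((∀ y ∈ B.patch c σ, ∀ l X, LocalVacuumPair.gaugeResidual β (metricMatrix c g.toFun)
        (Ξ.loc c σ) (𝒬.loc c σ) (fun i z => aH.loc c σ i z + aG.loc c σ i z) (aG.loc c σ)
        r y l X = 0) ∧
      ∀ y ∈ B.patch c σ, ∀ w, LocalVacuumPair.higgsResidual V (metricMatrix c g.toFun)
        (Ξ.loc c σ) (𝒬.loc c σ) (aG.loc c σ) (φ.loc c σ) r' y w = 0) ↔
    (∀ y ∈ B.patch c σ, ∀ j, coDerivTwo (metricMatrix c g.toFun) (Ξ.loc c σ)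
        (extCovDeriv (Ξ.loc c σ) (aH.loc c σ)) y j = 0) ∧
      (∀ y ∈ B.patch c σ, ∀ j, coDerivTwo (metricMatrix c g.toFun) (Ξ.loc c σ)
        (extCovDeriv (Ξ.loc c σ) (aG.loc c σ)) y j
        + r • 𝒬.globalMassYM β (c.symm y) (σ.sec (c.symm y)) (aG.loc c σ j y) = 0) ∧
      ∀ y ∈ B.patch c σ, coDerivOne (metricMatrix c g.toFun) (Ξ.loc c σ)
        (covDeriv (Ξ.loc c σ) (φ.loc c σ)) y
        + r' • 𝒬.globalMassH V (c.symm y) (σ.sec (c.symm y)) (φ.loc c σ y) = 0 := by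
  have H := 𝒬.localVacuumPair g hV hz₀ hΞ hc σ
  have haH : ∀ i, ContDiffOn ℝ ∞ (aH.loc c σ i) (B.patch c σ) := aH.smooth σ c hc
  have haG : ∀ i, ContDiffOn ℝ ∞ (aG.loc c σ i) (B.patch c σ) := aG.smooth σ c hc
  have hφs : ContDiffOn ℝ ∞ (φ.loc c σ) (B.patch c σ) := contDiffOn_comp_symm hc (φ.smooth σ)
  have key : ∀ y ∈ B.patch c σ, ∀ l, (∀ X, LocalVacuumPair.gaugeResidual β
      (metricMatrix c g.toFun) (Ξ.loc c σ) (𝒬.loc c σ)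
      (fun i z => aH.loc c σ i z + aG.loc c σ i z) (aG.loc c σ) r y l X = 0) ↔
      coDerivTwo (metricMatrix c g.toFun) (Ξ.loc c σ)
        (extCovDeriv (Ξ.loc c σ) (aH.loc c σ)) y l = 0 ∧
      coDerivTwo (metricMatrix c g.toFun) (Ξ.loc c σ)
        (extCovDeriv (Ξ.loc c σ) (aG.loc c σ)) y l
        + r • 𝒬.globalMassYM β (c.symm y) (σ.sec (c.symm y)) (aG.loc c σ l y) = 0 := by
    intro y hy l
    -- The equations are local, so an adapted frame near the point under consideration suffices.
    obtain ⟨τ, hx, hτ⟩ := 𝒬.exists_gauge (c.symm y)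
    have hs : B.patch c σ ∩ B.patch c τ ⊆ B.patch c σ := inter_subset_left
    rw [(𝒬.adaptedFrame hΞ.2 hc hτ).gaugeResidual_add_eq_zero_iff β
      (fun i => (H.smooth_potential i).mono hs) (fun i j => (H.smooth_metric i j).mono hs)
      (fun z hz => H.det_ne_zero z hz.1) (fun i => (haH i).mono hs) (fun i => (haG i).mono hs)
      (fun i z hz Z hZ => 𝒬.form_loc_adQ β hH hτ i hz.2 hZ)
      (fun i z hz Z hZ => 𝒬.form_loc_goldstone β hG hτ i hz.2 hZ) r ⟨hy, hy.1, hx⟩ l,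
      LocalVacuumPair.gaugeResidual_eq_zero_iff β (𝒬.form_globalMassYM β σ y _)]
  have hhiggs : ∀ y ∈ B.patch c σ, _ := fun y hy =>
    H.higgsResidual_eq_zero_iff hV haG hφs (fun z _ => 𝒬.inner_loc_eq_zero hφ c σ z) (r := r') hy
      (𝒬.inner_globalMassH hV σ y (φ.loc c σ y))
  constructor
  · rintro ⟨h1, h2⟩
    exact ⟨fun y hy l => ((key y hy l).1 (h1 y hy l)).1, fun y hy l => ((key y hy l).1 (h1 y hy l)).2,
      fun y hy => ((hhiggs y hy).1 (h2 y hy)).2⟩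
  · rintro ⟨h1, h2, h3⟩
    have h4 := fun y hy l => (key y hy l).2 ⟨h1 y hy l, h2 y hy l⟩
    -- The extra condition `δ(aG v) = 0` needed for the full Higgs residual is recovered from the
    -- gauge equations just assembled.
    exact ⟨h4, fun y hy => (hhiggs y hy).2 ⟨H.coDerivOne_action_eq_zero β hr
      (fun i => contDiffOn_fun_add (F := ρ.lie) (haH i) (haG i)) haG h4 hy, h3 y hy⟩⟩

/-- The Euler-Lagrange equations up to second order on a coordinate patch. -/
theorem exists_hasDerivAt_action_iff_residuals [IsManifold 𝓘(ℝ, Coord n) ∞ M]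
    (g : PseudoMetric n M) (k : Normalization)
    (β : InvariantForm ρ) {V : W → ℝ} (hV : IsHiggsPotential ρ V) (hz₀ : ∀ z, V z₀ ≤ V z)
    {Ξ : B.Connection} (hΞ : 𝒬.IsVacuumPair Ξ) {aH aG : B.AdForm} {φ : B.HiggsField}
    {A : ℝ → B.Connection} {Φ : ℝ → B.HiggsField} (hfl : 𝒬.IsFluctuation β Ξ aH aG φ A Φ)
    (hc : c ∈ charts n M) :
    (∀ K : Set (Coord n), IsCompact K → K ⊆ B.patch c σ →
      ∀ (α : Fin n → Coord n → ρ.lie) (ψ : Coord n → W),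
      (∀ i, ContDiff ℝ ∞ (α i) ∧ tsupport (α i) ⊆ K) → ContDiff ℝ ∞ ψ → tsupport ψ ⊆ K →
      ∃ D : ℝ → ℝ,
        (∀ t ∈ Icc (0 : ℝ) 1, HasDerivAt
          (fun ε : ℝ => action k β V (metricMatrix c g.toFun) K
            (fun i y => (A t).loc c σ i y + ε • α i y) (fun y => (Φ t).loc c σ y + ε • ψ y)) (D t) 0)
        ∧ D =O[𝓝[Icc 0 1] 0] fun t => t ^ 2) ↔
    (∀ y ∈ B.patch c σ, ∀ l X, LocalVacuumPair.gaugeResidual β (metricMatrix c g.toFun)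
        (Ξ.loc c σ) (𝒬.loc c σ) (fun i z => aH.loc c σ i z + aG.loc c σ i z) (aG.loc c σ)
        (k.s * k.cH / (2 * k.cYM)) y l X = 0) ∧
      ∀ y ∈ B.patch c σ, ∀ w, LocalVacuumPair.higgsResidual V (metricMatrix c g.toFun)
        (Ξ.loc c σ) (𝒬.loc c σ) (aG.loc c σ) (φ.loc c σ) (k.s * k.cV / (2 * k.cH)) y w = 0 := by
  have H := 𝒬.localVacuumPair g hV hz₀ hΞ hc σ
  have haG : ∀ i, ContDiffOn ℝ ∞ (aG.loc c σ i) (B.patch c σ) := aG.smooth σ c hc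
  have ha : ∀ i, ContDiffOn ℝ ∞ (fun z => aH.loc c σ i z + aG.loc c σ i z) (B.patch c σ) :=
    fun i => contDiffOn_fun_add (F := ρ.lie) (aH.smooth σ c hc i) (haG i)
  have hφs : ContDiffOn ℝ ∞ (φ.loc c σ) (B.patch c σ) := contDiffOn_comp_symm hc (φ.smooth σ)
  have hA : ∀ t ∈ Icc (0 : ℝ) 1, ∀ i, ∀ y ∈ B.patch c σ, (A t).loc c σ i y =
      Ξ.loc c σ i y + t • (aH.loc c σ i y + aG.loc c σ i y) := fun t ht i y hy =>
    congrArg (fun θ : TangentSpace 𝓘(ℝ, Coord n) (c.symm y) →ₗ[ℝ] ρ.lie =>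
      θ (mfderiv 𝓘(ℝ, Coord n) 𝓘(ℝ, Coord n) c.symm y (basisVec i)))
      (hfl.connection t ht σ (c.symm y) hy.2)
  have hΦ : ∀ t ∈ Icc (0 : ℝ) 1, ∀ y ∈ B.patch c σ, (Φ t).loc c σ y =
      𝒬.loc c σ y + t • φ.loc c σ y := fun t ht y _ => hfl.field t ht _ _
  rw [← H.integral_linearizedVariation_eq_zero_iff hV.smooth k β ha haG
    (fun i y _ => by
      rw [Submodule.coe_add, add_apply, 𝒬.loc_apply_eq_zero hfl.adQ, zero_add])
    hφs fun y _ => 𝒬.inner_loc_eq_zero hfl.physical c σ y]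
  refine forall_congr' fun K => forall_congr' fun hK => forall_congr' fun hKU =>
    forall_congr' fun α => forall_congr' fun ψ => forall_congr' fun hα => forall_congr' fun hψ =>
    forall_congr' fun _ => ?_
  exact H.exists_hasDerivAt_action_iff hV.smooth k β ha (fun i => (hα i).1.contDiffOn) hφs
    hψ.contDiffOn hK hKU hA hΦ

end PrincipalBundle

end YMH

/-! ### The equivalence over all patches -/

open YMH in
theorem mainTheorem4
    {n : ℕ} {M : Type*} [TopologicalSpace M] [ChartedSpace (Coord n) M]
    [IsManifold 𝓘(ℝ, Coord n) ∞ M] [T2Space M] [ParacompactSpace M] [ConnectedSpace M]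
    (g : PseudoMetric n M)
    {G : Type*} [Group G] [TopologicalSpace G] [IsTopologicalGroup G] [CompactSpace G]
    {W : Type*} [NormedAddCommGroup W] [InnerProductSpace ℝ W] [FiniteDimensional ℝ W]
    (ρ : OrthogonalRep G W) (β : InvariantForm ρ)
    (V : W → ℝ) (hV : IsHiggsPotential ρ V)
    (z₀ : W) (hz₀ : ∀ z, V z₀ ≤ V z)
    (B : PrincipalBundle ρ n M) (𝒬 : B.Vacuum z₀)
    (Ξ : B.Connection) (hΞ : 𝒬.IsVacuumPair Ξ)
    (aH aG : B.AdForm) (φ : B.HiggsField)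
    (A : ℝ → B.Connection) (Φ : ℝ → B.HiggsField)
    (hfl : 𝒬.IsFluctuation β Ξ aH aG φ A Φ)
    (k : Normalization) :
    B.EulerLagrangeUpToOrderTwo k β V g A Φ ↔
      PrincipalBundle.MasslessEquation g Ξ aH ∧
      PrincipalBundle.MassiveGaugeEquation (k.s * k.cH / (2 * k.cYM)) 𝒬 β g Ξ aG ∧
      PrincipalBundle.MassiveHiggsEquation (k.s * k.cV / (2 * k.cH)) 𝒬 V g Ξ φ := by
  have hr : k.s * k.cH / (2 * k.cYM) ≠ 0 := by
    have h1 : k.s ≠ 0 := by rcases k.s_sign with h | h <;> rw [h] <;> norm_num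
    have h2 := k.cH_pos.ne'
    have h3 := k.cYM_pos.ne'
    positivity
  have key := fun c (hc : c ∈ charts n M) (σ : B.Gauge) =>
    (PrincipalBundle.exists_hasDerivAt_action_iff_residuals (σ := σ) g k β hV hz₀ hΞ hfl hc).trans
      (PrincipalBundle.residuals_eq_zero_iff g β hV hz₀ hΞ hfl.adQ hfl.goldstone hfl.physical hc hr
        (k.s * k.cV / (2 * k.cH)))
  constructor
  · intro h
    exact ⟨fun c hc σ => ((key c hc σ).1 (h c hc σ)).1,
      fun c hc σ => ((key c hc σ).1 (h c hc σ)).2.1, fun c hc σ => ((key c hc σ).1 (h c hc σ)).2.2⟩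
  · rintro ⟨h1, h2, h3⟩ c hc σ
    exact (key c hc σ).2 ⟨h1 c hc σ, h2 c hc σ, h3 c hc σ⟩
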